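/- Let $n\ge 1$ and $q\in(0,1)$. Let $\mathrm{Pol}(\mathrm{Mat}_n)_q$ be the unital complex $*$-algebra with generators $z_a^\alpha$, $1\le a,\alpha\le n$, subject to the relations (together with their adjoints) $$z_a^\alpha z_b^\beta=q\,z_b^\beta z_a^\alpha\quad(a=b,\ \alpha<\beta\ \text{ or }\ a<b,\ \alpha=\beta),\qquad z_a^\alpha z_b^\beta=z_b^\beta z_a^\alpha\quad(\alpha<\beta,\ a>b),$$ $$z_a^\alpha z_b^\beta-z_b^\beta z_a^\alpha=(q-q^{-1})\,z_a^\beta z_b^\alpha\quad(\alpha<\beta,\ a<b),$$ $$(z_b^\beta)^*z_a^\alpha=q^2\sum_{a',b'=1}^n\sum_{\alpha',\beta'=1}^n R_{ba}^{b'a'}R_{\beta\alpha}^{\beta'\alpha'}\,z_{a'}^{\alpha'}(z_{b'}^{\beta'})^*+(1-q^2)\delta_{ab}\delta^{\alpha\beta},$$ where $R_{ij}^{kl}=q^{-1}$ if $i\ne j$, $i=k$, $j=l$; $R_{ij}^{kl}=1$ if $i=j=k=l$; $R_{ij}^{kl}=-(q^{-2}-1)$ if $i=j$, $k=l>j$;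 and $R_{ij}^{kl}=0$ otherwise. A $*$-representation is a unital $*$-homomorphism into the bounded operators on a complex Hilbert space; it is irreducible if the space is non-zero and has no closed invariant subspaces other than $0$ and itself; equivalence is unitary equivalence. *Fock representation.* On $\ell^2(\mathbb Z_+)$ let $Se_m=e_{m+1}$, $C_qe_m=\sqrt{1-q^{2m}}\,e_m$, $D_qe_m=q^me_m$, and $T_{11}=S^*C_q$, $T_{12}=-qD_q$, $T_{21}=D_q$, $T_{22}=C_qS$; these lie in the $C^*$-algebra $C^*(S)$ generated by $S$. Let the boxes of an $n\times n$ grid (rows $1,\dots,n$ from top to bottom, columns $1,\dots,n$ from left to right) index the factors of $C^*(S)^{\otimes n^2}$, acting on $\ell^2(\mathbb Z_+)^{\otimes n^2}$. Consider paths that enter the grid from below at the bottom of column $a$ and leave it at the right end of row $\alpha$, and that leave each visited box through its top or its right side. Such a path contributes the elementary tensor with factor $T_{21}$ at boxes crossed from the bottom to the top, $T_{22}$ from the bottom to the right, $T_{12}$ from the left to the right, $T_{11}$ from the left to the top, and $I$ at boxes not visited. Let $\pi_F(z_a^\alpha)$ be $(-q)^{a-n}$ times the sum of these tensors over all such paths.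 *Admissible sequences.* A sequence of pairs $\mathbf k_\varphi=[(k_n,\varphi_n),\dots,(k_1,\varphi_1)]$ with $k_j\in\mathbb Z_{\ge0}$, $\varphi_j\in[0,2\pi)$ is admissible if, with $M_j=\max\big(\{j\}\cup\{k_i+j+1-i: j<i\le n\}\big)$, one has $0\le k_j\le M_j$ for all $j$, and $\varphi_j=0$ whenever $k_j=M_j$. In row $j$ of its grid the last $k_j$ boxes are white and the other boxes are gray; the gray box in column $n-k_j$ (if $k_j<n$) carries the angle $\varphi_j$, all other gray boxes carry the angle $0$. *Theorem.* 1. $\pi_F$ extends uniquely to a $*$-representation of $\mathrm{Pol}(\mathrm{Mat}_n)_q$, with image in $C^*(S)^{\otimes n^2}$; the vector $e_0\otimes\cdots\otimes e_0$ is cyclic and is annihilated by all $\pi_F(z_a^\alpha)^*$ (so $\pi_F$ is the Fock representation). 2. For each admissible $\mathbf k_\varphi$, applying to each gray tensor factor with angle $\vartheta$ the character $\tau_\vartheta:C^*(S)\to\mathbb C$, $\tau_\vartheta(S)=e^{i\vartheta}$ (and the identity to the white factors), is a well-defined $*$-homomorphism on $C^*(S)^{\otimes n^2}$, and its composition with $\pi_F$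 is a $*$-representation $\pi_{\mathbf k_\varphi}$ on $\ell^2(\mathbb Z_+)^{\otimes(k_1+\cdots+k_n)}$. 3. The map $\mathbf k_\varphi\mapsto[\pi_{\mathbf k_\varphi}]$ is a bijection from the set of admissible sequences of pairs onto the set of equivalence classes of irreducible $*$-representations of $\mathrm{Pol}(\mathrm{Mat}_n)_q$. That is, every $\pi_{\mathbf k_\varphi}$ is irreducible, $\pi_{\mathbf k_\varphi}$ and $\pi_{\mathbf k'_{\varphi'}}$ are equivalent only if $\mathbf k_\varphi=\mathbf k'_{\varphi'}$, and every irreducible $*$-representation is equivalent to some $\pi_{\mathbf k_\varphi}$. -/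

import Mathlib

open scoped ComplexConjugate InnerProductSpace ENNReal

noncomputable section

namespace QMat

/-! ## The `*`-algebra `Pol(Mat_n)_q`

Indices run over `Fin n`, that is, they are shifted by one with respect to the usual `1, …, n`.
A generator `z_a^α` has the lower index `a` and the upper index `α`, written in this order. -/

/-- The generators: `Sum.inl (a, α)` is `z_a^α` and `Sum.inr (a, α)` is `(z_a^α)^*`. -/
abbrev Gen (n : ℕ) : Type := (Fin n × Fin n) ⊕ (Fin n × Fin n)

/-- The free unital complex algebra on the generators. -/
abbrev Free (n : ℕ) : Type := FreeAlgebra ℂ (Gen n)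

/-- The free generator `z_a^α`. -/
def fz {n : ℕ} (a α : Fin n) : Free n := FreeAlgebra.ι ℂ (Sum.inl (a, α))

/-- The free generator `(z_a^α)^*`. -/
def fzs {n : ℕ} (a α : Fin n) : Free n := FreeAlgebra.ι ℂ (Sum.inr (a, α))

/-- The coefficients `R_{ij}^{kl}`. -/
def RCoeff {n : ℕ} (q : ℝ) (i j k l : Fin n) : ℝ :=
  if i ≠ j ∧ i = k ∧ j = l then q⁻¹
  else if i = j ∧ j = k ∧ k = l then 1
  else if i = j ∧ k = l ∧ j < l then -(q⁻¹ ^ 2 - 1)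
  else 0

/-- The defining relations of `Pol(Mat_n)_q`. -/
inductive Rel (n : ℕ) (q : ℝ) : Free n → Free n → Prop
  | sameLower (a α β : Fin n) (h : α < β) :
      Rel n q (fz a α * fz a β) ((q : ℂ) • (fz a β * fz a α))
  | sameUpper (a b α : Fin n) (h : a < b) :
      Rel n q (fz a α * fz b α) ((q : ℂ) • (fz b α * fz a α))
  | comm (a b α β : Fin n) (h : α < β) (h' : b < a) :
      Rel n q (fz a α * fz b β) (fz b β * fz a α)
  | cross (a b α β : Fin n) (h : α < β) (h' : a < b) :
      Rel n q (fz a α * fz b β - fz b β * fz a α)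
        (((q - q⁻¹ : ℝ) : ℂ) • (fz a β * fz b α))
  | sameLowerStar (a α β : Fin n) (h : α < β) :
      Rel n q (fzs a β * fzs a α) ((q : ℂ) • (fzs a α * fzs a β))
  | sameUpperStar (a b α : Fin n) (h : a < b) :
      Rel n q (fzs b α * fzs a α) ((q : ℂ) • (fzs a α * fzs b α))
  | commStar (a b α β : Fin n) (h : α < β) (h' : b < a) :
      Rel n q (fzs b β * fzs a α) (fzs a α * fzs b β)
  | crossStar (a b α β : Fin n) (h : α < β) (h' : a < b) :
      Rel n q (fzs b β * fzs a α - fzs a α * fzs b β)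
        (((q - q⁻¹ : ℝ) : ℂ) • (fzs b α * fzs a β))
  | mixed (a b α β : Fin n) :
      Rel n q (fzs b β * fz a α)
        (((q ^ 2 : ℝ) : ℂ) • (∑ a' : Fin n, ∑ b' : Fin n, ∑ α' : Fin n, ∑ β' : Fin n,
            ((RCoeff q b a b' a' * RCoeff q β α β' α' : ℝ) : ℂ) • (fz a' α' * fzs b' β'))
          + ((if a = b ∧ α = β then 1 - q ^ 2 else 0 : ℝ) : ℂ) • (1 : Free n))

/-- The algebra `Pol(Mat_n)_q`. -/
def Pol (n : ℕ) (q : ℝ) : Type := RingQuot (Rel n q)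

instance (n : ℕ) (q : ℝ) : Ring (Pol n q) := inferInstanceAs (Ring (RingQuot (Rel n q)))

instance (n : ℕ) (q : ℝ) : Algebra ℂ (Pol n q) :=
  inferInstanceAs (Algebra ℂ (RingQuot (Rel n q)))

/-- The quotient map from the free algebra. -/
def polMk (n : ℕ) (q : ℝ) : Free n →ₐ[ℂ] Pol n q := RingQuot.mkAlgHom ℂ (Rel n q)

theorem polMk_surjective (n : ℕ) (q : ℝ) : Function.Surjective (polMk n q) :=
  RingQuot.mkAlgHom_surjective ℂ (Rel n q)

theorem polMk_rel {n : ℕ} {q : ℝ} {x y : Free n} (h : Rel n q x y) : polMk n q x = polMk n q y :=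
  RingQuot.mkAlgHom_rel ℂ h

/-- The generator `z_a^α` of `Pol(Mat_n)_q`. -/
def z {n : ℕ} (q : ℝ) (a α : Fin n) : Pol n q := polMk n q (fz a α)

/-! The involution is the conjugate linear anti-automorphism that exchanges `z_a^α` and
`(z_a^α)^*`. It is built as a ring homomorphism to the opposite ring. -/

/-- The opposite algebra with conjugated scalars. -/
@[reducible] def conjOp (n : ℕ) (q : ℝ) : Algebra ℂ (Pol n q)ᵐᵒᵖ :=
  Algebra.compHom (Pol n q)ᵐᵒᵖ (starRingEnd ℂ)

/-- The involution on the free algebra, with values in the quotient. -/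
def preStar (n : ℕ) (q : ℝ) : Free n →+* (Pol n q)ᵐᵒᵖ :=
  letI := conjOp n q
  (FreeAlgebra.lift ℂ
    (fun x : Gen n => MulOpposite.op (polMk n q (FreeAlgebra.ι ℂ x.swap)))).toRingHom

theorem preStar_ι {n : ℕ} (q : ℝ) (x : Gen n) :
    preStar n q (FreeAlgebra.ι ℂ x) = MulOpposite.op (polMk n q (FreeAlgebra.ι ℂ x.swap)) := by
  let := conjOp n q
  exact FreeAlgebra.lift_ι_apply _ _

theorem preStar_fz {n : ℕ} (q : ℝ) (a α : Fin n) :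
    preStar n q (fz a α) = MulOpposite.op (polMk n q (fzs a α)) := preStar_ι q _

theorem preStar_fzs {n : ℕ} (q : ℝ) (a α : Fin n) :
    preStar n q (fzs a α) = MulOpposite.op (polMk n q (fz a α)) := preStar_ι q _

theorem preStar_algebraMap {n : ℕ} (q : ℝ) (c : ℂ) :
    preStar n q (algebraMap ℂ (Free n) c) =
      MulOpposite.op (algebraMap ℂ (Pol n q) (conj c)) := by
  let := conjOp n q
  exact AlgHom.commutes (FreeAlgebra.lift ℂ
    (fun x : Gen n => MulOpposite.op (polMk n q (FreeAlgebra.ι ℂ x.swap)))) c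

theorem preStar_smul {n : ℕ} (q : ℝ) (c : ℂ) (x : Free n) :
    preStar n q (c • x) = conj c • preStar n q x := by
  rw [Algebra.smul_def, map_mul, preStar_algebraMap, Algebra.smul_def]
  rfl

theorem RCoeff_symm {n : ℕ} (q : ℝ) (i j k l : Fin n) : RCoeff q i j k l = RCoeff q j i l k := by
  unfold RCoeff
  grind

theorem preStar_rel {n : ℕ} {q : ℝ} {x y : Free n} (h : Rel n q x y) :
    preStar n q x = preStar n q y := by
  cases h with
  | sameLower a α β h =>
    have := congrArg MulOpposite.op (polMk_rel (Rel.sameLowerStar (q := q) a α β h))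
    simp only [map_mul, map_smul, preStar_smul, preStar_fz, Complex.conj_ofReal,
      MulOpposite.op_mul, MulOpposite.op_smul] at this ⊢
    exact this
  | sameUpper a b α h =>
    have := congrArg MulOpposite.op (polMk_rel (Rel.sameUpperStar (q := q) a b α h))
    simp only [map_mul, map_smul, preStar_smul, preStar_fz, Complex.conj_ofReal,
      MulOpposite.op_mul, MulOpposite.op_smul] at this ⊢
    exact this
  | comm a b α β h h' =>
    have := congrArg MulOpposite.op (polMk_rel (Rel.commStar (q := q) a b α β h h'))
    simp only [map_mul, preStar_fz, MulOpposite.op_mul] at this ⊢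
    exact this
  | cross a b α β h h' =>
    have := congrArg MulOpposite.op (polMk_rel (Rel.crossStar (q := q) a b α β h h'))
    simp only [map_sub, map_mul, map_smul, preStar_smul, preStar_fz, Complex.conj_ofReal,
      MulOpposite.op_sub, MulOpposite.op_mul, MulOpposite.op_smul] at this ⊢
    exact this
  | sameLowerStar a α β h =>
    have := congrArg MulOpposite.op (polMk_rel (Rel.sameLower (q := q) a α β h))
    simp only [map_mul, map_smul, preStar_smul, preStar_fzs, Complex.conj_ofReal,
      MulOpposite.op_mul, MulOpposite.op_smul] at this ⊢
    exact this
  | sameUpperStar a b α h =>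
    have := congrArg MulOpposite.op (polMk_rel (Rel.sameUpper (q := q) a b α h))
    simp only [map_mul, map_smul, preStar_smul, preStar_fzs, Complex.conj_ofReal,
      MulOpposite.op_mul, MulOpposite.op_smul] at this ⊢
    exact this
  | commStar a b α β h h' =>
    have := congrArg MulOpposite.op (polMk_rel (Rel.comm (q := q) a b α β h h'))
    simp only [map_mul, preStar_fzs, MulOpposite.op_mul] at this ⊢
    exact this
  | crossStar a b α β h h' =>
    have := congrArg MulOpposite.op (polMk_rel (Rel.cross (q := q) a b α β h h'))
    simp only [map_sub, map_mul, map_smul, preStar_smul, preStar_fzs, Complex.conj_ofReal,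
      MulOpposite.op_sub, MulOpposite.op_mul, MulOpposite.op_smul] at this ⊢
    exact this
  | mixed a b α β =>
    have := congrArg MulOpposite.op (polMk_rel (Rel.mixed (q := q) b a β α))
    simp only [map_add, map_sum, map_mul, map_smul, map_one, preStar_smul, preStar_fzs,
      preStar_fz, Complex.conj_ofReal, MulOpposite.op_add, Finset.op_sum,
      MulOpposite.op_mul, MulOpposite.op_smul, MulOpposite.op_one] at this ⊢
    rw [this]
    congr 1
    · congr 1
      rw [Finset.sum_comm]
      refine Finset.sum_congr rfl fun a' _ => Finset.sum_congr rfl fun b' _ => ?_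
      rw [Finset.sum_comm]
      refine Finset.sum_congr rfl fun α' _ => Finset.sum_congr rfl fun β' _ => ?_
      rw [RCoeff_symm q a b, RCoeff_symm q α β]
    · simp only [eq_comm]

/-- The involution as a ring homomorphism to the opposite ring. -/
def starHom (n : ℕ) (q : ℝ) : Pol n q →+* (Pol n q)ᵐᵒᵖ :=
  RingQuot.lift ⟨preStar n q, fun {_ _} h => preStar_rel h⟩

theorem starHom_mk {n : ℕ} (q : ℝ) (x : Free n) :
    starHom n q (polMk n q x) = preStar n q x := by
  have h : polMk n q x = RingQuot.mkRingHom (Rel n q) x := by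
    rw [← RingQuot.mkAlgHom_coe ℂ (Rel n q)]; rfl
  rw [h]
  exact RingQuot.lift_mkRingHom_apply _ _ _

instance (n : ℕ) (q : ℝ) : Star (Pol n q) := ⟨fun x => (starHom n q x).unop⟩

theorem star_def {n : ℕ} {q : ℝ} (x : Pol n q) : star x = (starHom n q x).unop := rfl

theorem star_mk {n : ℕ} (q : ℝ) (x : Free n) :
    star (polMk n q x) = (preStar n q x).unop := by
  rw [star_def, starHom_mk]

theorem polStar_mul {n : ℕ} {q : ℝ} (x y : Pol n q) : star (x * y) = star y * star x := by
  simp [star_def]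

theorem polStar_add {n : ℕ} {q : ℝ} (x y : Pol n q) : star (x + y) = star x + star y := by
  simp [star_def]

theorem polStar_polStar {n : ℕ} {q : ℝ} (x : Pol n q) : star (star x) = x := by
  obtain ⟨x, rfl⟩ := polMk_surjective n q x
  induction x using FreeAlgebra.induction with
  | grade0 c =>
    rw [star_mk, preStar_algebraMap, MulOpposite.unop_op, ← AlgHom.commutes (polMk n q), star_mk,
      preStar_algebraMap, MulOpposite.unop_op, Complex.conj_conj, AlgHom.commutes]
  | grade1 g => rw [star_mk, preStar_ι, MulOpposite.unop_op, star_mk, preStar_ι]; simp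
  | mul x y hx hy => rw [map_mul, polStar_mul, polStar_mul, hx, hy]
  | add x y hx hy => rw [map_add, polStar_add, polStar_add, hx, hy]

instance (n : ℕ) (q : ℝ) : StarRing (Pol n q) where
  star_involutive := polStar_polStar
  star_mul := polStar_mul
  star_add := polStar_add

instance (n : ℕ) (q : ℝ) : StarModule ℂ (Pol n q) where
  star_smul c x := by
    obtain ⟨x, rfl⟩ := polMk_surjective n q x
    rw [← map_smul, star_mk, star_mk, preStar_smul]
    rfl

theorem star_z {n : ℕ} (q : ℝ) (a α : Fin n) : star (z q a α) = polMk n q (fzs a α) := by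
  rw [z, star_mk, preStar_fz, MulOpposite.unop_op]

/-! ## `*`-representations -/

section Representations

variable {A : Type*} [Ring A] [StarRing A] [Algebra ℂ A]
  {H : Type*} [NormedAddCommGroup H] [InnerProductSpace ℂ H] [CompleteSpace H]
  {H' : Type*} [NormedAddCommGroup H'] [InnerProductSpace ℂ H'] [CompleteSpace H']

/-- A `*`-representation by bounded operators on a Hilbert space is irreducible if the space is
non-zero and the only closed invariant subspaces are `0` and the whole space. -/
def IsIrreducibleRep (π : A →⋆ₐ[ℂ] (H →L[ℂ] H)) : Prop :=
  Nontrivial H ∧ ∀ K : Submodule ℂ H, IsClosed (K : Set H) →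
    (∀ a : A, ∀ v ∈ K, π a v ∈ K) → K = ⊥ ∨ K = ⊤

/-- Unitary equivalence of `*`-representations. -/
def UnitarilyEquivalent (π : A →⋆ₐ[ℂ] (H →L[ℂ] H)) (π' : A →⋆ₐ[ℂ] (H' →L[ℂ] H')) : Prop :=
  ∃ U : H ≃ₗᵢ[ℂ] H', ∀ (a : A) (v : H), U (π a v) = π' a (U v)

end Representations

/-! ## Operators on `ℓ²(ℤ₊)^{⊗ B}`

For a set `B` of tensor factors, the Hilbert space tensor product of copies of `ℓ²(ℤ₊)` indexed by
a finite set `B` is realized as `ℓ²(ℤ₊^B)`: the standard basis vector at `m : B → ℕ` is the tensor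
product of the basis vectors `e_{m b}`. -/

/-- `ℓ²(ℤ₊)^{⊗ B}`. -/
abbrev Ell2 (B : Type) : Type := lp (fun _ : B → ℕ => ℂ) 2

section Operators

variable {B : Type}

theorem memℓp_comp (g : (B → ℕ) → (B → ℕ)) (hg : Function.Injective g) (f : Ell2 B) :
    Memℓp (fun m => f (g m)) 2 := by
  have hf := (memℓp_gen_iff (by simp)).1 (lp.memℓp f)
  exact memℓp_gen (hf.comp_injective hg)

/-- Composition with an injective map of the index set. -/
def compOp (g : (B → ℕ) → (B → ℕ)) (hg : Function.Injective g) : Ell2 B →L[ℂ] Ell2 B :=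
  LinearMap.mkContinuous
    { toFun := fun f => ⟨fun m => f (g m), memℓp_comp g hg f⟩
      map_add' := fun _ _ => rfl
      map_smul' := fun _ _ => rfl } 1 (by
    intro f
    refine lp.norm_le_of_tsum_le (by simp) (by positivity) ?_
    rw [one_mul, lp.norm_rpow_eq_tsum (by simp)]
    have hf := (memℓp_gen_iff (by simp)).1 (lp.memℓp f)
    exact tsum_comp_le_tsum_of_inj hf (fun _ => by positivity) hg)

/-- The diagonal operator with entries `w m` (with value `0` if `w` is unbounded; it is only used
for bounded `w`). -/
def diagOp (w : (B → ℕ) → ℂ) : Ell2 B →L[ℂ] Ell2 B :=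
  open Classical in
  if h : ∃ K : ℝ, 0 ≤ K ∧ ∀ m, ‖w m • ContinuousLinearMap.id ℂ ℂ‖ ≤ K then
    lp.mapCLM 2 (fun m => w m • ContinuousLinearMap.id ℂ ℂ) h.choose_spec.1 h.choose_spec.2
  else 0

theorem diagOp_apply (w : (B → ℕ) → ℂ) (hw : ∃ K : ℝ, ∀ m, ‖w m‖ ≤ K) (f : Ell2 B)
    (m : B → ℕ) : diagOp w f m = w m * f m := by
  have h : ∃ K : ℝ, 0 ≤ K ∧ ∀ m, ‖w m • ContinuousLinearMap.id ℂ ℂ‖ ≤ K := by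
    obtain ⟨K, hK⟩ := hw
    exact ⟨K, (norm_nonneg _).trans (hK m), fun m => by simpa [norm_smul] using hK m⟩
  rw [diagOp, dif_pos h]
  rfl

variable [DecidableEq B]

/-- The backward shift in the tensor factor `b`. -/
def backShift (b : B) : Ell2 B →L[ℂ] Ell2 B :=
  compOp (fun m => m + Pi.single b 1) (add_left_injective _)

/-- The isometric shift `S` (`S e_k = e_{k+1}`) in the tensor factor `b`. -/
def shift (b : B) : Ell2 B →L[ℂ] Ell2 B := ContinuousLinearMap.adjoint (backShift b)

/-- `D_q e_m = q^m e_m` in the tensor factor `b`. -/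
def opD (q : ℝ) (b : B) : Ell2 B →L[ℂ] Ell2 B := diagOp fun m => ((q ^ m b : ℝ) : ℂ)

/-- `C_q e_m = √(1 - q^{2m}) e_m` in the tensor factor `b`. -/
def opC (q : ℝ) (b : B) : Ell2 B →L[ℂ] Ell2 B :=
  diagOp fun m => ((Real.sqrt (1 - q ^ (2 * m b)) : ℝ) : ℂ)

/-- `T₁₁ = S^* C_q` in the tensor factor `b`. -/
def T11 (q : ℝ) (b : B) : Ell2 B →L[ℂ] Ell2 B :=
  ContinuousLinearMap.adjoint (shift b) * opC q b

/-- `T₁₂ = -q D_q` in the tensor factor `b`. -/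
def T12 (q : ℝ) (b : B) : Ell2 B →L[ℂ] Ell2 B := (-(q : ℂ)) • opD q b

/-- `T₂₁ = D_q` in the tensor factor `b`. -/
def T21 (q : ℝ) (b : B) : Ell2 B →L[ℂ] Ell2 B := opD q b

/-- `T₂₂ = C_q S` in the tensor factor `b`. -/
def T22 (q : ℝ) (b : B) : Ell2 B →L[ℂ] Ell2 B := opC q b * shift b

/-- The standard basis vector at `m`. -/
def basisVec (m : B → ℕ) : Ell2 B :=
  open Classical in lp.single 2 m (1 : ℂ)

/-- The shift acts on the standard basis as it should. -/
theorem shift_basisVec (b : B) (m : B → ℕ) :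
    shift b (basisVec m) = basisVec (m + Pi.single b 1) := by
  classical
  refine ext_inner_right ℂ fun f => ?_
  rw [shift, ContinuousLinearMap.adjoint_inner_left, basisVec, basisVec,
    lp.inner_single_left, lp.inner_single_left]
  rfl

/-- `C^*(S)^{⊗ B}` (minimal tensor product): the `C^*`-algebra of operators on `ℓ²(ℤ₊)^{⊗ B}`
generated by the shifts in all tensor factors. -/
def Toeplitz (B : Type) [DecidableEq B] : StarSubalgebra ℂ (Ell2 B →L[ℂ] Ell2 B) :=
  (StarAlgebra.adjoin ℂ (Set.range (shift : B → _))).topologicalClosure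

/-- The shift in the tensor factor `b` as an element of `C^*(S)^{⊗ B}`. -/
def toeplitzGen (b : B) : Toeplitz B :=
  ⟨shift b, StarSubalgebra.le_topologicalClosure _
    (StarAlgebra.subset_adjoin ℂ _ (Set.mem_range_self b))⟩

end Operators

/-! ## The Fock representation through paths in the `n × n` grid

The box `(i, a)` lies in the row `i` (rows are numbered from the top to the bottom) and in the
column `a` (columns are numbered from the left to the right). Each box carries one tensor factor. -/

/-- The boxes `(row, column)` of the grid. -/
abbrev Box (n : ℕ) : Type := Fin n × Fin n

/-- The side through which a path enters a box. -/
inductive Side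
  | below
  | left

/-- The sum, over all connected paths that start at a given place and leave the grid on the right
side in row `α`, of the elementary tensors described by the path.

The starting place is the side `s` of the box that has `r - 1` rows above it and `d - 1` columns to
the right of it. In each box a path makes one of the moves
up (entering from below, operator `T₂₁`), hook from below to the right (`T₂₂`),
right (entering from the left, operator `T₁₂`), hook from the left to the top (`T₁₁`);
boxes that are not visited carry the identity. If `d = 0` the path has left the grid
on the right side in row `r`, and if `r = 0 < d` it has left the grid through the top. -/
def pathSum {n : ℕ} (q : ℝ) (α : Fin n) :
    (s : Side) → (r d : ℕ) → r ≤ n → d ≤ n → (Ell2 (Box n) →L[ℂ] Ell2 (Box n))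
  | _, r, 0, _, _ => if r = (α : ℕ) + 1 then 1 else 0
  | _, 0, _ + 1, _, _ => 0
  | .below, r + 1, d + 1, hr, hd =>
      T21 q ((⟨r, by omega⟩, ⟨n - (d + 1), by omega⟩) : Box n) *
          pathSum q α .below r (d + 1) (by omega) hd +
        T22 q ((⟨r, by omega⟩, ⟨n - (d + 1), by omega⟩) : Box n) *
          pathSum q α .left (r + 1) d hr (by omega)
  | .left, r + 1, d + 1, hr, hd =>
      T12 q ((⟨r, by omega⟩, ⟨n - (d + 1), by omega⟩) : Box n) *
          pathSum q α .left (r + 1) d hr (by omega) +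
        T11 q ((⟨r, by omega⟩, ⟨n - (d + 1), by omega⟩) : Box n) *
          pathSum q α .below r (d + 1) (by omega) hd
termination_by _ r d => r + d

/-- The image of `z_a^α` under the Fock representation: `(-q)^{a-n}` times the sum over all paths
from the bottom of column `a` to the right end of row `α`. -/
def fockOp {n : ℕ} (q : ℝ) (a α : Fin n) : Ell2 (Box n) →L[ℂ] Ell2 (Box n) :=
  ((-(q : ℂ)) ^ ((a : ℤ) + 1 - (n : ℤ))) • pathSum q α .below n (n - a) le_rfl (Nat.sub_le _ _)

/-- `π` is the Fock representation in its realization by paths in the grid. -/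
def IsFock {n : ℕ} {q : ℝ} (π : Pol n q →⋆ₐ[ℂ] (Ell2 (Box n) →L[ℂ] Ell2 (Box n))) : Prop :=
  ∀ a α : Fin n, π (z q a α) = fockOp q a α

/-! ## Admissible sequences and their representations -/

/-- `max_{j < i ≤ n} (k_i + j + 1 - i, j)`. As the index `j : Fin n` stands for the integer `j + 1`,
the last entry reads `j + 1`. It is positive, so that truncation of a negative
`k_i + j + 1 - i` at `0` does not matter. -/
def kBound {n : ℕ} (k : Fin n → ℕ) (j : Fin n) : ℕ :=
  max ((j : ℕ) + 1) ((Finset.Ioi j).sup fun i => k i + (j : ℕ) + 1 - (i : ℕ))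

/-- Admissible sequences of pairs `[(k_n, φ_n), …, (k_1, φ_1)]`. -/
@[ext]
structure AdmissibleSeq (n : ℕ) where
  k : Fin n → ℕ
  φ : Fin n → ℝ
  k_le : ∀ j, k j ≤ kBound k j
  φ_mem : ∀ j, φ j ∈ Set.Ico 0 (2 * Real.pi)
  φ_eq_zero : ∀ j, k j = kBound k j → φ j = 0

namespace AdmissibleSeq

variable {n : ℕ} (κ : AdmissibleSeq n)

/-- A box is white if it is among the last `k_i` boxes of its row `i`. -/
def IsWhite (b : Box n) : Prop := n ≤ (b.2 : ℕ) + κ.k b.1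

/-- The white boxes of the grid. -/
abbrev White : Type := {b : Box n // κ.IsWhite b}

/-- The angle of a box that is not white: it is `φ_i` for the (light gray) box directly to the left
of the white boxes of row `i`, and `0` for the remaining (dark gray) boxes. If `k_i` attains its
maximal value, then `φ_i = 0`, so that all boxes of row `i` that are not white get the angle `0`. -/
def angle (b : Box n) : ℝ := if (b.2 : ℕ) + κ.k b.1 + 1 = n then κ.φ b.1 else 0

/-- `θ` applies the characters `τ_φ` (determined by `τ_φ(S) = e^{iφ}`) to the tensor factors of
`C^*(S)^{⊗ n²}` that belong to gray boxes, and the identity map to the white ones. -/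
def IsCharacterMap (θ : Toeplitz (Box n) →⋆ₐ[ℂ] (Ell2 κ.White →L[ℂ] Ell2 κ.White)) : Prop :=
  (∀ b : κ.White, θ (toeplitzGen b.1) = shift b) ∧
  (∀ b : Box n, ¬ κ.IsWhite b →
    θ (toeplitzGen b) = Complex.exp (Complex.I * (κ.angle b : ℂ)) • 1)

/-- `ρ` is the representation that is obtained from the Fock representation `F` by applying the
characters that belong to the gray boxes of the grid of `κ`. -/
def IsGridRep {q : ℝ} (F : Pol n q →⋆ₐ[ℂ] (Ell2 (Box n) →L[ℂ] Ell2 (Box n)))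
    (ρ : Pol n q →⋆ₐ[ℂ] (Ell2 κ.White →L[ℂ] Ell2 κ.White)) : Prop :=
  ∃ θ : Toeplitz (Box n) →⋆ₐ[ℂ] (Ell2 κ.White →L[ℂ] Ell2 κ.White),
    κ.IsCharacterMap θ ∧ ∀ a : Pol n q, ∃ h : F a ∈ Toeplitz (Box n), ρ a = θ ⟨F a, h⟩

end AdmissibleSeq

end QMat

end

open QMat

/-!
The generators are written as `z d α`, where `α` is the row in which the paths leave the grid and
`d = n - 1 - a` is the distance of the column `a`, in which they enter it, from the right side. In
this form the mixed relation involves only the sums `rowMix` over rows and, for equal columns, a sum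
over the columns further to the right (`QMatRel`), so that the columns at distance less than `N`
satisfy the relations by themselves, and the number of columns and the number of rows can be varied
independently of each other. A family of this kind is called a quantum matrix below.

**The sums over paths satisfy the relations.** If `a = T₂₂`, `a^* = T₁₁` and `D = T₂₁` commute with
a quantum matrix, then the replacement of two adjacent columns by the combinations which a box makes
of them leads to a quantum matrix again (`QMatRel.exchange`), and so does the addition of a row
together with a column whose only non-zero entry is `1` (`QMatRel.appendCol`). The sums over paths
arise from nothing by these two steps (`BoxRel.qMatRel`). The same argument applies to grids in
which some boxes are gray, i.e. have `a` a phase and `D = 0`.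

**Classification.** The bottom row of the grid is the last row of the quantum matrix, and it is
peeled off. Let `x_d = z d m`, `d < N`, be the generators of the last row of an irreducible
representation. A normal operator that commutes with all generators up to scalars is zero or
injective. This applies to `1 - ∑_{e < N} x_e x_e^*`. If it vanishes, then it also applies to the
leftmost generator of the row and, as long as the generators vanish, to the next ones from the left.
This gives a number `c` of white boxes: `x_d = 0` for `d > c`, and `x_c` is injective if `c < N`
(`IrrFam.exists_lastRow`). The common kernel of the `x_d^*` with `d < c` is not zero, because a
bounded `q`-oscillator without vacuum is unitary and would force the remaining generators of the
row to vanish (`oscillator`, `LastRow.lastVac_ne_bot`). On this kernel `x_c` is unitary, and it is a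
scalar of modulus one by Schur's lemma (`LastRow.exists_scalar`); the other generators of its column
vanish there. The remaining ones preserve the kernel, and after a change of normalization they form
an irreducible quantum matrix with one row less and, if `c < N`, with one column less
(`IrrFam.exists_rowExt`).

Conversely the smaller quantum matrix, `c` and the scalar determine the larger one: the relations
express all inner products and the action of all generators on the vectors that are generated from
the kernel by `x_d`, `d < c` (`RowExt.unique`). They are determined by it (`RowExt.invariants`), and
irreducibility of the smaller one implies that of the larger one (`RowExt.irreducible`). Iteration
down to a one-dimensional space classifies the irreducible representations by sequences of pairs
(`Iter`), and the condition that `c` does not exceed the number of remaining columns is the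
admissibility of the sequence, since the bounds `kBound` obey the same recursion as the numbers of
columns (`kBound_eq_nextCols`).

**The grids realize all sequences.** The operators of a grid arise from those of the grid without
its bottom row by adding a row in the above sense, the kernel being the vacuum of the white boxes of
the bottom row (`gridFam_rowExt`). In particular the Fock representation, all boxes of which are
white, is irreducible, and its vacuum vector is cyclic.

**Character maps.** A vector with a wave packet of width `N` in each gray box is, as `N → ∞`, an
approximate eigenvector of the shifts of these boxes. The pairs of operators that are intertwined by
such isometric embeddings in the limit form a `C^*`-algebra, on which the first projection is
injective; hence its range is closed and contains `C^*(S)^{⊗ n²}`, and the inverse followed by the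
second projection is the character map (`exists_character_map`). Its values at `C_q` and `D_q` are
determined by those at the shifts because `D_q` and `C_q - 1` are norm limits of combinations of the
projections `S^k S^{*k} - S^{k+1} S^{*(k+1)}`.
-/

noncomputable section

namespace QMat

/-! ### Families satisfying the quantum matrix relations -/

section Relations

variable {A : Type*} [Ring A] [Algebra ℂ A]

/-- The effect of the upper indices in the mixed relation, `f α' β'` being
`z_d^{α'} (z_e^{β'})^*`. -/
def rowMix (Q : ℂ) (m α β : ℕ) (f : ℕ → ℕ → A) : A :=
  if α = β then Q • f α α - (Q⁻¹ - Q) • ∑ γ ∈ Finset.Ioo α m, f γ γ else f α β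

theorem rowMix_add (Q : ℂ) (m α β : ℕ) (f g : ℕ → ℕ → A) :
    rowMix Q m α β (fun i j => f i j + g i j) = rowMix Q m α β f + rowMix Q m α β g := by
  unfold rowMix
  split_ifs
  · rw [Finset.sum_add_distrib]; module
  · rfl

theorem rowMix_smul (Q c : ℂ) (m α β : ℕ) (f : ℕ → ℕ → A) :
    rowMix Q m α β (fun i j => c • f i j) = c • rowMix Q m α β f := by
  unfold rowMix
  split_ifs
  · rw [← Finset.smul_sum]; module
  · rfl

theorem rowMix_mul (Q : ℂ) (m α β : ℕ) (t : A) (f : ℕ → ℕ → A) :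
    rowMix Q m α β (fun i j => t * f i j) = t * rowMix Q m α β f := by
  unfold rowMix
  split_ifs
  · rw [← Finset.mul_sum, mul_sub, mul_smul_comm, mul_smul_comm]
  · rfl

theorem rowMix_congr {Q : ℂ} {m α β : ℕ} (hα : α < m) (hβ : β < m) {f g : ℕ → ℕ → A}
    (h : ∀ i < m, ∀ j < m, f i j = g i j) : rowMix Q m α β f = rowMix Q m α β g := by
  unfold rowMix
  split_ifs
  · rw [h α hα α hα]
    congr 2
    exact Finset.sum_congr rfl fun γ hγ =>
      h _ (Finset.mem_Ioo.1 hγ).2 _ (Finset.mem_Ioo.1 hγ).2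
  · exact h α hα β hβ

/-- The relations of `Pol(Mat)_q` for `N` columns and `m` rows: `z d α` stands for the generator
with upper index `α` whose lower index has the distance `d` from the largest lower index, and
`w d α` stands for its adjoint. -/
structure QMatRel (Q : ℂ) (N m : ℕ) (z w : ℕ → ℕ → A) : Prop where
  row : ∀ d < N, ∀ α β, α < β → β < m → z d α * z d β = Q • (z d β * z d α)
  col : ∀ α < m, ∀ e d, e < d → d < N → z d α * z e α = Q • (z e α * z d α)
  comm : ∀ d e, d < e → e < N → ∀ α β, α < β → β < m → z d α * z e β = z e β * z d α
  cross : ∀ e d, e < d → d < N → ∀ α β, α < β → β < m →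
    z d α * z e β = z e β * z d α + (Q - Q⁻¹) • (z d β * z e α)
  mixed_ne : ∀ d < N, ∀ e < N, d ≠ e → ∀ α < m, ∀ β < m,
    w e β * z d α = rowMix Q m α β fun i j => z d i * w e j
  mixed_eq : ∀ d < N, ∀ α < m, ∀ β < m,
    w d β * z d α = Q • (rowMix Q m α β fun i j => z d i * w d j)
      - (Q⁻¹ - Q) • ∑ c ∈ Finset.range d, (rowMix Q m α β fun i j => z c i * w c j)
      + (if α = β then 1 - Q ^ 2 else 0 : ℂ) • (1 : A)

/-- The columns that are closest to the right form a quantum matrix themselves. -/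
theorem QMatRel.mono {Q : ℂ} {N N' m : ℕ} {z w : ℕ → ℕ → A} (h : QMatRel Q N m z w)
    (hN : N' ≤ N) : QMatRel Q N' m z w where
  row d hd := h.row d (hd.trans_le hN)
  col α hα e d hed hd := h.col α hα e d hed (hd.trans_le hN)
  comm d e hde he := h.comm d e hde (he.trans_le hN)
  cross e d hed hd := h.cross e d hed (hd.trans_le hN)
  mixed_ne d hd e he := h.mixed_ne d (hd.trans_le hN) e (he.trans_le hN)
  mixed_eq d hd := h.mixed_eq d (hd.trans_le hN)

/-- The relations involve only the entries with indices in the given range. -/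
theorem QMatRel.congr {Q : ℂ} {N m : ℕ} {z w z' w' : ℕ → ℕ → A} (h : QMatRel Q N m z w)
    (hz : ∀ d < N, ∀ α < m, z' d α = z d α) (hw : ∀ d < N, ∀ α < m, w' d α = w d α) :
    QMatRel Q N m z' w' where
  row d hd α β hαβ hβ := by
    rw [hz d hd α (hαβ.trans hβ), hz d hd β hβ]; exact h.row d hd α β hαβ hβ
  col α hα e d hed hd := by
    rw [hz d hd α hα, hz e (hed.trans hd) α hα]; exact h.col α hα e d hed hd
  comm d e hde he α β hαβ hβ := by
    rw [hz d (hde.trans he) α (hαβ.trans hβ), hz e he β hβ]; exact h.comm d e hde he α β hαβ hβ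
  cross e d hed hd α β hαβ hβ := by
    rw [hz d hd α (hαβ.trans hβ), hz e (hed.trans hd) β hβ, hz d hd β hβ,
      hz e (hed.trans hd) α (hαβ.trans hβ)]
    exact h.cross e d hed hd α β hαβ hβ
  mixed_ne d hd e he hde α hα β hβ := by
    rw [hz d hd α hα, hw e he β hβ, h.mixed_ne d hd e he hde α hα β hβ]
    exact rowMix_congr hα hβ fun i hi j hj => by rw [hz d hd i hi, hw e he j hj]
  mixed_eq d hd α hα β hβ := by
    rw [hz d hd α hα, hw d hd β hβ, h.mixed_eq d hd α hα β hβ]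
    congr 2
    · congr 1
      exact rowMix_congr hα hβ fun i hi j hj => by rw [hz d hd i hi, hw d hd j hj]
    · congr 1
      refine Finset.sum_congr rfl fun c hc => ?_
      have hc' := (Finset.mem_range.1 hc).trans hd
      exact rowMix_congr hα hβ fun i hi j hj => by rw [hz c hc' i hi, hw c hc' j hj]

theorem comm_mul_mul {t₁ t₂ x y : A} (h : x * t₂ = t₂ * x) :
    t₁ * x * (t₂ * y) = t₁ * t₂ * (x * y) := by
  rw [mul_assoc, ← mul_assoc x, h]; simp only [mul_assoc]

/-- Replacement of the columns `s`, `s + 1` by the combinations that a box with the operators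
`a = T₂₂`, `b = T₁₁`, `D = T₂₁` makes of them. -/
def exchange (Q : ℂ) (a b D : A) (s : ℕ) (z : ℕ → ℕ → A) (d α : ℕ) : A :=
  if d = s then a * z s α - Q • (D * z (s + 1) α)
  else if d = s + 1 then D * z s α + b * z (s + 1) α else z d α

end Relations

/-! ### Exchange of two adjacent columns -/

section Relations
set_option linter.unusedSimpArgs false
variable {A : Type*} [Ring A] [Algebra ℂ A]

theorem rowMix_comb {Q : ℂ} {m α β : ℕ} (hα : α < m) (hβ : β < m) (t₀ t₁ s₀ s₁ : A)
    {x₀ x₁ u₀ u₁ : ℕ → A} (h₀₀ : ∀ i < m, x₀ i * s₀ = s₀ * x₀ i)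
    (h₀₁ : ∀ i < m, x₀ i * s₁ = s₁ * x₀ i) (h₁₀ : ∀ i < m, x₁ i * s₀ = s₀ * x₁ i)
    (h₁₁ : ∀ i < m, x₁ i * s₁ = s₁ * x₁ i) :
    (rowMix Q m α β fun i j => (t₀ * x₀ i + t₁ * x₁ i) * (s₀ * u₀ j + s₁ * u₁ j)) =
      t₀ * s₀ * (rowMix Q m α β fun i j => x₀ i * u₀ j) +
      t₀ * s₁ * (rowMix Q m α β fun i j => x₀ i * u₁ j) +
      t₁ * s₀ * (rowMix Q m α β fun i j => x₁ i * u₀ j) +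
      t₁ * s₁ * (rowMix Q m α β fun i j => x₁ i * u₁ j) := by
  rw [← rowMix_mul, ← rowMix_mul, ← rowMix_mul, ← rowMix_mul, ← rowMix_add, ← rowMix_add,
    ← rowMix_add]
  refine rowMix_congr hα hβ fun i hi j hj => ?_
  simp only [mul_add, add_mul, comm_mul_mul (h₀₀ i hi), comm_mul_mul (h₀₁ i hi),
    comm_mul_mul (h₁₀ i hi), comm_mul_mul (h₁₁ i hi)]
  abel

theorem rowMix_comb_left {Q : ℂ} {m α β : ℕ} (t₀ t₁ : A) {x₀ x₁ u : ℕ → A} :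
    (rowMix Q m α β fun i j => (t₀ * x₀ i + t₁ * x₁ i) * u j) =
      t₀ * (rowMix Q m α β fun i j => x₀ i * u j) +
      t₁ * (rowMix Q m α β fun i j => x₁ i * u j) := by
  rw [← rowMix_mul, ← rowMix_mul, ← rowMix_add]
  simp only [add_mul, mul_assoc]

theorem rowMix_comb_right {Q : ℂ} {m α β : ℕ} (hα : α < m) (hβ : β < m) (s₀ s₁ : A)
    {x u₀ u₁ : ℕ → A} (h₀ : ∀ i < m, x i * s₀ = s₀ * x i) (h₁ : ∀ i < m, x i * s₁ = s₁ * x i) :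
    (rowMix Q m α β fun i j => x i * (s₀ * u₀ j + s₁ * u₁ j)) =
      s₀ * (rowMix Q m α β fun i j => x i * u₀ j) +
      s₁ * (rowMix Q m α β fun i j => x i * u₁ j) := by
  rw [← rowMix_mul, ← rowMix_mul, ← rowMix_add]
  refine rowMix_congr hα hβ fun i hi j hj => ?_
  rw [mul_add, ← mul_assoc, h₀ i hi, ← mul_assoc, h₁ i hi, mul_assoc, mul_assoc]

variable {Q : ℂ} {a b D : A} {s : ℕ} {z w : ℕ → ℕ → A}

theorem exchange_left (α : ℕ) :
    exchange Q a b D s z s α = a * z s α + -(Q • D) * z (s + 1) α := by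
  rw [exchange, if_pos rfl, neg_mul, smul_mul_assoc, sub_eq_add_neg]

theorem exchange_right (α : ℕ) :
    exchange Q a b D s z (s + 1) α = D * z s α + b * z (s + 1) α := by
  rw [exchange, if_neg (by omega), if_pos rfl]

theorem exchange_of_ne {d : ℕ} (h : d ≠ s) (h' : d ≠ s + 1) (α : ℕ) :
    exchange Q a b D s z d α = z d α := by
  rw [exchange, if_neg h, if_neg h']

/-- A box that commutes with a quantum matrix turns it into a quantum matrix. -/
theorem QMatRel.exchange {N m : ℕ} (h : QMatRel Q N m z w) (hQ : Q ≠ 0) (hs : s + 1 < N)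
    (hba : b * a = 1 - Q ^ 2 • (D * D)) (hab : a * b = 1 - D * D) (hDa : D * a = Q • (a * D))
    (hbD : b * D = Q • (D * b))
    (hz : ∀ d < N, ∀ α < m, z d α * a = a * z d α ∧ z d α * b = b * z d α ∧ z d α * D = D * z d α)
    (hw : ∀ d < N, ∀ α < m, w d α * a = a * w d α ∧ w d α * b = b * w d α ∧
      w d α * D = D * w d α) :
    QMatRel Q N m (exchange Q a b D s z) (exchange Q b a D s w) := by
  have hs' : s < N := by omega
  have zD : ∀ d < N, ∀ α < m, z d α * -(Q • D) = -(Q • D) * z d α := fun d hd α hα => by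
    simp [(hz d hd α hα).2.2]
  have cases3 : ∀ d, d = s ∨ d = s + 1 ∨ (d ≠ s ∧ d ≠ s + 1) := fun d => by omega
  constructor
  · intro d hd α β hαβ hβ
    have hα := hαβ.trans hβ
    have e1 := h.row s hs' α β hαβ hβ
    have e2 := h.row (s + 1) hs α β hαβ hβ
    have e3 := h.comm s (s + 1) (by omega) hs α β hαβ hβ
    have e4 := h.cross s (s + 1) (by omega) hs α β hαβ hβ
    obtain ⟨c1, c2, c3⟩ := hz s hs' α hα
    obtain ⟨c4, c5, c6⟩ := hz (s + 1) hs α hα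
    obtain ⟨c1', c2', c3'⟩ := hz s hs' β hβ
    obtain ⟨c4', c5', c6'⟩ := hz (s + 1) hs β hβ
    rcases cases3 d with rfl | rfl | ⟨hd1, hd2⟩
    · simp only [exchange_left, mul_add, add_mul, neg_mul, mul_neg, smul_mul_assoc, mul_smul_comm,
        comm_mul_mul c1, comm_mul_mul c3, comm_mul_mul c4, comm_mul_mul c6, comm_mul_mul c1',
        comm_mul_mul c3', comm_mul_mul c4', comm_mul_mul c6', hDa, e1, e2, e3, e4]
      match_scalars <;> field_simp <;> ring
    · simp only [exchange_right, mul_add, add_mul, smul_mul_assoc, mul_smul_comm,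
        comm_mul_mul c2, comm_mul_mul c3, comm_mul_mul c5, comm_mul_mul c6, comm_mul_mul c2',
        comm_mul_mul c3', comm_mul_mul c5', comm_mul_mul c6', hbD, e1, e2, e3, e4]
      match_scalars <;> field_simp <;> ring
    · simp only [exchange_of_ne hd1 hd2]
      exact h.row d hd α β hαβ hβ
  · intro α hα e d hed hd
    have he : e < N := hed.trans hd
    obtain ⟨c1, c2, c3⟩ := hz s hs' α hα
    obtain ⟨c4, c5, c6⟩ := hz (s + 1) hs α hα
    rcases cases3 e with rfl | rfl | ⟨he1, he2⟩ <;> rcases cases3 d with rfl | rfl | ⟨hd1, hd2⟩ <;>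
      try omega
    · have e1 := h.col α hα e (e + 1) hed hd
      simp only [exchange_left, exchange_right, mul_add, add_mul, neg_mul, mul_neg, smul_mul_assoc,
        mul_smul_comm, comm_mul_mul c1, comm_mul_mul c2, comm_mul_mul c3, comm_mul_mul c4,
        comm_mul_mul c5, comm_mul_mul c6, hDa, hbD, hab, hba, e1, sub_mul, one_mul]
      match_scalars <;> ring
    · have e1 := h.col α hα e d hed hd
      have e2 := h.col α hα (e + 1) d (by omega) hd
      obtain ⟨c1, c2, c3⟩ := hz d hd α hα
      rw [exchange_left, exchange_of_ne hd1 hd2, mul_add, add_mul, ← mul_assoc, ← mul_assoc, c1,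
        zD d hd α hα, mul_assoc, mul_assoc, mul_assoc, mul_assoc, e1, e2, mul_smul_comm,
        mul_smul_comm, smul_add]
    · have e1 := h.col α hα s d (by omega) hd
      have e2 := h.col α hα (s + 1) d (by omega) hd
      obtain ⟨c1, c2, c3⟩ := hz d hd α hα
      rw [exchange_right, exchange_of_ne hd1 hd2, mul_add, add_mul, ← mul_assoc, ← mul_assoc, c2,
        c3, mul_assoc, mul_assoc, mul_assoc, mul_assoc, e1, e2, mul_smul_comm, mul_smul_comm,
        smul_add]
    · have e1 := h.col α hα e d hed hd
      have e2 := h.col α hα e (d + 1) (by omega) hs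
      obtain ⟨c1, c2, c3⟩ := hz e he α hα
      rw [exchange_left, exchange_of_ne he1 he2, mul_add, add_mul, ← mul_assoc, ← mul_assoc, c1,
        zD e he α hα, mul_assoc, mul_assoc, mul_assoc, mul_assoc, e1, e2, mul_smul_comm,
        mul_smul_comm, smul_add]
    · have e1 := h.col α hα e s (by omega) hs'
      have e2 := h.col α hα e (s + 1) (by omega) hs
      obtain ⟨c1, c2, c3⟩ := hz e he α hα
      rw [exchange_right, exchange_of_ne he1 he2, mul_add, add_mul, ← mul_assoc, ← mul_assoc, c2,
        c3, mul_assoc, mul_assoc, mul_assoc, mul_assoc, e1, e2, mul_smul_comm, mul_smul_comm,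
        smul_add]
    · rw [exchange_of_ne he1 he2, exchange_of_ne hd1 hd2]
      exact h.col α hα e d hed hd
  · intro d e hde he α β hαβ hβ
    have hd : d < N := hde.trans he
    have hα := hαβ.trans hβ
    obtain ⟨c1, c2, c3⟩ := hz s hs' α hα
    obtain ⟨c4, c5, c6⟩ := hz (s + 1) hs α hα
    obtain ⟨c1', c2', c3'⟩ := hz s hs' β hβ
    obtain ⟨c4', c5', c6'⟩ := hz (s + 1) hs β hβ
    rcases cases3 e with rfl | rfl | ⟨he1, he2⟩ <;> rcases cases3 d with rfl | rfl | ⟨hd1, hd2⟩ <;>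
      try omega
    · have e1 := h.comm d e hde he α β hαβ hβ
      have e2 := h.comm d (e + 1) (by omega) hs α β hαβ hβ
      obtain ⟨c1, c2, c3⟩ := hz d hd α hα
      rw [exchange_left, exchange_of_ne hd1 hd2, mul_add, add_mul, ← mul_assoc, ← mul_assoc, c1,
        zD d hd α hα, mul_assoc, mul_assoc, mul_assoc, mul_assoc, e1, e2]
    · have e1 := h.row d hd α β hαβ hβ
      have e2 := h.row (d + 1) hs α β hαβ hβ
      have e3 := h.comm d (d + 1) (by omega) hs α β hαβ hβ
      have e4 := h.cross d (d + 1) (by omega) hs α β hαβ hβ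
      simp only [exchange_left, exchange_right, mul_add, add_mul, neg_mul, mul_neg, smul_mul_assoc,
        mul_smul_comm, comm_mul_mul c1, comm_mul_mul c2, comm_mul_mul c3, comm_mul_mul c4,
        comm_mul_mul c5, comm_mul_mul c6, comm_mul_mul c1', comm_mul_mul c2', comm_mul_mul c3',
        comm_mul_mul c4', comm_mul_mul c5', comm_mul_mul c6',
        hDa, hbD, hab, hba, e1, e2, e3, e4, sub_mul, one_mul, mul_sub]
      match_scalars <;> field_simp <;> ring
    · have e1 := h.comm d s (by omega) hs' α β hαβ hβ
      have e2 := h.comm d (s + 1) (by omega) hs α β hαβ hβ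
      obtain ⟨c1, c2, c3⟩ := hz d hd α hα
      rw [exchange_right, exchange_of_ne hd1 hd2, mul_add, add_mul, ← mul_assoc, ← mul_assoc, c2,
        c3, mul_assoc, mul_assoc, mul_assoc, mul_assoc, e1, e2]
    · have e1 := h.comm d e hde he α β hαβ hβ
      have e2 := h.comm (d + 1) e (by omega) he α β hαβ hβ
      obtain ⟨c1, c2, c3⟩ := hz e he β hβ
      rw [exchange_left, exchange_of_ne he1 he2, mul_add, add_mul, ← mul_assoc, ← mul_assoc, c1,
        zD e he β hβ, mul_assoc, mul_assoc, mul_assoc, mul_assoc, e1, e2]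
    · have e1 := h.comm s e (by omega) he α β hαβ hβ
      have e2 := h.comm (s + 1) e (by omega) he α β hαβ hβ
      obtain ⟨c1, c2, c3⟩ := hz e he β hβ
      rw [exchange_right, exchange_of_ne he1 he2, mul_add, add_mul, ← mul_assoc, ← mul_assoc, c2,
        c3, mul_assoc, mul_assoc, mul_assoc, mul_assoc, e1, e2]
    · rw [exchange_of_ne he1 he2, exchange_of_ne hd1 hd2]
      exact h.comm d e hde he α β hαβ hβ
  · intro e d hed hd α β hαβ hβ
    have he : e < N := hed.trans hd
    have hα := hαβ.trans hβ
    obtain ⟨c1, c2, c3⟩ := hz s hs' α hα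
    obtain ⟨c4, c5, c6⟩ := hz (s + 1) hs α hα
    obtain ⟨c1', c2', c3'⟩ := hz s hs' β hβ
    obtain ⟨c4', c5', c6'⟩ := hz (s + 1) hs β hβ
    rcases cases3 e with rfl | rfl | ⟨he1, he2⟩ <;> rcases cases3 d with rfl | rfl | ⟨hd1, hd2⟩ <;>
      try omega
    · have e1 := h.row e he α β hαβ hβ
      have e2 := h.row (e + 1) hs α β hαβ hβ
      have e3 := h.comm e (e + 1) (by omega) hs α β hαβ hβ
      have e4 := h.cross e (e + 1) (by omega) hs α β hαβ hβ
      simp only [exchange_left, exchange_right, mul_add, add_mul, neg_mul, mul_neg, smul_mul_assoc,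
        mul_smul_comm, comm_mul_mul c1, comm_mul_mul c2, comm_mul_mul c3, comm_mul_mul c4,
        comm_mul_mul c5, comm_mul_mul c6, comm_mul_mul c1', comm_mul_mul c2', comm_mul_mul c3',
        comm_mul_mul c4', comm_mul_mul c5', comm_mul_mul c6',
        hDa, hbD, hab, hba, e1, e2, e3, e4, sub_mul, one_mul, mul_sub, smul_sub, smul_add]
      match_scalars <;> field_simp <;> ring
    · have e1 := h.cross e d hed hd α β hαβ hβ
      have e2 := h.cross (e + 1) d (by omega) hd α β hαβ hβ
      obtain ⟨c1, c2, c3⟩ := hz d hd α hα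
      obtain ⟨c1', c2', c3'⟩ := hz d hd β hβ
      rw [exchange_left, exchange_left, exchange_of_ne hd1 hd2, exchange_of_ne hd1 hd2]
      simp only [mul_add, add_mul, ← mul_assoc, c1, c1', zD d hd α hα, zD d hd β hβ]
      simp only [mul_assoc, e1, e2, mul_add, mul_smul_comm, smul_add]
      abel
    · have e1 := h.cross s d (by omega) hd α β hαβ hβ
      have e2 := h.cross (s + 1) d (by omega) hd α β hαβ hβ
      obtain ⟨c1, c2, c3⟩ := hz d hd α hα
      obtain ⟨c1', c2', c3'⟩ := hz d hd β hβ
      rw [exchange_right, exchange_right, exchange_of_ne hd1 hd2, exchange_of_ne hd1 hd2]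
      simp only [mul_add, add_mul, ← mul_assoc, c2, c2', c3, c3']
      simp only [mul_assoc, e1, e2, mul_add, mul_smul_comm, smul_add]
      abel
    · have e1 := h.cross e d hed hd α β hαβ hβ
      have e2 := h.cross e (d + 1) (by omega) hs α β hαβ hβ
      obtain ⟨c1, c2, c3⟩ := hz e he α hα
      obtain ⟨c1', c2', c3'⟩ := hz e he β hβ
      rw [exchange_left, exchange_left, exchange_of_ne he1 he2, exchange_of_ne he1 he2]
      simp only [mul_add, add_mul, ← mul_assoc, c1, c1', zD e he α hα, zD e he β hβ]
      simp only [mul_assoc, e1, e2, mul_add, mul_smul_comm, smul_add]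
      abel
    · have e1 := h.cross e s (by omega) hs' α β hαβ hβ
      have e2 := h.cross e (s + 1) (by omega) hs α β hαβ hβ
      obtain ⟨c1, c2, c3⟩ := hz e he α hα
      obtain ⟨c1', c2', c3'⟩ := hz e he β hβ
      rw [exchange_right, exchange_right, exchange_of_ne he1 he2, exchange_of_ne he1 he2]
      simp only [mul_add, add_mul, ← mul_assoc, c2, c2', c3, c3']
      simp only [mul_assoc, e1, e2, mul_add, mul_smul_comm, smul_add]
      abel
    · simp only [exchange_of_ne he1 he2, exchange_of_ne hd1 hd2]
      exact h.cross e d hed hd α β hαβ hβ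
  · intro d hd e he hde α hα β hβ
    obtain ⟨c1, c2, c3⟩ := hw s hs' β hβ
    obtain ⟨c4, c5, c6⟩ := hw (s + 1) hs β hβ
    have wD : ∀ d < N, ∀ α < m, w d α * -(Q • D) = -(Q • D) * w d α := fun d hd α hα => by
      simp [(hw d hd α hα).2.2]
    rcases cases3 e with rfl | rfl | ⟨he1, he2⟩ <;> rcases cases3 d with rfl | rfl | ⟨hd1, hd2⟩ <;>
      try omega
    · simp only [exchange_left, exchange_right]
      rw [rowMix_comb hα hβ _ _ _ _ (fun i hi => (hz e he i hi).2.1) (zD e he)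
        (fun i hi => (hz _ hs i hi).2.1) (zD _ hs)]
      simp only [mul_add, add_mul, comm_mul_mul c3, comm_mul_mul c2, comm_mul_mul c6,
        comm_mul_mul c5, neg_mul, mul_neg, smul_mul_assoc, mul_smul_comm,
        h.mixed_ne (e + 1) hs e he (by omega) α hα β hβ,
        h.mixed_ne e he (e + 1) hs (by omega) α hα β hβ,
        h.mixed_eq e he α hα β hβ, h.mixed_eq (e + 1) hs α hα β hβ, Finset.sum_range_succ,
        hDa, hbD, hab, hba, sub_mul, mul_sub, one_mul, smul_sub, smul_add]
      match_scalars <;> field_simp <;> ring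
    · simp only [exchange_left, exchange_of_ne hd1 hd2]
      rw [rowMix_comb_right hα hβ _ _ (fun i hi => (hz d hd i hi).2.1) (zD d hd), add_mul,
        mul_assoc, mul_assoc, h.mixed_ne d hd e he hde α hα β hβ,
        h.mixed_ne d hd (e + 1) hs (by omega) α hα β hβ]
    · simp only [exchange_left, exchange_right]
      rw [rowMix_comb hα hβ _ _ _ _ (fun i hi => (hz d hd i hi).2.2)
        (fun i hi => (hz d hd i hi).1) (fun i hi => (hz _ hs i hi).2.2)
        (fun i hi => (hz _ hs i hi).1)]
      simp only [mul_add, add_mul, comm_mul_mul c3, comm_mul_mul c1, comm_mul_mul c6,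
        comm_mul_mul c4, neg_mul, mul_neg, smul_mul_assoc, mul_smul_comm,
        h.mixed_ne (d + 1) hs d hd (by omega) α hα β hβ,
        h.mixed_ne d hd (d + 1) hs (by omega) α hα β hβ,
        h.mixed_eq d hd α hα β hβ, h.mixed_eq (d + 1) hs α hα β hβ, Finset.sum_range_succ,
        hDa, hbD, hab, hba, sub_mul, mul_sub, one_mul, smul_sub, smul_add]
      match_scalars <;> field_simp <;> ring
    · simp only [exchange_right, exchange_of_ne hd1 hd2]
      rw [rowMix_comb_right hα hβ _ _ (fun i hi => (hz d hd i hi).2.2)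
        (fun i hi => (hz d hd i hi).1), add_mul,
        mul_assoc, mul_assoc, h.mixed_ne d hd s hs' hd1 α hα β hβ,
        h.mixed_ne d hd (s + 1) hs (by omega) α hα β hβ]
    · obtain ⟨c1, c2, c3⟩ := hw e he β hβ
      simp only [exchange_left, exchange_of_ne he1 he2]
      rw [rowMix_comb_left, mul_add, ← mul_assoc, ← mul_assoc, c1, wD e he β hβ,
        mul_assoc, mul_assoc, h.mixed_ne d hd e he hde α hα β hβ,
        h.mixed_ne (d + 1) hs e he (by omega) α hα β hβ]
    · obtain ⟨c1, c2, c3⟩ := hw e he β hβ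
      simp only [exchange_right, exchange_of_ne he1 he2]
      rw [rowMix_comb_left, mul_add, ← mul_assoc, ← mul_assoc, c2, c3,
        mul_assoc, mul_assoc, h.mixed_ne s hs' e he (by omega) α hα β hβ,
        h.mixed_ne (s + 1) hs e he (by omega) α hα β hβ]
    · simp only [exchange_of_ne he1 he2, exchange_of_ne hd1 hd2]
      exact h.mixed_ne d hd e he hde α hα β hβ
  · intro d hd α hα β hβ
    obtain ⟨c1, c2, c3⟩ := hw s hs' β hβ
    obtain ⟨c4, c5, c6⟩ := hw (s + 1) hs β hβ
    have M0 := rowMix_comb (Q := Q) hα hβ a (-(Q • D)) b (-(Q • D)) (u₀ := w s)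
      (u₁ := w (s + 1)) (fun i hi => (hz s hs' i hi).2.1) (zD s hs')
      (fun i hi => (hz _ hs i hi).2.1) (zD _ hs)
    have M1 := rowMix_comb (Q := Q) hα hβ D b D a (u₀ := w s)
      (u₁ := w (s + 1)) (fun i hi => (hz s hs' i hi).2.2)
      (fun i hi => (hz s hs' i hi).1) (fun i hi => (hz _ hs i hi).2.2)
      (fun i hi => (hz _ hs i hi).1)
    replace M0 := (show (rowMix Q m α β fun i j => QMat.exchange Q a b D s z s i *
        QMat.exchange Q b a D s w s j) = _ by simp only [exchange_left]).trans M0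
    replace M1 := (show (rowMix Q m α β fun i j => QMat.exchange Q a b D s z (s + 1) i *
        QMat.exchange Q b a D s w (s + 1) j) = _ by simp only [exchange_right]).trans M1
    -- The mixed relation for equal columns contains the sum over all columns further to the right.
    -- This sum does not change unless it ends between the two exchanged columns.
    have low : ∀ d ≤ s, ∑ c ∈ Finset.range d, (rowMix Q m α β fun i j =>
        QMat.exchange Q a b D s z c i * QMat.exchange Q b a D s w c j) =
        ∑ c ∈ Finset.range d, rowMix Q m α β fun i j => z c i * w c j := fun d hd =>
      Finset.sum_congr rfl fun c hc => by
        have := Finset.mem_range.1 hc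
        simp only [exchange_of_ne (show c ≠ s by omega) (show c ≠ s + 1 by omega)]
    have high : ∀ k, ∑ c ∈ Finset.range (s + 2 + k), (rowMix Q m α β fun i j =>
        QMat.exchange Q a b D s z c i * QMat.exchange Q b a D s w c j) =
        ∑ c ∈ Finset.range (s + 2 + k), rowMix Q m α β fun i j => z c i * w c j := fun k => by
      induction k with
      | zero =>
        rw [add_zero, Finset.sum_range_succ, Finset.sum_range_succ, low s le_rfl, M0, M1,
          Finset.sum_range_succ, Finset.sum_range_succ]
        simp only [neg_mul, mul_neg, smul_mul_assoc, mul_smul_comm,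
          hDa, hbD, hab, hba, sub_mul, one_mul, smul_sub]
        match_scalars <;> ring
      | succ k ih =>
        rw [← add_assoc, Finset.sum_range_succ, Finset.sum_range_succ, ih]
        simp only [exchange_of_ne (show s + 2 + k ≠ s by omega)
          (show s + 2 + k ≠ s + 1 by omega)]
    rcases cases3 d with rfl | rfl | ⟨hd1, hd2⟩
    · rw [M0, low d le_rfl]
      simp only [exchange_left]
      simp only [mul_add, add_mul, comm_mul_mul c3, comm_mul_mul c1, comm_mul_mul c6,
        comm_mul_mul c4, neg_mul, mul_neg, smul_mul_assoc, mul_smul_comm,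
        h.mixed_ne (d + 1) hs d hd (by omega) α hα β hβ,
        h.mixed_ne d hd (d + 1) hs (by omega) α hα β hβ,
        h.mixed_eq d hd α hα β hβ, h.mixed_eq (d + 1) hs α hα β hβ, Finset.sum_range_succ,
        hDa, hbD, hab, hba, sub_mul, mul_sub, one_mul, smul_sub, smul_add, mul_one]
      match_scalars <;> field_simp <;> ring
    · rw [M1, Finset.sum_range_succ, M0, low s le_rfl]
      simp only [exchange_right]
      simp only [mul_add, add_mul, comm_mul_mul c3, comm_mul_mul c2, comm_mul_mul c6,
        comm_mul_mul c5, neg_mul, mul_neg, smul_mul_assoc, mul_smul_comm,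
        h.mixed_ne (s + 1) hs s hs' (by omega) α hα β hβ,
        h.mixed_ne s hs' (s + 1) hs (by omega) α hα β hβ,
        h.mixed_eq s hs' α hα β hβ, h.mixed_eq (s + 1) hs α hα β hβ, Finset.sum_range_succ,
        hDa, hbD, hab, hba, sub_mul, mul_sub, one_mul, smul_sub, smul_add, mul_one]
      match_scalars <;> field_simp <;> ring
    · have hsum : ∑ c ∈ Finset.range d, (rowMix Q m α β fun i j =>
          QMat.exchange Q a b D s z c i * QMat.exchange Q b a D s w c j) =
          ∑ c ∈ Finset.range d, rowMix Q m α β fun i j => z c i * w c j := by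
        rcases le_or_gt d s with hds | hds
        · exact low d hds
        · obtain ⟨k, rfl⟩ : ∃ k, d = s + 2 + k := ⟨d - (s + 2), by omega⟩
          exact high k
      rw [hsum]
      simp only [exchange_of_ne hd1 hd2]
      exact h.mixed_eq d hd α hα β hβ

end Relations

/-! ### Addition of a row and of a column -/

section Relations
variable {A : Type*} [Ring A] [Algebra ℂ A]

theorem rowMix_of_ne {Q : ℂ} {m α β : ℕ} (h : α ≠ β) (f : ℕ → ℕ → A) :
    rowMix Q m α β f = f α β := if_neg h

theorem rowMix_self {Q : ℂ} {m α : ℕ} (f : ℕ → ℕ → A) :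
    rowMix Q m α α f = Q • f α α - (Q⁻¹ - Q) • ∑ γ ∈ Finset.Ioo α m, f γ γ := if_pos rfl

theorem rowMix_last {Q : ℂ} {m : ℕ} (f : ℕ → ℕ → A) :
    rowMix Q (m + 1) m m f = Q • f m m := by
  have : Finset.Ioo m (m + 1) = ∅ := by ext; simp
  rw [rowMix_self, this, Finset.sum_empty, smul_zero, sub_zero]

theorem rowMix_succ {Q : ℂ} {m α β : ℕ} (hα : α < m) (f : ℕ → ℕ → A) :
    rowMix Q (m + 1) α β f = rowMix Q m α β f - if α = β then (Q⁻¹ - Q) • f m m else 0 := by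
  split_ifs with h
  · subst h
    have : Finset.Ioo α (m + 1) = insert m (Finset.Ioo α m) := by ext; simp; omega
    rw [rowMix_self, rowMix_self, this, Finset.sum_insert (by simp)]
    module
  · rw [rowMix_of_ne h, rowMix_of_ne h, sub_zero]

/-- Addition of a row with index `r` and of a column at the right end of the row. -/
def appendCol (Q : ℂ) (r : ℕ) (z : ℕ → ℕ → A) : ℕ → ℕ → A
  | 0, α => if α = r then 1 else 0
  | d + 1, α => -Q⁻¹ • z d α

theorem appendCol_zero (Q : ℂ) (r : ℕ) (z : ℕ → ℕ → A) (α : ℕ) :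
    appendCol Q r z 0 α = if α = r then 1 else 0 := rfl

theorem appendCol_succ (Q : ℂ) (r : ℕ) (z : ℕ → ℕ → A) (d α : ℕ) :
    appendCol Q r z (d + 1) α = -Q⁻¹ • z d α := rfl

/-- If the row `r` of a quantum matrix is zero, then the column with the entry `1` in this row can
be added on the right. The factors `-Q⁻¹` of the other columns compensate for the new summand of the
mixed relation. -/
theorem QMatRel.appendCol {Q : ℂ} {N r : ℕ} {z w : ℕ → ℕ → A} (h : QMatRel Q N r z w)
    (hQ : Q ≠ 0) (hz : ∀ d, z d r = 0) (hw : ∀ d, w d r = 0) :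
    QMatRel Q (N + 1) (r + 1) (appendCol Q r z) (appendCol Q r w) := by
  constructor
  · intro d hd α β hαβ hβ
    cases d with
    | zero =>
      rw [appendCol_zero, appendCol_zero, if_neg (by omega)]; simp
    | succ d =>
      simp only [appendCol_succ]
      rcases (Nat.lt_succ_iff_lt_or_eq.1 hβ) with hβ | rfl
      · have := h.row d (by omega) α β hαβ hβ
        simp only [smul_mul_assoc, mul_smul_comm, this]; module
      · simp [hz]
  · intro α hα e d hed hd
    obtain ⟨d, rfl⟩ : ∃ d', d = d' + 1 := ⟨d - 1, by omega⟩
    simp only [appendCol_succ]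
    cases e with
    | zero =>
      rw [appendCol_zero]
      split_ifs with hr
      · subst hr; simp [hz]
      · simp
    | succ e =>
      simp only [appendCol_succ]
      rcases (Nat.lt_succ_iff_lt_or_eq.1 hα) with hα | rfl
      · have := h.col α hα e d (by omega) (by omega)
        simp only [smul_mul_assoc, mul_smul_comm, this]; module
      · simp [hz]
  · intro d e hde he α β hαβ hβ
    obtain ⟨e, rfl⟩ : ∃ d', e = d' + 1 := ⟨e - 1, by omega⟩
    cases d with
    | zero => rw [appendCol_zero, if_neg (by omega)]; simp
    | succ d =>
      simp only [appendCol_succ]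
      rcases (Nat.lt_succ_iff_lt_or_eq.1 hβ) with hβ | rfl
      · have := h.comm d e (by omega) (by omega) α β hαβ hβ
        simp only [smul_mul_assoc, mul_smul_comm, this]
      · simp [hz]
  · intro e d hed hd α β hαβ hβ
    obtain ⟨d, rfl⟩ : ∃ d', d = d' + 1 := ⟨d - 1, by omega⟩
    cases e with
    | zero =>
      rw [appendCol_zero, appendCol_zero, if_neg (show α ≠ r by omega)]
      split_ifs <;> simp
    | succ e =>
      simp only [appendCol_succ]
      rcases (Nat.lt_succ_iff_lt_or_eq.1 hβ) with hβ | rfl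
      · have := h.cross e d (by omega) (by omega) α β hαβ hβ
        simp only [smul_mul_assoc, mul_smul_comm, this]; module
      · simp [hz]
  · intro d hd e he hde α hα β hβ
    cases d with
    | zero =>
      obtain ⟨e, rfl⟩ : ∃ d', e = d' + 1 := ⟨e - 1, by omega⟩
      simp only [appendCol_zero, appendCol_succ]
      by_cases hαβ : α = β
      · subst hαβ
        have hf : ∀ i, (if i = r then (1 : A) else 0) * -Q⁻¹ • w e i = 0 := fun i => by
          split_ifs with hi
          · subst hi; simp [hw]
          · simp
        simp only [rowMix_self, hf]
        split_ifs with hi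
        · subst hi; simp [hw]
        · simp
      · rw [rowMix_of_ne hαβ]
        split_ifs <;> simp
    | succ d =>
    cases e with
    | zero =>
      simp only [appendCol_zero, appendCol_succ]
      by_cases hαβ : α = β
      · subst hαβ
        have hf : ∀ i, -Q⁻¹ • z d i * (if i = r then (1 : A) else 0) = 0 := fun i => by
          split_ifs with hi
          · subst hi; simp [hz]
          · simp
        simp only [rowMix_self, hf]
        split_ifs with hi
        · subst hi; simp [hz]
        · simp
      · rw [rowMix_of_ne hαβ]
        split_ifs <;> simp
    | succ e =>
      simp only [appendCol_succ]
      have hfr : (rowMix Q (r + 1) α β fun i j => -Q⁻¹ • z d i * -Q⁻¹ • w e j) =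
          Q⁻¹ ^ 2 • rowMix Q (r + 1) α β fun i j => z d i * w e j := by
        rw [← rowMix_smul]
        refine rowMix_congr hα hβ fun i _ j _ => ?_
        rw [smul_mul_smul_comm]; ring_nf
      rw [hfr, smul_mul_smul_comm]
      rcases (Nat.lt_succ_iff_lt_or_eq.1 hα) with hα | rfl
      · rw [rowMix_succ hα]
        rcases (Nat.lt_succ_iff_lt_or_eq.1 hβ) with hβ | rfl
        · rw [h.mixed_ne d (by omega) e (by omega) (by omega) α hα β hβ, hz]
          simp; ring_nf
        · rw [if_neg (by omega), rowMix_of_ne (by omega), hw]; simp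
      · by_cases hαβ : α = β
        · subst hαβ; rw [rowMix_last, hz]; simp
        · rw [rowMix_of_ne hαβ, hz]; simp
  · intro d hd α hα β hβ
    cases d with
    | zero =>
      simp only [appendCol_zero, Finset.range_zero, Finset.sum_empty]
      rcases (Nat.lt_succ_iff_lt_or_eq.1 hα) with hα | rfl
      · rw [rowMix_succ hα]
        by_cases hαβ : α = β
        · subst hαβ
          have : ∀ γ ∈ Finset.Ioo α r, (if γ = r then (1 : A) else 0) *
              (if γ = r then (1 : A) else 0) = 0 := fun γ hγ => by
            rw [if_neg (Finset.mem_Ioo.1 hγ).2.ne]; simp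
          rw [rowMix_self, Finset.sum_congr rfl this]
          simp only [if_neg hα.ne, Finset.sum_const_zero, if_true, mul_one, mul_zero]
          match_scalars; field_simp; ring
        · rw [rowMix_of_ne hαβ]
          simp [if_neg hα.ne, if_neg hαβ]
      · by_cases hαβ : α = β
        · subst hαβ; rw [rowMix_last]; simp
          match_scalars; ring
        · rw [rowMix_of_ne hαβ]
          simp [if_neg (Ne.symm hαβ), if_neg hαβ]
    | succ d =>
      have hd' : d < N := by omega
      have hfr : ∀ d, (rowMix Q (r + 1) α β fun i j => -Q⁻¹ • z d i * -Q⁻¹ • w d j) =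
          Q⁻¹ ^ 2 • rowMix Q (r + 1) α β fun i j => z d i * w d j := fun d => by
        rw [← rowMix_smul]
        refine rowMix_congr hα hβ fun i _ j _ => ?_
        rw [smul_mul_smul_comm]; ring_nf
      rw [Finset.sum_range_succ']
      simp only [appendCol_succ, hfr, appendCol_zero]
      rw [← Finset.smul_sum, smul_mul_smul_comm]
      rcases (Nat.lt_succ_iff_lt_or_eq.1 hα) with hα | rfl
      · have h1 : ∀ d, (rowMix Q (r + 1) α β fun i j => z d i * w d j) =
            rowMix Q r α β fun i j => z d i * w d j := fun d => by
          rw [rowMix_succ hα, hz]; simp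
        have h2 : (rowMix Q (r + 1) α β fun i j => (if i = r then (1 : A) else 0) *
            (if j = r then (1 : A) else 0)) = if α = β then -(Q⁻¹ - Q) • 1 else 0 := by
          rw [rowMix_succ hα]
          by_cases hαβ : α = β
          · subst hαβ
            have : ∀ γ ∈ Finset.Ioo α r, (if γ = r then (1 : A) else 0) *
                (if γ = r then (1 : A) else 0) = 0 := fun γ hγ => by
              rw [if_neg (Finset.mem_Ioo.1 hγ).2.ne]; simp
            rw [rowMix_self, Finset.sum_congr rfl this]
            simp [if_neg hα.ne]
            module
          · rw [rowMix_of_ne hαβ]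
            simp [if_neg hα.ne, if_neg hαβ]
        simp only [h1, h2]
        rcases (Nat.lt_succ_iff_lt_or_eq.1 hβ) with hβ | rfl
        · rw [h.mixed_eq d hd' α hα β hβ]
          split_ifs
          · match_scalars <;> field_simp <;> ring
          · match_scalars <;> field_simp <;> simp
        · have hαβ : α ≠ β := by omega
          rw [hw]
          simp [rowMix_of_ne hαβ, hαβ, hw]
      · by_cases hαβ : α = β
        · subst hαβ
          simp only [rowMix_last, hz]
          simp
          match_scalars; field_simp; ring
        · simp only [rowMix_of_ne hαβ, hz]
          simp [hαβ, Ne.symm hαβ]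

end Relations

/-! ### Sums over paths in a grid -/

section Paths
variable {A : Type*} [Ring A] [StarRing A] [Algebra ℂ A] [StarModule ℂ A]

/-- The (normalized) sums over the paths that enter a box of a given row from the left, where
`a d`, `(a d)^*`, `D d` are the operators `T₂₂`, `T₁₁`, `T₂₁` of the box at distance `d` from the
right end of the row, `u d` is the sum of the paths that continue above that box, and `δ` is the
contribution of a path that leaves the row on the right. -/
def rowPath (Q : ℂ) (a D u : ℕ → A) (δ : A) : ℕ → A
  | 0 => δ
  | d + 1 => D d * rowPath Q a D u δ d - Q⁻¹ • (star (a d) * u d)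

/-- The (normalized) sum over the paths that enter a grid with `r` rows from below, at distance `d`
from its right side, and leave it in the row `α`. -/
def gridPath (Q : ℂ) (a D : ℕ → ℕ → A) : ℕ → ℕ → ℕ → A
  | 0, _, _ => 0
  | r + 1, d, α => D r d * gridPath Q a D r d α +
      a r d * rowPath Q (a r) (D r) (fun d => gridPath Q a D r d α) (if α = r then 1 else 0) d

/-- The relations between the operators that belong to the boxes of a grid. -/
structure BoxRel (Q : ℂ) (a D : ℕ → ℕ → A) : Prop where
  star_D : ∀ r d, star (D r d) = D r d
  star_mul_self : ∀ r d, star (a r d) * a r d = 1 - Q ^ 2 • (D r d * D r d)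
  mul_star_self : ∀ r d, a r d * star (a r d) = 1 - D r d * D r d
  D_mul : ∀ r d, D r d * a r d = Q • (a r d * D r d)
  comm_aa : ∀ r d r' d', (r, d) ≠ (r', d') → Commute (a r d) (a r' d')
  comm_as : ∀ r d r' d', (r, d) ≠ (r', d') → Commute (a r d) (star (a r' d'))
  comm_aD : ∀ r d r' d', (r, d) ≠ (r', d') → Commute (a r d) (D r' d')
  comm_DD : ∀ r d r' d', (r, d) ≠ (r', d') → Commute (D r d) (D r' d')

variable {Q : ℂ} {a D : ℕ → ℕ → A}

theorem gridPath_zero (d α : ℕ) : gridPath Q a D 0 d α = 0 := rfl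

theorem gridPath_succ (r d α : ℕ) : gridPath Q a D (r + 1) d α = D r d * gridPath Q a D r d α +
      a r d * rowPath Q (a r) (D r) (fun d => gridPath Q a D r d α)
        (if α = r then 1 else 0) d := rfl

theorem rowPath_eq_zero {a D : ℕ → A} {u : ℕ → A} (hu : ∀ d, u d = 0) (d : ℕ) :
    rowPath Q a D u 0 d = 0 := by
  induction d with
  | zero => rfl
  | succ d ih => rw [rowPath, ih, hu]; simp

theorem gridPath_of_le {r α : ℕ} (h : r ≤ α) (d : ℕ) : gridPath Q a D r d α = 0 := by
  induction r generalizing d with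
  | zero => rfl
  | succ r ih =>
    have ih' := ih (by omega)
    rw [gridPath_succ, if_neg (by omega), ih', rowPath_eq_zero ih']
    simp

theorem rowPath_mem (S : Subalgebra ℂ A) {a D u : ℕ → A} {δ : A} {s : ℕ} (hδ : δ ∈ S)
    (hu : ∀ d, u d ∈ S) (h : ∀ d < s, star (a d) ∈ S ∧ D d ∈ S) :
    rowPath Q a D u δ s ∈ S := by
  induction s with
  | zero => exact hδ
  | succ s ih =>
    exact sub_mem (mul_mem (h s (by omega)).2 (ih fun d hd => h d (by omega)))
      (S.smul_mem (mul_mem (h s (by omega)).1 (hu s)) _)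

theorem gridPath_mem (S : Subalgebra ℂ A) {r : ℕ}
    (h : ∀ r' < r, ∀ d, a r' d ∈ S ∧ star (a r' d) ∈ S ∧ D r' d ∈ S) (d α : ℕ) :
    gridPath Q a D r d α ∈ S := by
  induction r generalizing d with
  | zero => exact zero_mem _
  | succ r ih =>
    have ih' := ih fun r' hr' => h r' (by omega)
    refine add_mem (mul_mem (h r (by omega) d).2.2 (ih' d)) (mul_mem (h r (by omega) d).1 ?_)
    exact rowPath_mem S (by split_ifs; exacts [one_mem _, zero_mem _]) ih'
      fun d _ => (h r (by omega) d).2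

/-- The sums over paths from the frontier between the boxes of row `r` that have been passed
(those at distance less than `s` from the right side) and the remaining boxes. -/
def frontier (Q : ℂ) (a D : ℕ → ℕ → A) (r s d α : ℕ) : A :=
  if d < s then gridPath Q a D (r + 1) d α
  else if d = s then
    rowPath Q (a r) (D r) (fun d => gridPath Q a D r d α) (if α = r then 1 else 0) d
  else -Q⁻¹ • gridPath Q a D r (d - 1) α

theorem frontier_of_lt {r s d : ℕ} (h : d < s) (α : ℕ) :
    frontier Q a D r s d α = gridPath Q a D (r + 1) d α := if_pos h

theorem frontier_self (r s α : ℕ) : frontier Q a D r s s α =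
    rowPath Q (a r) (D r) (fun d => gridPath Q a D r d α) (if α = r then 1 else 0) s := by
  rw [frontier, if_neg (lt_irrefl s), if_pos rfl]

theorem frontier_of_gt {r s d : ℕ} (h : s < d) (α : ℕ) :
    frontier Q a D r s d α = -Q⁻¹ • gridPath Q a D r (d - 1) α := by
  rw [frontier, if_neg (by omega), if_neg (by omega)]

/-- Before the first box is passed, a row and a column have been appended to the sums over the paths
in the rows above. -/
theorem frontier_zero (r : ℕ) :
    frontier Q a D r 0 = appendCol Q r (gridPath Q a D r) := by
  funext d α
  cases d with
  | zero => rw [frontier_self]; rfl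
  | succ d => rw [frontier_of_gt (by omega)]; rfl

/-- Passing a box is an exchange. -/
theorem frontier_succ (hQ : Q ≠ 0) (r s : ℕ) : frontier Q a D r (s + 1) =
    exchange Q (a r s) (star (a r s)) (D r s) s (frontier Q a D r s) := by
  funext d α
  rcases (by omega : d < s ∨ d = s ∨ d = s + 1 ∨ s + 1 < d) with h | rfl | rfl | h
  · rw [exchange_of_ne h.ne (by omega), frontier_of_lt (by omega), frontier_of_lt h]
  · rw [exchange_left, frontier_of_lt (by omega), frontier_self, frontier_of_gt (by omega),
      gridPath_succ, Nat.add_sub_cancel]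
    simp only [neg_mul, smul_mul_assoc, mul_smul_comm, neg_smul, smul_neg, mul_neg]
    match_scalars <;> field_simp
  · rw [exchange_right, frontier_self, frontier_self, frontier_of_gt (by omega), rowPath,
      Nat.add_sub_cancel]
    simp only [neg_smul, mul_neg, mul_smul_comm, sub_eq_add_neg]
  · rw [exchange_of_ne (by omega) (by omega), frontier_of_gt h, frontier_of_gt (by omega)]

theorem BoxRel.star_mul_D (h : BoxRel Q a D) (hQ : star Q = Q) (r d : ℕ) :
    star (a r d) * D r d = Q • (D r d * star (a r d)) := by
  have := congrArg star (h.D_mul r d)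
  rwa [star_mul, star_smul, star_mul, h.star_D, hQ] at this

/-- The paths up to the frontier do not visit the box that is passed next. -/
theorem BoxRel.frontier_comm (h : BoxRel Q a D) (r s d α : ℕ) :
    frontier Q a D r s d α * a r s = a r s * frontier Q a D r s d α ∧
    frontier Q a D r s d α * star (a r s) = star (a r s) * frontier Q a D r s d α ∧
    frontier Q a D r s d α * D r s = D r s * frontier Q a D r s d α := by
  let S : Subalgebra ℂ A := Subalgebra.centralizer ℂ {a r s, star (a r s), D r s}
  have key : ∀ r' d', (r', d') ≠ (r, s) → a r' d' ∈ S ∧ star (a r' d') ∈ S ∧ D r' d' ∈ S := by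
    intro r' d' hne
    simp only [S, Subalgebra.mem_centralizer_iff, Set.mem_insert_iff, Set.mem_singleton_iff,
      forall_eq_or_imp, forall_eq]
    refine ⟨⟨h.comm_aa _ _ _ _ hne.symm, (h.comm_as _ _ _ _ hne).symm,
      (h.comm_aD _ _ _ _ hne).symm⟩, ⟨h.comm_as _ _ _ _ hne.symm,
      (h.comm_aa _ _ _ _ hne.symm).star_star, ?_⟩, ⟨h.comm_aD _ _ _ _ hne.symm, ?_,
      h.comm_DD _ _ _ _ hne.symm⟩⟩
    · have := (h.comm_aD _ _ _ _ hne).star_star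
      rw [h.star_D] at this; exact this.symm
    · have := (h.comm_aD _ _ _ _ hne.symm).star_star
      rw [h.star_D] at this; exact this
  have hg : ∀ d, gridPath Q a D r d α ∈ S := fun d =>
    gridPath_mem S (fun r' hr' d => key r' d (by simp; omega)) d α
  have hB : ∀ d ≤ s, rowPath Q (a r) (D r) (fun d => gridPath Q a D r d α)
      (if α = r then 1 else 0) d ∈ S := fun d hd =>
    rowPath_mem S (by split_ifs; exacts [one_mem _, zero_mem _]) hg
      fun d' hd' => (key r d' (by simp; omega)).2
  have : frontier Q a D r s d α ∈ S := by
    rcases lt_trichotomy d s with h1 | h1 | h1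
    · have k := key r d (by simp; omega)
      rw [frontier_of_lt h1]
      exact add_mem (mul_mem k.2.2 (hg d)) (mul_mem k.1 (hB d h1.le))
    · rw [h1, frontier_self]
      exact hB s le_rfl
    · rw [frontier_of_gt h1]
      exact S.smul_mem (hg _) _
  simp only [S, Subalgebra.mem_centralizer_iff, Set.mem_insert_iff, Set.mem_singleton_iff,
      forall_eq_or_imp, forall_eq] at this
  exact ⟨this.1.symm, this.2.1.symm, this.2.2.symm⟩

/-- The sums over paths form a quantum matrix: passing a box is an exchange, and passing to the next
row appends a column. -/
theorem BoxRel.qMatRel (h : BoxRel Q a D) (hQ : Q ≠ 0) (hQr : star Q = Q) (N r : ℕ) :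
    QMatRel Q N r (gridPath Q a D r) fun d α => star (gridPath Q a D r d α) := by
  induction r with
  | zero =>
    constructor
    · intro d hd α β _ hβ; omega
    · intro α hα; omega
    · intro d e _ _ α β _ hβ; omega
    · intro d e _ _ α β _ hβ; omega
    · intro d hd e he _ α hα; omega
    · intro d hd α hα; omega
  | succ r ih =>
    have mid : ∀ s ≤ N, QMatRel Q (N + 1) (r + 1) (frontier Q a D r s)
        fun d α => star (frontier Q a D r s d α) := by
      intro s hs
      induction s with
      | zero =>
        rw [frontier_zero]
        refine (ih.appendCol hQ (fun d => gridPath_of_le le_rfl d)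
          (fun d => by rw [gridPath_of_le le_rfl d, star_zero])).congr (fun _ _ _ _ => rfl) ?_
        intro d _ α _
        cases d with
        | zero => rw [appendCol_zero, appendCol_zero]; split_ifs <;> simp
        | succ d =>
          rw [appendCol_succ, appendCol_succ, star_smul, star_neg, star_inv₀, hQr]
      | succ s ih' =>
        have hc := h.frontier_comm r s
        have hc' : ∀ d α, star (frontier Q a D r s d α) * a r s =
              a r s * star (frontier Q a D r s d α) ∧
            star (frontier Q a D r s d α) * star (a r s) =
              star (a r s) * star (frontier Q a D r s d α) ∧
            star (frontier Q a D r s d α) * D r s = D r s * star (frontier Q a D r s d α) := by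
          intro d α
          refine ⟨?_, ?_, ?_⟩ <;> apply star_injective <;> simp only [star_mul, star_star, h.star_D]
          · exact (hc d α).2.1.symm
          · exact (hc d α).1.symm
          · exact (hc d α).2.2.symm
        rw [frontier_succ hQ]
        refine ((ih' (by omega)).exchange hQ (s := s) (by omega) (h.star_mul_self r s)
          (h.mul_star_self r s) (h.D_mul r s) (h.star_mul_D hQr r s) (fun d _ α _ => hc d α)
          (fun d _ α _ => hc' d α)).congr (fun _ _ _ _ => rfl) ?_
        intro d _ α _
        unfold QMat.exchange
        split_ifs
        · rw [star_sub, star_smul, star_mul, star_mul, hQr, h.star_D, (hc' _ _).2.1,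
            (hc' _ _).2.2]
        · rw [star_add, star_mul, star_mul, star_star, h.star_D, (hc' _ _).1, (hc' _ _).2.2]
        · rfl
    refine ((mid N le_rfl).mono (Nat.le_succ N)).congr ?_ ?_ <;> intro d hd α _ <;>
      rw [frontier_of_lt hd]

end Paths

/-! ### Subspaces generated by the operators of the last row -/

section Transport
variable {A B : Type*} [Ring A] [Algebra ℂ A] [Ring B] [Algebra ℂ B]

theorem rowMix_map {F : Type*} [FunLike F A B] [LinearMapClass F ℂ A B] (f : F) (Q : ℂ)
    (m α β : ℕ) (g : ℕ → ℕ → A) :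
    f (rowMix Q m α β g) = rowMix Q m α β fun i j => f (g i j) := by
  unfold rowMix
  split_ifs
  · rw [map_sub, map_smul, map_smul, map_sum]
  · rfl

theorem rowMix_prodMk (Q : ℂ) (m α β : ℕ) (f : ℕ → ℕ → A) (g : ℕ → ℕ → B) :
    (rowMix Q m α β fun i j => (f i j, g i j)) = (rowMix Q m α β f, rowMix Q m α β g) := by
  unfold rowMix
  split_ifs
  · ext <;> simp [Prod.fst_sum, Prod.snd_sum]
  · rfl

theorem QMatRel.map {Q : ℂ} {N m : ℕ} {z w : ℕ → ℕ → A} (h : QMatRel Q N m z w)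
    (f : A →ₐ[ℂ] B) : QMatRel Q N m (fun d α => f (z d α)) fun d α => f (w d α) where
  row d hd α β hαβ hβ := by
    rw [← map_mul, h.row d hd α β hαβ hβ, map_smul, map_mul]
  col α hα e d hed hd := by
    rw [← map_mul, h.col α hα e d hed hd, map_smul, map_mul]
  comm d e hde he α β hαβ hβ := by
    rw [← map_mul, h.comm d e hde he α β hαβ hβ, map_mul]
  cross e d hed hd α β hαβ hβ := by
    rw [← map_mul, h.cross e d hed hd α β hαβ hβ, map_add, map_smul, map_mul, map_mul]
  mixed_ne d hd e he hde α hα β hβ := by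
    rw [← map_mul, h.mixed_ne d hd e he hde α hα β hβ, rowMix_map]
    simp only [map_mul]
  mixed_eq d hd α hα β hβ := by
    rw [← map_mul, h.mixed_eq d hd α hα β hβ, map_add, map_sub, map_smul, map_smul, map_smul,
      map_sum, map_one]
    simp only [rowMix_map, map_mul]

theorem QMatRel.prodMk {Q : ℂ} {N m : ℕ} {z w : ℕ → ℕ → A} {z' w' : ℕ → ℕ → B}
    (h : QMatRel Q N m z w) (h' : QMatRel Q N m z' w') :
    QMatRel Q N m (fun d α => (z d α, z' d α)) fun d α => (w d α, w' d α) where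
  row d hd α β hαβ hβ := Prod.ext (h.row d hd α β hαβ hβ) (h'.row d hd α β hαβ hβ)
  col α hα e d hed hd := Prod.ext (h.col α hα e d hed hd) (h'.col α hα e d hed hd)
  comm d e hde he α β hαβ hβ :=
    Prod.ext (h.comm d e hde he α β hαβ hβ) (h'.comm d e hde he α β hαβ hβ)
  cross e d hed hd α β hαβ hβ :=
    Prod.ext (h.cross e d hed hd α β hαβ hβ) (h'.cross e d hed hd α β hαβ hβ)
  mixed_ne d hd e he hde α hα β hβ := by
    simp only [Prod.mk_mul_mk, rowMix_prodMk]
    exact Prod.ext (h.mixed_ne d hd e he hde α hα β hβ) (h'.mixed_ne d hd e he hde α hα β hβ)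
  mixed_eq d hd α hα β hβ := by
    simp only [Prod.mk_mul_mk, rowMix_prodMk]
    refine Prod.ext ?_ ?_
    · simpa [Prod.fst_sum, -ite_smul] using h.mixed_eq d hd α hα β hβ
    · simpa [Prod.snd_sum, -ite_smul] using h'.mixed_eq d hd α hα β hβ

end Transport

section GenSpan

variable {V : Type*} [AddCommGroup V] [Module ℂ V]

/-- The smallest subspace that contains `W` and is invariant under `x d` for `d < c`. -/
def genSpan (x : ℕ → Module.End ℂ V) (c : ℕ) (W : Submodule ℂ V) : Submodule ℂ V :=
  sInf {M | W ≤ M ∧ ∀ d < c, ∀ v ∈ M, x d v ∈ M}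

/-- The vectors that are mapped to `T` by all `f d` with `d < N`. -/
def commonComap (f : ℕ → Module.End ℂ V) (N : ℕ) (T : Submodule ℂ V) : Submodule ℂ V :=
  ⨅ d : Fin N, Submodule.comap (f d) T

theorem mem_commonComap {f : ℕ → Module.End ℂ V} {N : ℕ} {T : Submodule ℂ V} {v : V} :
    v ∈ commonComap f N T ↔ ∀ d < N, f d v ∈ T := by
  rw [commonComap, Submodule.mem_iInf]
  exact ⟨fun h d hd => h ⟨d, hd⟩, fun h d => h d d.2⟩

variable {x : ℕ → Module.End ℂ V} {c : ℕ} {W : Submodule ℂ V}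

theorem le_genSpan : W ≤ genSpan x c W := le_sInf fun _ h => h.1

theorem genSpan_invariant {d : ℕ} (hd : d < c) {v : V} (hv : v ∈ genSpan x c W) :
    x d v ∈ genSpan x c W := by
  rw [genSpan, Submodule.mem_sInf] at hv ⊢
  exact fun M hM => hM.2 d hd v (hv M hM)

theorem genSpan_le {M : Submodule ℂ V} (hW : W ≤ M) (h : ∀ d < c, ∀ v ∈ M, x d v ∈ M) :
    genSpan x c W ≤ M := sInf_le ⟨hW, h⟩

variable {Q : ℂ} {N m : ℕ} {z w : ℕ → ℕ → Module.End ℂ V}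

local notation "L" => genSpan (fun d => z d m) c W

/-- The space that is generated from `W` by the first `c` generators of the last row is invariant
under the whole last row if the latter maps `W` to it. -/
theorem QMatRel.last_mem_genSpan (h : QMatRel Q N (m + 1) z w) (hc : c ≤ N)
    (hW : ∀ d < N, c ≤ d → ∀ v ∈ W, z d m v ∈ L) {d : ℕ} (hd : d < N) {v : V} (hv : v ∈ L) :
    z d m v ∈ L := by
  rcases lt_or_ge d c with hdc | hdc
  · exact genSpan_invariant hdc hv
  · have : L ≤ L ⊓ Submodule.comap (z d m) L := by
      refine genSpan_le (le_inf le_genSpan fun v hv => hW d hd hdc v hv) ?_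
      rintro e he v ⟨hv, hv'⟩
      refine ⟨genSpan_invariant he hv, ?_⟩
      have := LinearMap.congr_fun (h.col m (by omega) e d (by omega) hd) v
      simp only [Module.End.mul_apply, LinearMap.smul_apply] at this
      change z d m (z e m v) ∈ L
      rw [this]
      exact Submodule.smul_mem _ _ (genSpan_invariant he hv')
    exact (this hv).2

/-- The space that is generated from `W` by the first `c` generators of the last row is invariant
under all generators if they map `W` to it: by the relations, generators of other rows can be moved
to the right past those of the last row. -/
theorem QMatRel.mem_genSpan (h : QMatRel Q N (m + 1) z w) (hc : c ≤ N)
    (hW : ∀ d < N, ∀ α < m + 1, ∀ v ∈ W, z d α v ∈ L) {d α : ℕ} (hd : d < N) (hα : α < m + 1)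
    {v : V} (hv : v ∈ L) : z d α v ∈ L := by
  have hlast : ∀ {d : ℕ}, d < N → ∀ {v : V}, v ∈ L → z d m v ∈ L := fun {d} hd {v} hv =>
    h.last_mem_genSpan hc (fun d hd _ v hv => hW d hd m (by omega) v hv) hd hv
  rcases (Nat.lt_succ_iff_lt_or_eq.1 hα) with hα | rfl
    -- The columns have to be treated simultaneously, since the cross relation exchanges them.
  · have : L ≤ L ⊓ commonComap (fun d => z d α) N L := by
      refine genSpan_le ?_ ?_
      · exact le_inf le_genSpan fun v hv =>
          mem_commonComap.2 fun d hd => hW d hd α (by omega) v hv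
      rintro e he v hv
      obtain ⟨hvL, hvz⟩ := Submodule.mem_inf.1 hv
      rw [mem_commonComap] at hvz
      refine Submodule.mem_inf.2 ⟨genSpan_invariant he hvL, mem_commonComap.2 fun d hd => ?_⟩
      change z d α (z e m v) ∈ L
      rcases lt_trichotomy d e with hde | rfl | hde
      · have := LinearMap.congr_fun (h.comm d e hde (by omega) α m hα (by omega)) v
        simp only [Module.End.mul_apply] at this
        rw [this]
        exact genSpan_invariant he (hvz d hd)
      · have := LinearMap.congr_fun (h.row d hd α m hα (by omega)) v
        simp only [Module.End.mul_apply, LinearMap.smul_apply] at this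
        rw [this]
        exact Submodule.smul_mem _ _ (genSpan_invariant he (hvz d hd))
      · have := LinearMap.congr_fun (h.cross e d hde hd α m hα (by omega)) v
        simp only [Module.End.mul_apply, LinearMap.smul_apply, LinearMap.add_apply] at this
        rw [this]
        exact add_mem (genSpan_invariant he (hvz d hd))
          (Submodule.smul_mem _ _ (hlast hd (hvz e (by omega))))
    exact mem_commonComap.1 (Submodule.mem_inf.1 (this hv)).2 d hd
  · exact hlast hd hv

/-- The space that is generated from `W` by the first `c` generators of the last row is invariant
under the adjoints of the last row if they map `W` to it. -/
theorem QMatRel.star_last_mem_genSpan (h : QMatRel Q N (m + 1) z w) {N' : ℕ} (hc : c ≤ N')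
    (hN : N' ≤ N) (hW : ∀ d < N', ∀ v ∈ W, w d m v ∈ L) {d : ℕ} (hd : d < N') {v : V}
    (hv : v ∈ L) : w d m v ∈ L := by
  have : L ≤ L ⊓ commonComap (fun d => w d m) N' L := by
    refine genSpan_le ?_ ?_
    · exact le_inf le_genSpan fun v hv => mem_commonComap.2 fun d hd => hW d hd v hv
    rintro e he v hv
    obtain ⟨hvL, hvz⟩ := Submodule.mem_inf.1 hv
    rw [mem_commonComap] at hvz
    refine Submodule.mem_inf.2 ⟨genSpan_invariant he hvL, mem_commonComap.2 fun d hd => ?_⟩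
    change w d m (z e m v) ∈ L
    by_cases hde : e = d
    · subst hde
      have := LinearMap.congr_fun (h.mixed_eq e (by omega) m (by omega) m (by omega)) v
      simp only [rowMix_last, Module.End.mul_apply, LinearMap.smul_apply, LinearMap.add_apply,
        LinearMap.sub_apply, LinearMap.sum_apply, Module.End.one_apply, if_true] at this
      rw [this]
      refine add_mem (sub_mem ?_ ?_) (Submodule.smul_mem _ _ hvL)
      · exact Submodule.smul_mem _ _ (Submodule.smul_mem _ _ (genSpan_invariant he (hvz e hd)))
      · refine Submodule.smul_mem _ _ (Submodule.sum_mem _ fun i hi => Submodule.smul_mem _ _ ?_)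
        have hi := Finset.mem_range.1 hi
        exact genSpan_invariant (hi.trans he) (hvz i (by omega))
    · have := LinearMap.congr_fun
        (h.mixed_ne e (by omega) d (by omega) hde m (by omega) m (by omega)) v
      simp only [rowMix_last, Module.End.mul_apply, LinearMap.smul_apply] at this
      rw [this]
      exact Submodule.smul_mem _ _ (genSpan_invariant he (hvz d hd))
  exact mem_commonComap.1 (Submodule.mem_inf.1 (this hv)).2 d hd

/-- The adjoints of the generators of the other rows map the generated subspace to any invariant
subspace to which they map the generating one. -/
theorem QMatRel.star_mem_of_genSpan (h : QMatRel Q N (m + 1) z w) (hc : c ≤ N)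
    {T : Submodule ℂ V} (hT : ∀ d < c, ∀ v ∈ T, z d m v ∈ T) {α : ℕ} (hα : α < m)
    (hW : ∀ d < N, ∀ v ∈ W, w d α v ∈ T) {d : ℕ} (hd : d < N) {v : V}
    (hv : v ∈ L) : w d α v ∈ T := by
  have : L ≤ commonComap (fun d => w d α) N T := by
    refine genSpan_le ?_ ?_
    · exact fun v hv => mem_commonComap.2 fun d hd => hW d hd v hv
    rintro e he v hv
    have hvz := mem_commonComap.1 hv
    refine mem_commonComap.2 fun d hd => ?_
    change w d α (z e m v) ∈ T
    by_cases hde : e = d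
    · subst hde
      have := LinearMap.congr_fun (h.mixed_eq e (by omega) m (by omega) α (by omega)) v
      simp only [rowMix_of_ne (show m ≠ α by omega), Module.End.mul_apply, LinearMap.smul_apply,
        LinearMap.add_apply, LinearMap.sub_apply, LinearMap.sum_apply, Module.End.one_apply,
        if_neg (show m ≠ α by omega), zero_smul, add_zero] at this
      rw [this]
      refine sub_mem ?_ ?_
      · exact Submodule.smul_mem _ _ (hT e he _ (hvz e hd))
      · refine Submodule.smul_mem _ _ (Submodule.sum_mem _ fun i hi => ?_)
        have hi := Finset.mem_range.1 hi
        exact hT i (hi.trans he) _ (hvz i (by omega))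
    · have := LinearMap.congr_fun
        (h.mixed_ne e (by omega) d (by omega) hde m (by omega) α (by omega)) v
      simp only [rowMix_of_ne (show m ≠ α by omega), Module.End.mul_apply] at this
      rw [this]
      exact hT e he _ (hvz d hd)
  exact mem_commonComap.1 (this hv) d hd

end GenSpan

/-! ### Adding a row to a representation -/

universe u₁ u₂ u₃ u₄

section Hilbert

variable {H : Type u₁} [NormedAddCommGroup H] [InnerProductSpace ℂ H] [CompleteSpace H]
variable {H' : Type u₂} [NormedAddCommGroup H'] [InnerProductSpace ℂ H'] [CompleteSpace H']
variable {H₂ : Type u₃} [NormedAddCommGroup H₂] [InnerProductSpace ℂ H₂] [CompleteSpace H₂]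
variable {H₂' : Type u₄} [NormedAddCommGroup H₂'] [InnerProductSpace ℂ H₂'] [CompleteSpace H₂']

theorem inner_star_left (T : H →L[ℂ] H) (x y : H) : ⟪star T x, y⟫_ℂ = ⟪x, T y⟫_ℂ := by
  rw [ContinuousLinearMap.star_eq_adjoint, ContinuousLinearMap.adjoint_inner_left]

theorem inner_star_right (T : H →L[ℂ] H) (x y : H) : ⟪x, star T y⟫_ℂ = ⟪T x, y⟫_ℂ := by
  rw [ContinuousLinearMap.star_eq_adjoint, ContinuousLinearMap.adjoint_inner_right]

/-- Bounded operators as linear maps. -/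
def toEnd (H : Type u₁) [NormedAddCommGroup H] [InnerProductSpace ℂ H] :
    (H →L[ℂ] H) →ₐ[ℂ] Module.End ℂ H :=
  { ContinuousLinearMap.toLinearMapRingHom with commutes' := fun _ => rfl }

theorem toEnd_apply (T : H →L[ℂ] H) (v : H) : toEnd H T v = T v := rfl

/-- A family of bounded operators that satisfies the relations of a quantum matrix together with
its adjoints. -/
def IsQMat (Q : ℂ) (N m : ℕ) (Z : ℕ → ℕ → H →L[ℂ] H) : Prop :=
  QMatRel Q N m Z fun d α => star (Z d α)

/-- Irreducibility of a family of operators together with its adjoints. -/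
def IrrFam (N m : ℕ) (Z : ℕ → ℕ → H →L[ℂ] H) : Prop :=
  Nontrivial H ∧ ∀ K : Submodule ℂ H, IsClosed (K : Set H) →
    (∀ d < N, ∀ α < m, ∀ v ∈ K, Z d α v ∈ K ∧ star (Z d α) v ∈ K) → K = ⊥ ∨ K = ⊤

/-- The operators of `Z` and `Z₂` correspond to each other under a unitary operator. -/
def FamEquiv (N m : ℕ) (Z : ℕ → ℕ → H →L[ℂ] H) (Z₂ : ℕ → ℕ → H₂ →L[ℂ] H₂) : Prop :=
  ∃ U : H ≃ₗᵢ[ℂ] H₂, ∀ d < N, ∀ α < m, ∀ v, U (Z d α v) = Z₂ d α (U v)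

/-- The quantum matrix `Z` with `m + 1` rows arises from the quantum matrix `Z'` with `m` rows by
adding a last row with `c` white boxes, where `l` is the scalar that belongs to the box to the left
of the white ones. If all the `N` boxes of the last row are white, then `Z'` has `N` columns,
otherwise it has `N - 1` columns. The space of `Z'` is embedded by `J` as the space of those vectors
that are annihilated by the adjoints of the generators in the last row that belong to white
boxes. -/
structure RowExt (Q : ℂ) (N m c : ℕ) (l : ℂ) (Z : ℕ → ℕ → H →L[ℂ] H)
    (Z' : ℕ → ℕ → H' →L[ℂ] H') (J : H' →ₗᵢ[ℂ] H) : Prop where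
  rel : IsQMat Q N (m + 1) Z
  c_le : c ≤ N
  ann : ∀ d < c, ∀ v, star (Z d m) (J v) = 0
  eig : c < N → ∀ v, Z c m (J v) = l • J v
  zero : ∀ d, c < d → d < N → ∀ v, Z d m (J v) = 0
  low : ∀ d < c, ∀ α < m, ∀ v, Z d α (J v) = J (Z' d α v)
  mid : c < N → ∀ α < m, ∀ v, Z c α (J v) = 0
  high : ∀ d, c ≤ d → d + 1 < N → ∀ α < m, ∀ v,
    Z (d + 1) α (J v) = (-Q⁻¹ * if d = c then conj l else 1) • J (Z' d α v)
  dense : (genSpan (fun d => toEnd H (Z d m)) c J.range).topologicalClosure = ⊤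

/-- The number of columns that are left after a row with `c` white boxes. -/
def nextCols (N c : ℕ) : ℕ := if c = N then N else N - 1

/-- Two Hilbert spaces are isomorphic through a dense linear relation that preserves the norm. -/
theorem exists_unitary_of_relation (G : Submodule ℂ (H × H₂))
    (h₁ : (Submodule.map (LinearMap.fst ℂ H H₂) G).topologicalClosure = ⊤)
    (h₂ : (Submodule.map (LinearMap.snd ℂ H H₂) G).topologicalClosure = ⊤)
    (h : ∀ p ∈ G, ‖p.1‖ = ‖p.2‖) :
    ∃ U : H ≃ₗᵢ[ℂ] H₂, ∀ p ∈ G, U p.1 = p.2 := by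
  have d₁ : DenseRange ((LinearMap.fst ℂ H H₂).comp G.subtype) := by
    have : Dense ((Submodule.map (LinearMap.fst ℂ H H₂) G : Submodule ℂ H) : Set H) :=
      (Submodule.dense_iff_topologicalClosure_eq_top).2 h₁
    refine this.mono ?_
    rintro _ ⟨p, hp, rfl⟩
    exact ⟨⟨p, hp⟩, rfl⟩
  have d₂ : DenseRange ((LinearMap.snd ℂ H H₂).comp G.subtype) := by
    have : Dense ((Submodule.map (LinearMap.snd ℂ H H₂) G : Submodule ℂ H₂) : Set H₂) :=
      (Submodule.dense_iff_topologicalClosure_eq_top).2 h₂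
    refine this.mono ?_
    rintro _ ⟨p, hp, rfl⟩
    exact ⟨⟨p, hp⟩, rfl⟩
  have hn : ∀ x : G, ‖(LinearMap.snd ℂ H H₂).comp G.subtype (LinearEquiv.refl ℂ G x)‖ =
    ‖(LinearMap.fst ℂ H H₂).comp G.subtype x‖ := fun x => (h x x.2).symm
  refine ⟨(LinearEquiv.refl ℂ G).extendOfIsometry _ _ d₁ d₂ hn, fun p hp => ?_⟩
  exact LinearEquiv.extendOfIsometry_eq _ _ _ d₁ d₂ hn ⟨p, hp⟩

/-- The representation with an additional row is determined by the representation without it. -/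
theorem RowExt.unique {Q : ℂ} {N m c : ℕ} {l : ℂ} {Z : ℕ → ℕ → H →L[ℂ] H}
    {Z₂ : ℕ → ℕ → H₂ →L[ℂ] H₂} {Z' : ℕ → ℕ → H' →L[ℂ] H'} {J : H' →ₗᵢ[ℂ] H} {J₂ : H' →ₗᵢ[ℂ] H₂}
    (h : RowExt Q N m c l Z Z' J) (h₂ : RowExt Q N m c l Z₂ Z' J₂) :
    FamEquiv N (m + 1) Z Z₂ := by
  let f : (H →L[ℂ] H) × (H₂ →L[ℂ] H₂) →ₐ[ℂ] Module.End ℂ (H × H₂) :=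
    (LinearMap.prodMapAlgHom ℂ H H₂).comp (AlgHom.prodMap (toEnd H) (toEnd H₂))
  have hf : ∀ S T v, f (S, T) v = (S v.1, T v.2) := fun _ _ _ => rfl
  have rel := (h.rel.prodMk h₂.rel).map f
  -- The relation is generated, by the pairs of generators of the last row, from the graph of the
  -- identification of the two embedded spaces.
  let W : Submodule ℂ (H × H₂) := LinearMap.range (J.toLinearMap.prod J₂.toLinearMap)
  have hJW : ∀ v, (J v, J₂ v) ∈ W := fun v => ⟨v, rfl⟩
  let G := genSpan (fun d => f (Z d m, Z₂ d m)) c W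
  have hWG : W ≤ G := le_genSpan
  -- the relation is invariant under the generators
  have hG : ∀ d < N, ∀ α < m + 1, ∀ p ∈ G, f (Z d α, Z₂ d α) p ∈ G := by
    intro d hd α hα p hp
    refine rel.mem_genSpan h.c_le ?_ hd hα hp
    rintro d hd α hα _ ⟨v, rfl⟩
    change (Z d α (J v), Z₂ d α (J₂ v)) ∈ G
    rcases (Nat.lt_succ_iff_lt_or_eq.1 hα) with hα | rfl
    · rcases lt_trichotomy d c with hdc | rfl | hdc
      · rw [h.low d hdc α hα, h₂.low d hdc α hα]
        exact hWG (hJW _)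
      · rw [h.mid hd α hα, h₂.mid hd α hα]
        exact zero_mem _
      · obtain ⟨d, rfl⟩ : ∃ d', d = d' + 1 := ⟨d - 1, by omega⟩
        rw [h.high d (by omega) hd α hα, h₂.high d (by omega) hd α hα]
        exact G.smul_mem _ (hWG (hJW _))
    · rcases lt_trichotomy d c with hdc | rfl | hdc
      · exact genSpan_invariant (x := fun d => f (Z d α, Z₂ d α)) hdc (hWG (hJW v))
      · rw [h.eig hd, h₂.eig hd]
        exact G.smul_mem _ (hWG (hJW _))
      · rw [h.zero d hdc hd, h₂.zero d hdc hd]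
        exact zero_mem _
  have hG' : ∀ d < c, ∀ p ∈ G, f (star (Z d m), star (Z₂ d m)) p ∈ G := by
    intro d hd p hp
    refine rel.star_last_mem_genSpan le_rfl h.c_le ?_ hd hp
    rintro d hd _ ⟨v, rfl⟩
    change (star (Z d m) (J v), star (Z₂ d m) (J₂ v)) ∈ G
    rw [h.ann d hd, h₂.ann d hd]
    exact zero_mem _
  -- the relation preserves inner products
  have inn : ∀ p ∈ G, ∀ p' ∈ G, ⟪p.1, p'.1⟫_ℂ = ⟪p.2, p'.2⟫_ℂ := by
    let M : Submodule ℂ (H × H₂) :=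
      { carrier := {p | ∀ p' ∈ G, ⟪p.1, p'.1⟫_ℂ = ⟪p.2, p'.2⟫_ℂ}
        add_mem' := fun {a b} ha hb p' hp' => by
          rw [Prod.fst_add, Prod.snd_add, inner_add_left, inner_add_left, ha p' hp', hb p' hp']
        zero_mem' := fun p' _ => by simp
        smul_mem' := fun s a ha p' hp' => by
          rw [Prod.smul_fst, Prod.smul_snd, inner_smul_left, inner_smul_left, ha p' hp'] }
    have hM : G ≤ M := by
      refine genSpan_le ?_ ?_
      · rintro _ ⟨v, rfl⟩
        let M' : Submodule ℂ (H × H₂) :=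
          { carrier := {p | ⟪J v, p.1⟫_ℂ = ⟪J₂ v, p.2⟫_ℂ}
            add_mem' := fun {a b} ha hb => by
              simp only [Set.mem_ofPred_eq] at ha hb ⊢
              rw [Prod.fst_add, Prod.snd_add, inner_add_right, inner_add_right, ha, hb]
            zero_mem' := by simp
            smul_mem' := fun s a ha => by
              simp only [Set.mem_ofPred_eq] at ha ⊢
              rw [Prod.smul_fst, Prod.smul_snd, inner_smul_right, inner_smul_right, ha] }
        have hM' : G ≤ M' := by
          refine genSpan_le ?_ ?_
          · rintro _ ⟨v', rfl⟩
            change ⟪J v, J v'⟫_ℂ = ⟪J₂ v, J₂ v'⟫_ℂ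
            rw [J.inner_map_map, J₂.inner_map_map]
          · intro d hd p hp
            change ⟪J v, Z d m p.1⟫_ℂ = ⟪J₂ v, Z₂ d m p.2⟫_ℂ
            rw [← inner_star_left, ← inner_star_left, h.ann d hd, h₂.ann d hd]
            simp
        exact fun p' hp' => hM' hp'
      · intro d hd p hp p' hp'
        change ⟪Z d m p.1, p'.1⟫_ℂ = ⟪Z₂ d m p.2, p'.2⟫_ℂ
        rw [← inner_star_right, ← inner_star_right]
        exact hp _ (hG' d hd p' hp')
    exact fun p hp => hM hp
  have fstG : genSpan (fun d => toEnd H (Z d m)) c J.range ≤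
      Submodule.map (LinearMap.fst ℂ H H₂) G := by
    refine genSpan_le ?_ ?_
    · rintro _ ⟨v, rfl⟩
      exact ⟨_, hWG (hJW v), rfl⟩
    · rintro d hd _ ⟨p, hp, rfl⟩
      exact ⟨_, genSpan_invariant (x := fun d => f (Z d m, Z₂ d m)) hd hp, rfl⟩
  have sndG : genSpan (fun d => toEnd H₂ (Z₂ d m)) c J₂.range ≤
      Submodule.map (LinearMap.snd ℂ H H₂) G := by
    refine genSpan_le ?_ ?_
    · rintro _ ⟨v, rfl⟩
      exact ⟨_, hWG (hJW v), rfl⟩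
    · rintro d hd _ ⟨p, hp, rfl⟩
      exact ⟨_, genSpan_invariant (x := fun d => f (Z d m, Z₂ d m)) hd hp, rfl⟩
  obtain ⟨U, hU⟩ := exists_unitary_of_relation G
    (top_le_iff.1 (h.dense ▸ Submodule.topologicalClosure_mono fstG))
    (top_le_iff.1 (h₂.dense ▸ Submodule.topologicalClosure_mono sndG))
    (fun p hp => by
      have := inn p hp p hp
      rw [inner_self_eq_norm_sq_to_K, inner_self_eq_norm_sq_to_K] at this
      norm_cast at this
      exact (sq_eq_sq₀ (norm_nonneg _) (norm_nonneg _)).1 this)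
  refine ⟨U, fun d hd α hα v => ?_⟩
  have hd₁ : Dense ((Submodule.map (LinearMap.fst ℂ H H₂) G : Submodule ℂ H) : Set H) :=
    Submodule.dense_iff_topologicalClosure_eq_top.2
      (top_le_iff.1 (h.dense ▸ Submodule.topologicalClosure_mono fstG))
  refine congrFun (Continuous.ext_on hd₁ (by fun_prop : Continuous fun v => U (Z d α v))
    (by fun_prop : Continuous fun v => Z₂ d α (U v)) ?_) v
  rintro _ ⟨p, hp, rfl⟩
  change U (Z d α p.1) = Z₂ d α (U p.1)
  rw [hU p hp]
  exact hU _ (hG d hd α hα p hp)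

/-- The embedded space consists of the vectors that are annihilated by the adjoints of the
generators that belong to white boxes. -/
theorem RowExt.mem_range {Q : ℂ} {N m c : ℕ} {l : ℂ} {Z : ℕ → ℕ → H →L[ℂ] H}
    {Z' : ℕ → ℕ → H' →L[ℂ] H'} {J : H' →ₗᵢ[ℂ] H} (h : RowExt Q N m c l Z Z' J) {v : H}
    (hv : ∀ d < c, star (Z d m) v = 0) : ∃ u, J u = v := by
  -- A vector in the kernel that is orthogonal to the embedded space is orthogonal to everything
  -- that is generated from this space, hence to a dense subspace.
  have key : ∀ r : H, (∀ d < c, star (Z d m) r = 0) → r ∈ J.rangeᗮ → r = 0 := by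
    intro r hr hr'
    have : genSpan (fun d => toEnd H (Z d m)) c J.range ≤ (ℂ ∙ r)ᗮ := by
      refine genSpan_le ?_ ?_
      · intro w hw
        rw [Submodule.mem_orthogonal_singleton_iff_inner_left]
        exact (Submodule.mem_orthogonal _ _).1 hr' w hw
      · intro d hd w _
        rw [Submodule.mem_orthogonal_singleton_iff_inner_right, toEnd_apply, ← inner_star_left,
          hr d hd, inner_zero_left]
    have : (⊤ : Submodule ℂ H) ≤ (ℂ ∙ r)ᗮ := by
      rw [← h.dense]
      exact Submodule.topologicalClosure_minimal _ this (Submodule.isClosed_orthogonal _)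
    have := this (Submodule.mem_top (x := r))
    rwa [Submodule.mem_orthogonal_singleton_iff_inner_right, inner_self_eq_zero] at this
  have hcomp : IsComplete (J.range : Set H) := by
    have := J.isometry.isUniformInducing.isComplete_range
    exact this
  have : CompleteSpace J.range := completeSpace_coe_iff_isComplete.2 hcomp
  obtain ⟨_, ⟨u, rfl⟩, r, hr, rfl⟩ := J.range.exists_add_mem_mem_orthogonal v
  refine ⟨u, ?_⟩
  have : r = 0 := key r (fun d hd => by
    have := hv d hd
    rw [map_add] at this
    have h0 := h.ann d hd u
    have h0' : star (Z d m) (J.toLinearMap u) = 0 := h0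
    rwa [h0', zero_add] at this) hr
  rw [this, add_zero]; rfl

/-- Irreducibility of the smaller quantum matrix implies that of the larger one. -/
theorem RowExt.irreducible {Q : ℂ} {N m c : ℕ} {l : ℂ} {Z : ℕ → ℕ → H →L[ℂ] H}
    {Z' : ℕ → ℕ → H' →L[ℂ] H'} {J : H' →ₗᵢ[ℂ] H} (h : RowExt Q N m c l Z Z' J) (hQ : Q ≠ 0)
    (hl : l ≠ 0) (hZ' : IrrFam (nextCols N c) m Z') : IrrFam N (m + 1) Z := by
  obtain ⟨hn, hirr⟩ := hZ'
  refine ⟨J.injective.nontrivial, fun K hK hinv => ?_⟩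
  have : CompleteSpace K := hK.completeSpace_coe
  have hperp : ∀ d < N, ∀ α < m + 1, ∀ v ∈ Kᗮ, Z d α v ∈ Kᗮ := by
    intro d hd α hα v hv
    rw [Submodule.mem_orthogonal] at hv ⊢
    intro w hw
    rw [← inner_star_left]
    exact hv _ (hinv d hd α hα w hw).2
  -- The two components of a vector of the embedded space belong to this space again, because the
  -- subspace and its complement are invariant under the adjoints of the last row.
  have hdec : ∀ v, ∃ u, J u ∈ K ∧ J (v - u) ∈ Kᗮ := by
    intro v
    obtain ⟨k, hk, k', hk', hkk⟩ := K.exists_add_mem_mem_orthogonal (J v)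
    have hk0 : ∀ d < c, star (Z d m) k = 0 := by
      intro d hd
      have hd' := hd.trans_le h.c_le
      have e : star (Z d m) k + star (Z d m) k' = 0 := by
        rw [← map_add, ← hkk, h.ann d hd]
      have h1 := (hinv d hd' m (by omega) k hk).2
      have h2 : star (Z d m) k' ∈ Kᗮ := by
        rw [Submodule.mem_orthogonal] at hk' ⊢
        intro w hw
        rw [inner_star_right]
        exact hk' _ (hinv d hd' m (by omega) w hw).1
      have h3 : star (Z d m) k ∈ Kᗮ := by
        rw [eq_neg_of_add_eq_zero_left e]
        exact neg_mem h2
      have := (Submodule.mem_orthogonal _ _).1 h3 _ h1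
      rwa [inner_self_eq_zero] at this
    obtain ⟨u, hu⟩ := h.mem_range hk0
    refine ⟨u, hu ▸ hk, ?_⟩
    rw [map_sub, hkk, hu, add_sub_cancel_left]
    exact hk'
  -- Subspaces that are invariant under the generators are also invariant under the generators of
  -- the smaller quantum matrix.
  have hZJ : ∀ M : Submodule ℂ H, (∀ d < N, ∀ α < m + 1, ∀ v ∈ M, Z d α v ∈ M) →
      ∀ d < nextCols N c, ∀ α < m, ∀ v, J v ∈ M → J (Z' d α v) ∈ M := by
    intro M hM d hd α hα v hv
    have hcN := h.c_le
    rcases lt_or_ge d c with hdc | hdc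
    · rw [← h.low d hdc α hα]
      exact hM d (by omega) α (by omega) _ hv
    · have hdN : d + 1 < N := by
        unfold nextCols at hd
        split_ifs at hd <;> omega
      have := hM (d + 1) hdN α (by omega) _ hv
      rw [h.high d hdc hdN α hα] at this
      refine (M.smul_mem_iff ?_).1 this
      split_ifs <;> simp [hQ, hl]
  have h' := hirr (K.comap J.toLinearMap) (hK.preimage J.continuous) ?_
  · rcases h' with h' | h'
    · left
      have : J.range ≤ Kᗮ := by
        rintro _ ⟨v, rfl⟩
        obtain ⟨u, hu, hu'⟩ := hdec v
        have hu0 : u = 0 := by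
          have : u ∈ K.comap J.toLinearMap := hu
          rwa [h', Submodule.mem_bot] at this
        rw [hu0, sub_zero] at hu'
        exact hu'
      have : (⊤ : Submodule ℂ H) ≤ Kᗮ := by
        rw [← h.dense]
        refine Submodule.topologicalClosure_minimal _ (genSpan_le this ?_)
          (Submodule.isClosed_orthogonal _)
        exact fun d hd v hv => hperp d (hd.trans_le h.c_le) m (by omega) v hv
      rwa [top_le_iff, Submodule.orthogonal_eq_top_iff] at this
    · right
      have : J.range ≤ K := by
        rintro _ ⟨v, rfl⟩
        have : v ∈ K.comap J.toLinearMap := by rw [h']; trivial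
        exact this
      rw [← top_le_iff, ← h.dense]
      refine Submodule.topologicalClosure_minimal _ (genSpan_le this ?_) hK
      exact fun d hd v hv => (hinv d (hd.trans_le h.c_le) m (by omega) v hv).1
  · intro d hd α hα v hv
    refine ⟨hZJ K (fun d hd α hα v hv => (hinv d hd α hα v hv).1) d hd α hα v hv, ?_⟩
    change J (star (Z' d α) v) ∈ K
    obtain ⟨u, hu, hu'⟩ := hdec (star (Z' d α) v)
    have h1 := hZJ Kᗮ hperp d hd α hα _ hu'
    have h2 : ⟪star (Z' d α) v - u, star (Z' d α) v - u⟫_ℂ = 0 := by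
      rw [inner_sub_right, inner_star_right, ← J.inner_map_map, ← J.inner_map_map,
        (Submodule.mem_orthogonal' _ _).1 h1 (J v) hv, (Submodule.mem_orthogonal' _ _).1 hu' _ hu,
        sub_zero]
    rw [inner_self_eq_zero, sub_eq_zero] at h2
    rw [h2]; exact hu

/-- The number of white boxes in the last row is an invariant. -/
theorem RowExt.white_le {Q : ℂ} {N m c c₂ : ℕ} {l l₂ : ℂ} {Z : ℕ → ℕ → H →L[ℂ] H}
    {Z₂ : ℕ → ℕ → H₂ →L[ℂ] H₂} {Z' : ℕ → ℕ → H' →L[ℂ] H'} {Z₂' : ℕ → ℕ → H₂' →L[ℂ] H₂'}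
    {J : H' →ₗᵢ[ℂ] H} {J₂ : H₂' →ₗᵢ[ℂ] H₂} (h : RowExt Q N m c l Z Z' J)
    (h₂ : RowExt Q N m c₂ l₂ Z₂ Z₂' J₂) (hl : l ≠ 0) [Nontrivial H₂'] (U : H ≃ₗᵢ[ℂ] H₂)
    (hU : ∀ d < N, ∀ v, U (star (Z d m) v) = star (Z₂ d m) (U v)) : c₂ ≤ c := by
  by_contra hc
  obtain ⟨w, hw⟩ := exists_ne (0 : H₂')
  have hc₂ := h₂.c_le
  have h0 : ∀ d ≤ c, star (Z d m) (U.symm (J₂ w)) = 0 := by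
    intro d hd
    apply U.injective
    rw [hU d (by omega), U.apply_symm_apply, h₂.ann d (by omega), map_zero]
  obtain ⟨u, hu⟩ := h.mem_range fun d hd => h0 d hd.le
  have h1 : ⟪star (Z c m) (J u), J u⟫_ℂ = 0 := by rw [hu, h0 c le_rfl, inner_zero_left]
  rw [inner_star_left, h.eig (by omega), inner_smul_right, mul_eq_zero, inner_self_eq_zero] at h1
  rw [h1.resolve_left hl] at hu
  have := U.symm.map_eq_zero_iff.1 hu.symm
  exact hw ((map_eq_zero_iff J₂ J₂.injective).1 this)

/-- A unitary operator that intertwines two families also intertwines their adjoints. -/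
theorem FamEquiv.star {N m : ℕ} {Z : ℕ → ℕ → H →L[ℂ] H} {Z₂ : ℕ → ℕ → H₂ →L[ℂ] H₂}
    {U : H ≃ₗᵢ[ℂ] H₂} (hU : ∀ d < N, ∀ α < m, ∀ v, U (Z d α v) = Z₂ d α (U v)) :
    ∀ d < N, ∀ α < m, ∀ v, U (star (Z d α) v) = star (Z₂ d α) (U v) := by
  intro d hd α hα v
  refine ext_inner_right ℂ fun w => ?_
  obtain ⟨w, rfl⟩ := U.surjective w
  rw [inner_star_left, ← hU d hd α hα, U.inner_map_map, U.inner_map_map, inner_star_left]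

/-- The number of white boxes, the scalar and the smaller representation are invariants of a
representation with an additional row. -/
theorem RowExt.invariants {Q : ℂ} {N m c c₂ : ℕ} {l l₂ : ℂ} {Z : ℕ → ℕ → H →L[ℂ] H}
    {Z₂ : ℕ → ℕ → H₂ →L[ℂ] H₂} {Z' : ℕ → ℕ → H' →L[ℂ] H'} {Z₂' : ℕ → ℕ → H₂' →L[ℂ] H₂'}
    {J : H' →ₗᵢ[ℂ] H} {J₂ : H₂' →ₗᵢ[ℂ] H₂} (h : RowExt Q N m c l Z Z' J)
    (h₂ : RowExt Q N m c₂ l₂ Z₂ Z₂' J₂) (hQ : Q ≠ 0) (hl : l ≠ 0) (hl₂ : l₂ ≠ 0) [Nontrivial H']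
    [Nontrivial H₂'] (hE : FamEquiv N (m + 1) Z Z₂) :
    c = c₂ ∧ (c < N → l = l₂) ∧ FamEquiv (nextCols N c) m Z' Z₂' := by
  obtain ⟨U, hU⟩ := hE
  have hUs := FamEquiv.star hU
  have hUs' : ∀ d < N, ∀ v, U.symm (star (Z₂ d m) v) = star (Z d m) (U.symm v) := by
    intro d hd v
    rw [U.symm_apply_eq, hUs d hd m (by omega), U.apply_symm_apply]
  obtain rfl : c = c₂ := le_antisymm
    (h₂.white_le h hl₂ U.symm hUs')
    (h.white_le h₂ hl U fun d hd => hUs d hd m (by omega))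
  have hcN := h.c_le
  have ex1 : ∀ v, ∃ u, J₂ u = U (J v) := fun v => h₂.mem_range fun d hd => by
    rw [← hUs d (by omega) m (by omega), h.ann d hd, map_zero]
  have ex2 : ∀ u, ∃ v, J₂ u = U (J v) := fun u => by
    obtain ⟨v, hv⟩ := h.mem_range (v := U.symm (J₂ u)) fun d hd => by
      rw [← hUs' d (by omega), h₂.ann d hd, map_zero]
    exact ⟨v, by rw [hv, U.apply_symm_apply]⟩
  have hl' : c < N → l = l₂ := by
    intro hc
    obtain ⟨u, hu⟩ := exists_ne (0 : H₂')
    obtain ⟨v, hv⟩ := ex2 u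
    have h1 : U (Z c m (J v)) = Z₂ c m (U (J v)) := hU c hc m (by omega) _
    rw [h.eig hc, ← hv, h₂.eig hc, map_smul, ← hv] at h1
    refine smul_left_injective ℂ ?_ h1
    rwa [Ne, map_eq_zero_iff J₂ J₂.injective]
  refine ⟨rfl, hl', ?_⟩
  let G : Submodule ℂ (H' × H₂') :=
    LinearMap.ker ((J₂.toLinearMap ∘ₗ LinearMap.snd ℂ H' H₂') -
      (U.toLinearEquiv.toLinearMap ∘ₗ J.toLinearMap ∘ₗ LinearMap.fst ℂ H' H₂'))
  have memG : ∀ p, p ∈ G ↔ J₂ p.2 = U (J p.1) := fun p => by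
    rw [LinearMap.mem_ker, LinearMap.sub_apply, sub_eq_zero]; rfl
  have G₁ : (Submodule.map (LinearMap.fst ℂ H' H₂') G).topologicalClosure = ⊤ := by
    rw [eq_top_iff]
    refine le_trans ?_ (Submodule.le_topologicalClosure _)
    intro v _
    obtain ⟨u, hu⟩ := ex1 v
    exact ⟨(v, u), (memG _).2 hu, rfl⟩
  have G₂ : (Submodule.map (LinearMap.snd ℂ H' H₂') G).topologicalClosure = ⊤ := by
    rw [eq_top_iff]
    refine le_trans ?_ (Submodule.le_topologicalClosure _)
    intro u _
    obtain ⟨v, hv⟩ := ex2 u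
    exact ⟨(v, u), (memG _).2 hv, rfl⟩
  obtain ⟨U', hU'⟩ := exists_unitary_of_relation G G₁ G₂ fun p hp => by
    rw [← J.norm_map, ← J₂.norm_map, (memG p).1 hp, U.norm_map]
  refine ⟨U', fun d hd α hα v => ?_⟩
  have hUU : ∀ v, J₂ (U' v) = U (J v) := fun v => by
    obtain ⟨u, hu⟩ := ex1 v
    rw [hU' (v, u) ((memG _).2 hu), hu]
  apply J₂.injective
  rw [hUU]
  rcases lt_or_ge d c with hdc | hdc
  · rw [← h.low d hdc α hα, ← h₂.low d hdc α hα, hUU]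
    exact hU d (by omega) α (by omega) _
  · have hdN : d + 1 < N := by
      unfold nextCols at hd
      split_ifs at hd <;> omega
    have h1 := h.high d hdc hdN α hα v
    have h2 := h₂.high d hdc hdN α hα (U' v)
    rw [hUU, ← hU (d + 1) hdN α (by omega), h1, map_smul, ← hl' (by omega)] at h2
    refine smul_right_injective _ ?_ h2
    split_ifs <;> simp [hQ, hl]

/-- The smaller representation may be replaced by an equivalent one. -/
theorem RowExt.comp {Q : ℂ} {N m c : ℕ} {l : ℂ} {Z : ℕ → ℕ → H →L[ℂ] H}
    {Z' : ℕ → ℕ → H' →L[ℂ] H'} {J : H' →ₗᵢ[ℂ] H} (h : RowExt Q N m c l Z Z' J)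
    {Z₂ : ℕ → ℕ → H₂ →L[ℂ] H₂} (hE : FamEquiv (nextCols N c) m Z₂ Z') :
    ∃ J' : H₂ →ₗᵢ[ℂ] H, RowExt Q N m c l Z Z₂ J' := by
  obtain ⟨U, hU⟩ := hE
  have hcN := h.c_le
  refine ⟨J.comp U.toLinearIsometry, ⟨h.rel, hcN, fun d hd v => h.ann d hd _,
    fun hc v => h.eig hc _, fun d hd hd' v => h.zero d hd hd' _, ?_,
    fun hc α hα v => h.mid hc α hα _,
    ?_, ?_⟩⟩
  · intro d hd α hα v
    have : d < nextCols N c := by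
      unfold nextCols
      split_ifs <;> omega
    exact (h.low d hd α hα _).trans (congrArg J (hU d this α hα v).symm)
  · intro d hd hdN α hα v
    have : d < nextCols N c := by
      unfold nextCols
      split_ifs <;> omega
    exact (h.high d hd hdN α hα _).trans
      (congrArg (fun w => _ • J w) (hU d this α hα v).symm)
  · have : (J.comp U.toLinearIsometry).range = J.range := by
      ext v
      constructor
      · rintro ⟨u, rfl⟩
        exact ⟨U u, rfl⟩
      · rintro ⟨u, rfl⟩
        exact ⟨U.symm u, congrArg J (U.apply_symm_apply u)⟩
    rw [this]
    exact h.dense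

end Hilbert

/-! ### Operators on Hilbert spaces -/

section Operators

variable {H : Type*} [NormedAddCommGroup H] [InnerProductSpace ℂ H] [CompleteSpace H]

theorem clm_mul_apply (S T : H →L[ℂ] H) (v : H) : (S * T) v = S (T v) := rfl

theorem clm_one_apply (v : H) : (1 : H →L[ℂ] H) v = v := rfl

variable {K : Type*} [NormedAddCommGroup K] [InnerProductSpace ℂ K] [CompleteSpace K]

/-- Compression of an operator to a Hilbert space that is embedded by `J`. -/
def compress (J : K →ₗᵢ[ℂ] H) : (H →L[ℂ] H) →ₗ[ℂ] (K →L[ℂ] K) where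
  toFun T := ContinuousLinearMap.adjoint J.toContinuousLinearMap ∘L T ∘L J.toContinuousLinearMap
  map_add' S T := by ext; simp
  map_smul' c T := by ext; simp

variable {J : K →ₗᵢ[ℂ] H}

theorem inner_compress (T : H →L[ℂ] H) (u v : K) :
    ⟪u, compress J T v⟫_ℂ = ⟪J u, T (J v)⟫_ℂ := by
  change ⟪u, ContinuousLinearMap.adjoint J.toContinuousLinearMap (T (J v))⟫_ℂ = _
  rw [ContinuousLinearMap.adjoint_inner_right]; rfl

theorem compress_star (T : H →L[ℂ] H) : compress J (star T) = star (compress J T) := by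
  ext v
  refine ext_inner_left ℂ fun u => ?_
  rw [inner_compress, inner_star_right, inner_star_right, ← inner_conj_symm, ← inner_compress,
    inner_conj_symm]

theorem compress_one : compress J 1 = 1 := by
  ext v
  exact ext_inner_left ℂ fun u => by
    rw [inner_compress, clm_one_apply, J.inner_map_map]; rfl

/-- The embedded space is invariant under `T`. -/
def Preserves (J : K →ₗᵢ[ℂ] H) (T : H →L[ℂ] H) : Prop := ∀ v, ∃ u, J u = T (J v)

theorem Preserves.map_compress {T : H →L[ℂ] H} (h : Preserves J T) (v : K) :
    J (compress J T v) = T (J v) := by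
  obtain ⟨u, hu⟩ := h v
  have : compress J T v = u := ext_inner_left ℂ fun w => by
    rw [inner_compress, ← hu, J.inner_map_map]
  rw [this, hu]

theorem compress_mul {S T : H →L[ℂ] H} (h : Preserves J T) :
    compress J (S * T) = compress J S * compress J T := by
  ext v
  refine ext_inner_left ℂ fun u => ?_
  rw [inner_compress, clm_mul_apply, clm_mul_apply, inner_compress, h.map_compress]

theorem compress_eq_zero {T : H →L[ℂ] H} (h : ∀ v, T (J v) = 0) : compress J T = 0 := by
  ext v
  exact ext_inner_left ℂ fun u => by rw [inner_compress, h]; simp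

theorem compress_eq_one {T : H →L[ℂ] H} (h : ∀ v, T (J v) = J v) : compress J T = 1 := by
  ext v
  exact ext_inner_left ℂ fun u => by
    rw [inner_compress, h, J.inner_map_map]; rfl

theorem norm_sq_eq_inner (T : H →L[ℂ] H) (v : H) :
    ((‖T v‖ : ℂ)) ^ 2 = ⟪(star T * T) v, v⟫_ℂ := by
  rw [clm_mul_apply, inner_star_left, inner_self_eq_norm_sq_to_K]; rfl

/-- A bounded representation of the `q`-oscillator without vacuum vector is given by a unitary
operator `x`, since `1 - x x^*` is conjugated to its multiple by `q²` and therefore has spectral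
radius zero. -/
theorem oscillator {q : ℝ} (hq0 : 0 < q) (hq1 : q < 1) {x : H →L[ℂ] H}
    (hx : star x * x = ((q : ℂ) ^ 2) • (x * star x) + (1 - (q : ℂ) ^ 2) • (1 : H →L[ℂ] H))
    (hker : ∀ v, star x v = 0 → v = 0) : x * star x = 1 := by
  rcases subsingleton_or_nontrivial H with hs | hn
  · ext v; exact Subsingleton.elim _ _
  have hq2 : q ^ 2 < 1 := by nlinarith
  -- The operator `x` is invertible: `x^* x` is bounded below by `1 - q²`, and `x^*` is injective.
  have h1 : IsUnit (star x * x) := by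
    refine ContinuousLinearMap.isUnit_of_forall_le_norm_inner_map _
      (c := Real.toNNReal (1 - q ^ 2)) (by simpa using hq2) fun v => ?_
    have : ⟪(star x * x) v, v⟫_ℂ = ((q ^ 2 * ‖star x v‖ ^ 2 + (1 - q ^ 2) * ‖v‖ ^ 2 : ℝ) : ℂ) := by
      have e := norm_sq_eq_inner (star x) v
      rw [star_star] at e
      rw [hx, add_apply, smul_apply,
        smul_apply, inner_add_left, inner_smul_left, inner_smul_left, ← e,
        clm_one_apply, inner_self_eq_norm_sq_to_K]
      simp
    rw [this, Complex.norm_real, Real.norm_of_nonneg (by positivity)]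
    rw [Real.coe_toNNReal _ (by linarith)]
    nlinarith [mul_nonneg (sq_nonneg q) (sq_nonneg ‖star x v‖)]
  obtain ⟨s, hs⟩ := h1.exists_right_inv
  have h2 : x * (s * star x) = 1 := by
    have : star x * (1 - x * (s * star x)) = 0 := by
      rw [mul_sub, mul_one, ← mul_assoc, ← mul_assoc, hs, one_mul, sub_self]
    ext v
    have : (1 - x * (s * star x)) v = 0 := hker _ (ContinuousLinearMap.ext_iff.1 this v)
    rw [sub_apply, sub_eq_zero] at this
    exact this.symm
  obtain ⟨s', hs'⟩ := h1.exists_left_inv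
  have h3 : (s' * star x) * x = 1 := by rw [mul_assoc]; exact hs'
  have h4 : s' * star x = s * star x := by
    calc s' * star x = (s' * star x) * (x * (s * star x)) := by rw [h2, mul_one]
      _ = s * star x := by rw [← mul_assoc, h3, one_mul]
  let ux : (H →L[ℂ] H)ˣ := ⟨x, s * star x, h2, by rw [← h4]; exact h3⟩
  have hux : (ux : H →L[ℂ] H) = x := rfl
  set y := 1 - x * star x with hy
  have hsa : IsSelfAdjoint y := by
    rw [hy, IsSelfAdjoint, star_sub, star_one, star_mul, star_star]
  have hyx : y * x = ((q : ℂ) ^ 2) • (x * y) := by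
    rw [hy, sub_mul, mul_assoc, hx, mul_sub, mul_add, mul_smul_comm, mul_smul_comm, one_mul,
      mul_one]
    module
  have hconj : y = ((q : ℂ) ^ 2) • (ux * y * (ux⁻¹ : (H →L[ℂ] H)ˣ)) := by
    rw [hux, ← smul_mul_assoc, ← hyx, mul_assoc, ← hux, Units.mul_inv, mul_one]
  -- A point of maximal modulus of the spectrum of `y` is the multiple by `q²` of another point.
  have hspec : spectrum ℂ y = (fun z => (q : ℂ) ^ 2 • z) '' spectrum ℂ y := by
    have : spectrum ℂ y = spectrum ℂ (((q : ℂ) ^ 2) • (ux * y * (ux⁻¹ : (H →L[ℂ] H)ˣ))) :=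
      congrArg _ hconj
    rw [spectrum.smul_eq_smul _ _ (spectrum.nonempty _), spectrum.units_conjugate] at this
    exact this
  obtain ⟨z, hz, hzr⟩ := spectrum.exists_nnnorm_eq_spectralRadius y
  have hz0 : z = 0 := by
    rw [hspec] at hz
    obtain ⟨z', hz', rfl⟩ := hz
    have hle : (‖z'‖₊ : ℝ≥0∞) ≤ spectralRadius ℂ y :=
      le_iSup₂ (f := fun k (_ : k ∈ spectrum ℂ y) => (‖k‖₊ : ℝ≥0∞)) z' hz'
    rw [← hzr, ENNReal.coe_le_coe, ← NNReal.coe_le_coe] at hle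
    simp only [coe_nnnorm, norm_smul, norm_pow, Complex.norm_real, Real.norm_of_nonneg hq0.le]
      at hle
    have : ‖z'‖ = 0 := by nlinarith [norm_nonneg z']
    rw [norm_eq_zero.1 this]
    exact smul_zero _
  rw [hz0, hsa.spectralRadius_eq_nnnorm] at hzr
  have : y = 0 := by simpa using hzr.symm
  rw [hy, sub_eq_zero] at this
  exact this.symm

/-- Schur's lemma for a normal operator `u`: if there are no closed subspaces that are invariant
under all operators which commute with `u` and `u^*`, then `u` is a scalar. -/
theorem schur [Nontrivial H] {u : H →L[ℂ] H} (hu : IsStarNormal u)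
    (hirr : ∀ M : Submodule ℂ H, IsClosed (M : Set H) →
      (∀ g, Commute u g → Commute (star u) g → ∀ v ∈ M, g v ∈ M) → M = ⊥ ∨ M = ⊤) :
    ∃ l : ℂ, u = l • 1 := by
  obtain ⟨l, hl⟩ := spectrum.nonempty u
  refine ⟨l, ?_⟩
  rw [← Algebra.algebraMap_eq_smul_one]
  refine CFC.eq_algebraMap_of_spectrum_subset_singleton u l fun t ht => ?_
  by_contra htl
  rw [Set.mem_singleton_iff] at htl
  have hr : 0 < ‖t - l‖ := norm_pos_iff.2 (sub_ne_zero.2 htl)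
  -- If the spectrum has two points `l` and `t`, then functions with disjoint supports around them
  -- give two non-zero operators with product zero. The kernel of the first one is invariant.
  let f : ℂ → ℂ → ℂ := fun p z => ((max 0 (‖t - l‖ / 2 - ‖z - p‖) : ℝ) : ℂ)
  have hf : ∀ p, Continuous (f p) := fun p => by fun_prop
  have hfp : ∀ p ∈ spectrum ℂ u, cfc (f p) u ≠ 0 := by
    intro p hp h0
    have := cfc_map_spectrum (f p) u hu (hf p).continuousOn
    rw [h0, spectrum.zero_eq] at this
    have h1 : f p p ∈ ({0} : Set ℂ) := this ▸ ⟨p, hp, rfl⟩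
    simp only [f, sub_self, norm_zero, sub_zero, Set.mem_singleton_iff, Complex.ofReal_eq_zero]
      at h1
    rw [max_eq_right (by positivity)] at h1
    linarith
  have hmul : cfc (f l) u * cfc (f t) u = 0 := by
    rw [← cfc_mul _ _ _ (hf l).continuousOn (hf t).continuousOn]
    have : (fun z => f l z * f t z) = fun _ => 0 := by
      funext z
      have htri : ‖t - l‖ ≤ ‖z - l‖ + ‖z - t‖ := by
        have := norm_sub_le (z - l) (z - t)
        simpa using this
      rcases le_total (‖t - l‖ / 2) ‖z - l‖ with h | h
      · have : max 0 (‖t - l‖ / 2 - ‖z - l‖) = 0 := max_eq_left (by linarith)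
        simp only [f, this]; simp
      · have : max 0 (‖t - l‖ / 2 - ‖z - t‖) = 0 := max_eq_left (by linarith)
        simp only [f, this]; simp
    rw [this]
    simp
  rcases hirr (LinearMap.ker (cfc (f l) u).toLinearMap) (ContinuousLinearMap.isClosed_ker _)
    (fun g h1 h2 v hv => by
      have hc := Commute.cfc h1 h2 (f l)
      have := ContinuousLinearMap.ext_iff.1 hc.eq v
      simp only [clm_mul_apply] at this
      change cfc (f l) u v = 0 at hv
      change cfc (f l) u (g v) = 0
      rw [this, hv, map_zero]) with h | h
  · refine hfp t ht ?_
    ext v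
    have : cfc (f t) u v ∈ LinearMap.ker (cfc (f l) u).toLinearMap :=
      ContinuousLinearMap.ext_iff.1 hmul v
    rw [h] at this
    exact this
  · refine hfp l hl ?_
    ext v
    have : v ∈ LinearMap.ker (cfc (f l) u).toLinearMap := by rw [h]; trivial
    exact this

theorem apply_eq_zero_iff_of_normal {T : H →L[ℂ] H} (hT : star T * T = T * star T) (v : H) :
    star T v = 0 ↔ T v = 0 := by
  have h1 := norm_sq_eq_inner T v
  have h2 := norm_sq_eq_inner (star T) v
  rw [star_star, ← hT, ← h1] at h2
  norm_cast at h2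
  have h3 := (sq_eq_sq₀ (norm_nonneg _) (norm_nonneg _)).1 h2
  rw [← norm_eq_zero, h3, norm_eq_zero]

/-- In an irreducible family, a normal operator that commutes with the family up to scalars is zero
or injective. -/
theorem IrrFam.eq_zero_or_injective {N m : ℕ} {Z : ℕ → ℕ → H →L[ℂ] H} (hZ : IrrFam N m Z)
    {T : H →L[ℂ] H} (hT : star T * T = T * star T)
    (h : ∀ d < N, ∀ α < m, ∃ s : ℂ, s ≠ 0 ∧ T * Z d α = s • (Z d α * T)) :
    T = 0 ∨ ∀ v, T v = 0 → v = 0 := by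
  have hinv : ∀ d < N, ∀ α < m, ∀ v ∈ LinearMap.ker T.toLinearMap,
      Z d α v ∈ LinearMap.ker T.toLinearMap ∧ star (Z d α) v ∈ LinearMap.ker T.toLinearMap := by
    intro d hd α hα v hv
    obtain ⟨s, hs, e⟩ := h d hd α hα
    change T v = 0 at hv
    have e1 := ContinuousLinearMap.ext_iff.1 e v
    have e2 := ContinuousLinearMap.ext_iff.1 (congrArg star e) v
    simp only [star_mul, star_smul, clm_mul_apply,
      smul_apply] at e1 e2
    refine ⟨?_, ?_⟩
    · change T (Z d α v) = 0
      rw [e1, hv]; simp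
    · change T (star (Z d α) v) = 0
      rw [← apply_eq_zero_iff_of_normal hT] at hv ⊢
      rw [hv, map_zero, eq_comm, smul_eq_zero] at e2
      exact e2.resolve_left (star_ne_zero.2 hs)
  rcases hZ.2 (LinearMap.ker T.toLinearMap) (ContinuousLinearMap.isClosed_ker _) hinv with h' | h'
  · right
    intro v hv
    have : v ∈ LinearMap.ker T.toLinearMap := hv
    rwa [h', Submodule.mem_bot] at this
  · left
    ext v
    have : v ∈ LinearMap.ker T.toLinearMap := by rw [h']; trivial
    exact this

end Operators

/-! ### The last row of a representation -/

section LastRow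

variable {H : Type*} [NormedAddCommGroup H] [InnerProductSpace ℂ H] [CompleteSpace H]

/-- The defect `1 - ∑_{e < c} x_e x_e^*` of the generators `x_e` of the last row. -/
def defect (Z : ℕ → ℕ → H →L[ℂ] H) (m c : ℕ) : H →L[ℂ] H :=
  1 - ∑ e ∈ Finset.range c, Z e m * star (Z e m)

variable {q : ℝ} {N m : ℕ} {Z : ℕ → ℕ → H →L[ℂ] H}

theorem defect_zero : defect Z m 0 = 1 := by simp [defect]

theorem defect_succ (c : ℕ) : defect Z m (c + 1) = defect Z m c - Z c m * star (Z c m) := by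
  rw [defect, defect, Finset.sum_range_succ]; abel

theorem star_defect (c : ℕ) : star (defect Z m c) = defect Z m c := by
  simp [defect, star_sum]

theorem IsQMat.star_mul_last (h : IsQMat (q : ℂ) N (m + 1) Z) (hq : q ≠ 0) {d : ℕ} (hd : d < N) :
    star (Z d m) * Z d m =
      ((q : ℂ) ^ 2) • (Z d m * star (Z d m)) + (1 - (q : ℂ) ^ 2) • defect Z m d := by
  have hQ : (q : ℂ) ≠ 0 := by exact_mod_cast hq
  have := h.mixed_eq d hd m (by omega) m (by omega)
  simp only [rowMix_last, ← Finset.smul_sum, if_true] at this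
  rw [this, defect, smul_sub, smul_smul, smul_smul]
  have e : ((q : ℂ)⁻¹ - q) * q = 1 - (q : ℂ) ^ 2 := by field_simp
  rw [e, sq]
  abel

theorem IsQMat.star_mul_last' (h : IsQMat (q : ℂ) N (m + 1) Z) (hq : q ≠ 0) {d : ℕ} (hd : d < N) :
    star (Z d m) * Z d m =
      Z d m * star (Z d m) + (1 - (q : ℂ) ^ 2) • defect Z m (d + 1) := by
  rw [h.star_mul_last hq hd, defect_succ]; module

theorem IsQMat.star_mul_last_of_ne (h : IsQMat (q : ℂ) N (m + 1) Z) {d e : ℕ} (hd : d < N)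
    (he : e < N) (hde : d ≠ e) :
    star (Z e m) * Z d m = (q : ℂ) • (Z d m * star (Z e m)) := by
  rw [h.mixed_ne d hd e he hde m (by omega) m (by omega), rowMix_last]

theorem IsQMat.star_last_mul_of_ne (h : IsQMat (q : ℂ) N (m + 1) Z) {d e α : ℕ} (hd : d < N)
    (he : e < N) (hde : d ≠ e) (hα : α < m) :
    star (Z e m) * Z d α = Z d α * star (Z e m) := by
  rw [h.mixed_ne d hd e he hde α (by omega) m (by omega), rowMix_of_ne (by omega)]

theorem IsQMat.star_last_mul (h : IsQMat (q : ℂ) N (m + 1) Z) {d α : ℕ} (hd : d < N)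
    (hα : α < m) :
    star (Z d m) * Z d α = (q : ℂ) • (Z d α * star (Z d m)) -
      ((q : ℂ)⁻¹ - q) • ∑ e ∈ Finset.range d, Z e α * star (Z e m) := by
  rw [h.mixed_eq d hd α (by omega) m (by omega)]
  simp only [rowMix_of_ne (show α ≠ m by omega), if_neg (show α ≠ m by omega), zero_smul, add_zero]

theorem IsQMat.star_mul_lastRow (h : IsQMat (q : ℂ) N (m + 1) Z) {d α : ℕ} (hd : d < N)
    (hα : α < m) :
    star (Z d α) * Z d m = (q : ℂ) • (Z d m * star (Z d α)) -
      ((q : ℂ)⁻¹ - q) • ∑ e ∈ Finset.range d, Z e m * star (Z e α) := by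
  rw [h.mixed_eq d hd m (by omega) α (by omega)]
  simp only [rowMix_of_ne (show m ≠ α by omega), if_neg (show m ≠ α by omega), zero_smul, add_zero]

/-- The defect of the whole last row commutes with the generators of the other rows. -/
theorem IsQMat.defect_mul_of_lt (h : IsQMat (q : ℂ) N (m + 1) Z) (hq : q ≠ 0) {d α : ℕ}
    (hd : d < N) (hα : α < m) : defect Z m N * Z d α = Z d α * defect Z m N := by
  have hQ : (q : ℂ) ≠ 0 := by exact_mod_cast hq
  have hN : Finset.range N = Finset.range d ∪ {d} ∪ Finset.Ioo d N := by ext; simp; omega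
  have h1 : Disjoint (Finset.range d ∪ {d}) (Finset.Ioo d N) := by
    rw [Finset.disjoint_left]; intro; simp; omega
  have h2 : Disjoint (Finset.range d) {d} := by simp
  rw [defect, sub_mul, mul_sub, one_mul, mul_one, Finset.sum_mul, Finset.mul_sum, hN,
    Finset.sum_union h1, Finset.sum_union h1, Finset.sum_union h2, Finset.sum_union h2,
    Finset.sum_singleton, Finset.sum_singleton]
  have e1 : ∑ e ∈ Finset.Ioo d N, Z e m * star (Z e m) * Z d α =
      ∑ e ∈ Finset.Ioo d N, Z d α * (Z e m * star (Z e m)) := by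
    refine Finset.sum_congr rfl fun e he => ?_
    obtain ⟨he, he'⟩ := Finset.mem_Ioo.1 he
    rw [mul_assoc, h.star_last_mul_of_ne hd he' (by omega) hα, ← mul_assoc, ← mul_assoc,
      h.comm d e he he' α m hα (by omega)]
  have e2 : ∑ e ∈ Finset.range d, Z e m * star (Z e m) * Z d α =
      ∑ e ∈ Finset.range d, (Z d α * (Z e m * star (Z e m)) +
        ((q : ℂ)⁻¹ - q) • (Z d m * (Z e α * star (Z e m)))) := by
    refine Finset.sum_congr rfl fun e he => ?_
    have he := Finset.mem_range.1 he
    rw [mul_assoc, h.star_last_mul_of_ne hd (by omega) (by omega) hα, ← mul_assoc, ← mul_assoc,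
      h.cross e d he hd α m hα (by omega), add_mul, smul_mul_assoc, mul_assoc (Z d m)]
    module
  have e3 : Z d m * star (Z d m) * Z d α = Z d α * (Z d m * star (Z d m)) -
      ∑ e ∈ Finset.range d, ((q : ℂ)⁻¹ - q) • (Z d m * (Z e α * star (Z e m))) := by
    rw [mul_assoc, h.star_last_mul hd hα, ← mul_assoc (Z d α), h.row d hd α m hα (by omega),
      mul_sub, mul_smul_comm, mul_smul_comm, Finset.mul_sum, smul_mul_assoc, mul_assoc,
      Finset.smul_sum]
  rw [e1, e2, e3, Finset.sum_add_distrib]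
  abel

theorem IsQMat.defect_mul_of_le (h : IsQMat (q : ℂ) N (m + 1) Z) {c d : ℕ} (hc : c ≤ d)
    (hd : d < N) : defect Z m c * Z d m = Z d m * defect Z m c := by
  rw [defect, sub_mul, mul_sub, one_mul, mul_one, Finset.sum_mul, Finset.mul_sum]
  congr 1
  refine Finset.sum_congr rfl fun e he => ?_
  have he := Finset.mem_range.1 he
  rw [mul_assoc, h.star_mul_last_of_ne hd (by omega) (by omega), ← mul_assoc,
    h.col m (by omega) e d (by omega) hd, mul_smul_comm, smul_mul_assoc, mul_assoc]

theorem IsQMat.defect_mul_last (h : IsQMat (q : ℂ) N (m + 1) Z) (hq : q ≠ 0) {c d : ℕ}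
    (hd : d < c) (hc : c ≤ N) :
    defect Z m c * Z d m = ((q : ℂ) ^ 2) • (Z d m * defect Z m c) := by
  induction c, Nat.succ_le_of_lt hd using Nat.le_induction with
  | base =>
    rw [Nat.succ_eq_add_one, defect_succ, sub_mul, h.defect_mul_of_le le_rfl (by omega), mul_assoc,
      h.star_mul_last hq (by omega), mul_sub, mul_add, mul_smul_comm, mul_smul_comm]
    module
  | succ c hc' ih =>
    rw [defect_succ, sub_mul, ih (by omega) (by omega), mul_assoc,
      h.star_mul_last_of_ne (by omega) (by omega) (by omega), mul_smul_comm, ← mul_assoc,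
      h.col m (by omega) d c (by omega) (by omega), mul_sub, smul_mul_assoc, mul_assoc]
    module

/-- In an irreducible representation either the last row has only white boxes, or there is a box
such that the generators to the left of it vanish and the generator that belongs to it is
injective. The number `c` is the number of boxes to the right of it. -/
structure LastRow (q : ℝ) (N m c : ℕ) (Z : ℕ → ℕ → H →L[ℂ] H) : Prop where
  pos : 0 < q
  lt_one : q < 1
  rel : IsQMat (q : ℂ) N (m + 1) Z
  irr : IrrFam N (m + 1) Z
  le : c ≤ N
  eq_zero : ∀ d, c < d → d < N → Z d m = 0
  defect_eq_zero : c < N → defect Z m (c + 1) = 0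
  injective : c < N → ∀ v, Z c m v = 0 → v = 0
  defect_injective : c = N → ∀ v, defect Z m N v = 0 → v = 0

/-- If not all boxes are white, then the box with the injective generator is found from the left: as
long as the defect of the first `j + 1` generators vanishes, the last of them is normal and commutes
with all generators up to scalars, so that it is zero or injective. If it is zero, then the defect
of the first `j` of them vanishes, too. -/
theorem IrrFam.exists_lastRow (hq0 : 0 < q) (hq1 : q < 1) (hirr : IrrFam N (m + 1) Z)
    (h : IsQMat (q : ℂ) N (m + 1) Z) : ∃ c, LastRow q N m c Z := by
  have hq : q ≠ 0 := hq0.ne'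
  have hQ : (q : ℂ) ≠ 0 := by exact_mod_cast hq
  have descend : ∀ j ≤ N, defect Z m j = 0 → (∀ d, j ≤ d → d < N → Z d m = 0) →
      ∃ c, LastRow q N m c Z := by
    intro j
    induction j with
    | zero =>
      intro _ h0 _
      rw [defect_zero] at h0
      obtain ⟨v, hv⟩ := @exists_ne H hirr.1 0
      exact absurd (ContinuousLinearMap.ext_iff.1 h0 v) hv
    | succ j ih =>
      intro hj hy hx
      have hn : star (Z j m) * Z j m = Z j m * star (Z j m) := by
        rw [h.star_mul_last' hq (by omega), hy, smul_zero, add_zero]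
      rcases hirr.eq_zero_or_injective hn (fun d hd α hα => by
        rcases (Nat.lt_succ_iff_lt_or_eq.1 hα) with hα | rfl
        · rcases lt_trichotomy d j with hdj | rfl | hdj
          · exact ⟨1, one_ne_zero, by rw [one_smul, h.comm d j hdj (by omega) α m hα (by omega)]⟩
          · refine ⟨(q : ℂ)⁻¹, inv_ne_zero hQ, ?_⟩
            rw [h.row d hd α m hα (by omega), smul_smul, inv_mul_cancel₀ hQ, one_smul]
          · refine ⟨1, one_ne_zero, ?_⟩
            rw [h.cross j d hdj hd α m hα (by omega), hx d hdj hd]; simp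
        · rcases lt_trichotomy d j with hdj | rfl | hdj
          · exact ⟨q, hQ, h.col α (by omega) d j hdj (by omega)⟩
          · exact ⟨1, one_ne_zero, by rw [one_smul]⟩
          · exact ⟨1, one_ne_zero, by rw [hx d hdj hd]; simp⟩) with h0 | h0
      · refine ih (by omega) ?_ fun d hd hd' => ?_
        · rw [defect_succ, h0] at hy
          simpa using hy
        · rcases Nat.eq_or_lt_of_le hd with rfl | hd
          · exact h0
          · exact hx d hd hd'
      · exact ⟨j, hq0, hq1, h, hirr, by omega, fun d hd hd' => hx d hd hd', fun _ => hy,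
          fun _ => h0, fun hj => by omega⟩
  rcases hirr.eq_zero_or_injective (T := defect Z m N) (by rw [star_defect])
    (fun d hd α hα => by
      rcases (Nat.lt_succ_iff_lt_or_eq.1 hα) with hα | rfl
      · exact ⟨1, one_ne_zero, by rw [one_smul, h.defect_mul_of_lt hq hd hα]⟩
      · exact ⟨_, pow_ne_zero 2 hQ, h.defect_mul_last hq hd le_rfl⟩) with h0 | h0
  · exact descend N le_rfl h0 fun d hd hd' => by omega
  · exact ⟨N, hq0, hq1, h, hirr, le_rfl, fun d hd hd' => by omega, fun hN => by omega,
      fun hN => by omega, fun _ => h0⟩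

/-- The vectors that are annihilated by the adjoints of the first `c` generators of the last row. -/
def lastVac (Z : ℕ → ℕ → H →L[ℂ] H) (m c : ℕ) : Submodule ℂ H where
  carrier := {v | ∀ d < c, star (Z d m) v = 0}
  add_mem' hv hw d hd := by rw [map_add, hv d hd, hw d hd, add_zero]
  zero_mem' d _ := map_zero _
  smul_mem' s v hv d hd := by rw [map_smul, hv d hd, smul_zero]

theorem mem_lastVac {c : ℕ} {v : H} : v ∈ lastVac Z m c ↔ ∀ d < c, star (Z d m) v = 0 := Iff.rfl

theorem isClosed_lastVac (c : ℕ) : IsClosed (lastVac Z m c : Set H) := by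
  have : (lastVac Z m c : Set H) = ⋂ d, ⋂ _ : d < c, {v | star (Z d m) v = 0} := by
    ext v; simp [mem_lastVac]
  rw [this]
  exact isClosed_iInter fun d => isClosed_iInter fun _ =>
    isClosed_eq (star (Z d m)).continuous continuous_const

instance (c : ℕ) : CompleteSpace (lastVac Z m c) := (isClosed_lastVac c).completeSpace_coe

/-- On the common kernel the defect is the identity. -/
theorem defect_apply_of_mem {c : ℕ} {v : H} (hv : v ∈ lastVac Z m c) : defect Z m c v = v := by
  rw [defect, sub_apply, sum_apply,
    Finset.sum_eq_zero fun e he => ?_, sub_zero, clm_one_apply]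
  rw [clm_mul_apply, hv e (Finset.mem_range.1 he), map_zero]

theorem IsQMat.last_mem_lastVac (h : IsQMat (q : ℂ) N (m + 1) Z) {c d : ℕ} (hc : c ≤ d)
    (hd : d < N) {v : H} (hv : v ∈ lastVac Z m c) : Z d m v ∈ lastVac Z m c := by
  intro e he
  rw [← clm_mul_apply, h.star_mul_last_of_ne hd (by omega) (by omega)]
  simp only [smul_apply, clm_mul_apply, hv e he, map_zero, smul_zero]

theorem IsQMat.star_last_mem_lastVac (h : IsQMat (q : ℂ) N (m + 1) Z) {c d : ℕ} (hc : c ≤ d)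
    (hd : d < N) {v : H} (hv : v ∈ lastVac Z m c) : star (Z d m) v ∈ lastVac Z m c := by
  intro e he
  rw [← clm_mul_apply, ← star_mul, h.col m (by omega) e d (by omega) hd, star_smul, star_mul]
  simp only [smul_apply, clm_mul_apply, hv e he, map_zero, smul_zero]

/-- An operator with `‖T‖ ≤ q ‖T‖` for some `q < 1` vanishes. -/
theorem eq_zero_of_norm_le (hq1 : q < 1) {T : H →L[ℂ] H}
    (h : ∀ v, ‖T v‖ ≤ q * ‖T‖ * ‖v‖) : T = 0 := by
  rcases le_or_gt 0 (q * ‖T‖) with h0 | h0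
  · have := T.opNorm_le_bound h0 h
    rw [← norm_eq_zero]
    nlinarith [norm_nonneg T]
  · ext v
    rw [zero_apply, ← norm_eq_zero]
    nlinarith [h v, norm_nonneg (T v), norm_nonneg v]

/-- If the vectors annihilated by the adjoints of `x_0, …, x_{j-1}` contain no vacuum vector for
`x_j`, then they are annihilated by the remaining generators of the row. -/
theorem IsQMat.defect_of_lastVac_eq_bot {K : Type*} [NormedAddCommGroup K] [InnerProductSpace ℂ K]
    [CompleteSpace K] (h : IsQMat (q : ℂ) N (m + 1) Z) (hq0 : 0 < q) (hq1 : q < 1) {j : ℕ}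
    (hj : j < N) {J : K →ₗᵢ[ℂ] H} (hJ : ∀ v, v ∈ lastVac Z m j ↔ ∃ u, J u = v)
    (h0 : lastVac Z m (j + 1) = ⊥) :
    (∀ d, j + 1 ≤ d → d ≤ N → ∀ v, defect Z m d (J v) = 0) ∧
      ∀ d, j < d → d < N → ∀ v, Z d m (J v) = 0 := by
  have hq := hq0.ne'
  have hp : ∀ d, j ≤ d → d < N → Preserves J (Z d m) := fun d hd hd' v =>
    (hJ _).1 (h.last_mem_lastVac hd hd' ((hJ _).2 ⟨v, rfl⟩))
  have hps : ∀ d, j ≤ d → d < N → Preserves J (star (Z d m)) := fun d hd hd' v =>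
    (hJ _).1 (h.star_last_mem_lastVac hd hd' ((hJ _).2 ⟨v, rfl⟩))
  have hv1 : ∀ v, defect Z m j (J v) = J v := fun v => defect_apply_of_mem ((hJ _).2 ⟨v, rfl⟩)
  -- The compression of `x_j` is an oscillator without vacuum.
  have hx : compress J (Z j m) * star (compress J (Z j m)) = 1 := by
    refine oscillator hq0 hq1 ?_ fun v hv => ?_
    · rw [← compress_star, ← compress_mul (hp j le_rfl hj), ← compress_mul (hps j le_rfl hj),
        h.star_mul_last hq hj, map_add, map_smul, map_smul, compress_eq_one hv1]
    · have : J v ∈ lastVac Z m (j + 1) := by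
        intro d hd
        rcases Nat.lt_succ_iff_lt_or_eq.1 hd with hd | rfl
        · exact (hJ _).2 ⟨v, rfl⟩ d hd
        · rw [← (hps d le_rfl hj).map_compress, compress_star, hv, map_zero]
      rw [h0, Submodule.mem_bot] at this
      exact (map_eq_zero_iff J J.injective).1 this
  -- As long as the defect vanishes, `x^* x = q² x x^*`, which is possible only for `x = 0`.
  have hzero : ∀ d, j < d → d < N → (∀ v, defect Z m d (J v) = 0) → compress J (Z d m) = 0 := by
    intro d hd hd' hv
    have e : star (compress J (Z d m)) * compress J (Z d m) =
        ((q : ℂ) ^ 2) • (compress J (Z d m) * star (compress J (Z d m))) := by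
      rw [← compress_star, ← compress_mul (hp d hd.le hd'), ← compress_mul (hps d hd.le hd'),
        h.star_mul_last hq hd', map_add, map_smul, map_smul, compress_eq_zero hv,
        smul_zero, add_zero]
    refine eq_zero_of_norm_le hq1 fun v => ?_
    have e1 := norm_sq_eq_inner (compress J (Z d m)) v
    have e2 := norm_sq_eq_inner (star (compress J (Z d m))) v
    rw [star_star] at e2
    rw [e, smul_apply, inner_smul_left, ← e2] at e1
    have e3 : ‖compress J (Z d m) v‖ ^ 2 = (q * ‖star (compress J (Z d m)) v‖) ^ 2 := by
      simp only [map_pow, Complex.conj_ofReal] at e1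
      rw [mul_pow]; exact_mod_cast e1
    have h1 := (sq_eq_sq₀ (norm_nonneg _) (mul_nonneg hq0.le (norm_nonneg _))).1 e3
    rw [h1, mul_assoc]
    refine mul_le_mul_of_nonneg_left ?_ hq0.le
    have := (star (compress J (Z d m))).le_opNorm v
    rwa [norm_star] at this
  have hy : ∀ d, j + 1 ≤ d → d ≤ N → ∀ v, defect Z m d (J v) = 0 := by
    intro d hd
    induction d, hd using Nat.le_induction with
    | base =>
      intro _ v
      have := congrArg J (ContinuousLinearMap.ext_iff.1 hx v)
      rw [← compress_star, clm_mul_apply, (hp j le_rfl hj).map_compress,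
        (hps j le_rfl hj).map_compress] at this
      rw [defect_succ, sub_apply, hv1, clm_mul_apply, this]
      exact sub_self (J v)
    | succ d hd ihd =>
      intro hd' v
      have h1 := hzero d hd (by omega) (ihd (by omega))
      have h2 : star (Z d m) (J v) = 0 := by
        rw [← (hps d (by omega) (by omega)).map_compress, compress_star, h1, star_zero]
        exact map_zero J
      rw [defect_succ, sub_apply, ihd (by omega) v, clm_mul_apply, h2]
      simp
  refine ⟨hy, fun d hd hd' v => ?_⟩
  rw [← (hp d hd.le hd').map_compress, hzero d hd hd' (hy d hd hd'.le)]
  exact map_zero J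

/-- The common kernels of the adjoints that belong to the white boxes are not zero: otherwise an
oscillator without vacuum would make all the remaining generators of the row vanish. -/
theorem LastRow.lastVac_ne_bot {c : ℕ} (h : LastRow q N m c Z) : lastVac Z m c ≠ ⊥ := by
  have key : ∀ j ≤ c, lastVac Z m j ≠ ⊥ := by
    intro j
    induction j with
    | zero =>
      intro _ h0
      obtain ⟨v, hv⟩ := @exists_ne H h.irr.1 0
      have : v ∈ lastVac Z m 0 := fun d hd => by omega
      rw [h0] at this
      exact hv this
    | succ j ih =>
      intro hj h0
      have hc := h.le
      refine ih (by omega) ?_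
      obtain ⟨h1, h2⟩ := h.rel.defect_of_lastVac_eq_bot h.pos h.lt_one (by omega)
        (J := (lastVac Z m j).subtypeₗᵢ) (fun v => ⟨fun hv => ⟨⟨v, hv⟩, rfl⟩, fun ⟨u, hu⟩ =>
          hu ▸ u.2⟩) h0
      rw [eq_bot_iff]
      intro v hv
      rcases h.le.lt_or_eq with hcN | hcN
      · exact h.injective hcN v (h2 c (by omega) hcN ⟨v, hv⟩)
      · exact h.defect_injective hcN v (h1 N (by omega) le_rfl ⟨v, hv⟩)
  exact key c le_rfl

end LastRow

/-! ### The action of the generators on the common kernel -/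

section LastRow

variable {H : Type*} [NormedAddCommGroup H] [InnerProductSpace ℂ H] [CompleteSpace H]
variable {K : Type*} [NormedAddCommGroup K] [InnerProductSpace ℂ K] [CompleteSpace K]
variable {q : ℝ} {N m c : ℕ} {Z : ℕ → ℕ → H →L[ℂ] H} {J : K →ₗᵢ[ℂ] H}

namespace LastRow

variable (h : LastRow q N m c Z) (hJ : ∀ v, v ∈ lastVac Z m c ↔ ∃ u, J u = v)

include h hJ

theorem star_last {d : ℕ} (hd : d < N) (hdc : d ≠ c) (v : K) : star (Z d m) (J v) = 0 := by
  rcases Nat.lt_or_gt_of_ne hdc with hdc | hdc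
  · exact (hJ _).2 ⟨v, rfl⟩ d hdc
  · rw [h.eq_zero d hdc hd, star_zero]; rfl

/-- The generators of the other rows preserve the common kernel, since the adjoints of the last row
can be moved past them. -/
theorem preserves {d α : ℕ} (hd : d < N) (hα : α < m) : Preserves J (Z d α) := by
  refine fun v => (hJ _).1 fun e he => ?_
  have hv := (hJ _).2 ⟨v, rfl⟩
  have hc := h.le
  rw [← clm_mul_apply]
  by_cases hde : d = e
  · subst hde
    rw [h.rel.star_last_mul hd hα, sub_apply,
      smul_apply, smul_apply,
      sum_apply, clm_mul_apply, hv d he,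
      Finset.sum_eq_zero fun i hi => by
        rw [clm_mul_apply, hv i ((Finset.mem_range.1 hi).trans he), map_zero]]
    simp
  · rw [h.rel.star_last_mul_of_ne hd (by omega) hde hα, clm_mul_apply, hv e he, map_zero]

/-- The adjoints of the generators of the other rows preserve the common kernel, apart from those in
the column of the box to the left of the white ones. -/
theorem preserves_star {d α : ℕ} (hd : d < N) (hdc : d ≠ c) (hα : α < m) :
    Preserves J (star (Z d α)) := by
  refine fun v => (hJ _).1 fun e he => ?_
  have hv := (hJ _).2 ⟨v, rfl⟩
  have hc := h.le
  rw [← clm_mul_apply, ← star_mul]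
  rcases lt_trichotomy d e with hde | rfl | hde
  · rw [h.rel.comm d e hde (by omega) α m hα (by omega), star_mul, clm_mul_apply, hv e he,
      map_zero]
  · rw [h.rel.row d hd α m hα (by omega), star_smul, star_mul, smul_apply,
      clm_mul_apply, hv d he, map_zero, smul_zero]
  · rw [h.rel.cross e d hde hd α m hα (by omega), star_add, star_smul, star_mul, star_mul,
      add_apply, smul_apply, clm_mul_apply, clm_mul_apply,
      hv e he, h.star_last hJ hd hdc]
    simp

theorem preserves_box (hc : c < N) : Preserves J (Z c m) := fun v =>
  (hJ _).1 (h.rel.last_mem_lastVac le_rfl hc ((hJ _).2 ⟨v, rfl⟩))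

theorem preserves_star_box (hc : c < N) : Preserves J (star (Z c m)) := fun v =>
  (hJ _).1 (h.rel.star_last_mem_lastVac le_rfl hc ((hJ _).2 ⟨v, rfl⟩))

theorem box_mul_star (hc : c < N) (v : K) : (Z c m * star (Z c m)) (J v) = J v := by
  have h1 := h.defect_eq_zero hc
  rw [defect_succ, sub_eq_zero] at h1
  rw [← h1, defect_apply_of_mem ((hJ _).2 ⟨v, rfl⟩)]

theorem star_mul_box (hc : c < N) (v : K) : (star (Z c m) * Z c m) (J v) = J v := by
  rw [h.rel.star_mul_last' h.pos.ne' hc, h.defect_eq_zero hc, smul_zero, add_zero,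
    h.box_mul_star hJ hc]

theorem compress_box_mul_star (hc : c < N) :
    compress J (Z c m) * star (compress J (Z c m)) = 1 := by
  rw [← compress_star, ← compress_mul (h.preserves_star_box hJ hc),
    compress_eq_one (h.box_mul_star hJ hc)]

theorem star_mul_compress_box (hc : c < N) :
    star (compress J (Z c m)) * compress J (Z c m) = 1 := by
  rw [← compress_star, ← compress_mul (h.preserves_box hJ hc),
    compress_eq_one (h.star_mul_box hJ hc)]

theorem norm_star_compress_box (hc : c < N) (v : K) : ‖star (compress J (Z c m)) v‖ = ‖v‖ := by
  have h1 := norm_sq_eq_inner (star (compress J (Z c m))) v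
  rw [star_star, h.compress_box_mul_star hJ hc, clm_one_apply, inner_self_eq_norm_sq_to_K] at h1
  have h2 : ‖star (compress J (Z c m)) v‖ ^ 2 = ‖v‖ ^ 2 := by
    apply Complex.ofReal_injective
    push_cast
    exact h1
  exact (sq_eq_sq₀ (norm_nonneg _) (norm_nonneg _)).1 h2

/-- In the column of the box to the left of the white ones all generators of the other rows vanish
on the common kernel, since they are multiplied by `q` when they are conjugated by a unitary. -/
theorem compress_column (hc : c < N) {α : ℕ} (hα : α < m) : compress J (Z c α) = 0 := by
  have e : star (compress J (Z c m)) * compress J (Z c α) =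
      (q : ℂ) • (compress J (Z c α) * star (compress J (Z c m))) := by
    rw [← compress_star, ← compress_mul (h.preserves hJ hc hα),
      ← compress_mul (h.preserves_star_box hJ hc), h.rel.star_last_mul hc hα, map_sub, map_smul,
      map_smul, map_sum, Finset.sum_eq_zero fun i hi => ?_, smul_zero, sub_zero]
    refine compress_eq_zero fun v => ?_
    have hi := Finset.mem_range.1 hi
    rw [clm_mul_apply, h.star_last hJ (by omega) hi.ne, map_zero]
  refine eq_zero_of_norm_le h.lt_one fun v => ?_
  have e1 := ContinuousLinearMap.ext_iff.1 e v
  rw [← h.norm_star_compress_box hJ hc, ← clm_mul_apply, e1, smul_apply,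
    norm_smul, Complex.norm_real, Real.norm_of_nonneg h.pos.le, clm_mul_apply, mul_assoc,
    ← h.norm_star_compress_box hJ hc v]
  exact mul_le_mul_of_nonneg_left ((compress J (Z c α)).le_opNorm _) h.pos.le

theorem column (hc : c < N) {α : ℕ} (hα : α < m) (v : K) : Z c α (J v) = 0 := by
  rw [← (h.preserves hJ hc hα).map_compress, h.compress_column hJ hc hα]
  exact map_zero J

end LastRow
end LastRow

/-! ### Invariant subspaces of the common kernel -/

section LastRow

variable {H : Type*} [NormedAddCommGroup H] [InnerProductSpace ℂ H] [CompleteSpace H]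
variable {K : Type*} [NormedAddCommGroup K] [InnerProductSpace ℂ K] [CompleteSpace K]
variable {q : ℝ} {N m c : ℕ} {Z : ℕ → ℕ → H →L[ℂ] H} {J : K →ₗᵢ[ℂ] H}

theorem mem_topologicalClosure_of_mem {L T : Submodule ℂ H} (hT : IsClosed (T : Set H))
    {S : H →L[ℂ] H} (h : ∀ v ∈ L, S v ∈ T) {v : H} (hv : v ∈ L.topologicalClosure) : S v ∈ T := by
  have : L.topologicalClosure ≤ T.comap S.toLinearMap :=
    Submodule.topologicalClosure_minimal _ h (hT.preimage S.continuous)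
  exact this hv

/-- A function that is dominated by the norm and decreases by the factor `q` along a norm
preserving map vanishes. -/
theorem eq_zero_of_le_mul {q C : ℝ} (hq0 : 0 ≤ q) (hq1 : q < 1) {f : K → ℝ} {g : K → K}
    {W : Set K} (hf : ∀ v ∈ W, 0 ≤ f v) (hC : ∀ v ∈ W, f v ≤ C * ‖v‖) (hg : ∀ v ∈ W, g v ∈ W)
    (hgn : ∀ v ∈ W, ‖g v‖ = ‖v‖) (h : ∀ v ∈ W, f v ≤ q * f (g v)) {v : K} (hv : v ∈ W) :
    f v = 0 := by
  have key : ∀ k : ℕ, ∀ v ∈ W, f v ≤ q ^ k * (C * ‖v‖) := by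
    intro k
    induction k with
    | zero => simpa using hC
    | succ k ih =>
      intro v hv
      have h1 := ih _ (hg v hv)
      rw [hgn v hv] at h1
      calc f v ≤ q * f (g v) := h v hv
        _ ≤ q * (q ^ k * (C * ‖v‖)) := mul_le_mul_of_nonneg_left h1 hq0
        _ = _ := by ring
  have lim : Filter.Tendsto (fun k : ℕ => q ^ k * (C * ‖v‖)) Filter.atTop (nhds (0 * (C * ‖v‖))) :=
    (tendsto_pow_atTop_nhds_zero_of_lt_one hq0 hq1).mul_const _
  rw [zero_mul] at lim
  exact le_antisymm (ge_of_tendsto' lim fun k => key k v hv) (hf v hv)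

namespace LastRow

variable (h : LastRow q N m c Z) (hJ : ∀ v, v ∈ lastVac Z m c ↔ ∃ u, J u = v)

include h

/-- The generator of the box to the left of the white ones is a contraction: the product `x_c^* x_c`
is the defect of the white boxes. -/
theorem norm_box_le (hc : c < N) (v : H) : ‖Z c m v‖ ≤ ‖v‖ := by
  have hn : star (Z c m) * Z c m = defect Z m c := by
    have h1 := h.defect_eq_zero hc
    rw [h.rel.star_mul_last' h.pos.ne' hc, h1, smul_zero, add_zero]
    rw [defect_succ, sub_eq_zero] at h1
    exact h1.symm
  have e' : ‖Z c m v‖ ^ 2 = ‖v‖ ^ 2 - ∑ e ∈ Finset.range c, ‖star (Z e m) v‖ ^ 2 := by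
    apply Complex.ofReal_injective
    push_cast
    have hs : ∀ e, (‖star (Z e m) v‖ : ℂ) ^ 2 = ⟪(Z e m * star (Z e m)) v, v⟫_ℂ := fun e => by
      rw [norm_sq_eq_inner, star_star]
    rw [norm_sq_eq_inner, hn, defect, sub_apply,
      sum_apply, inner_sub_left, sum_inner, clm_one_apply,
      inner_self_eq_norm_sq_to_K]
    simp only [hs]
    rfl
  refine le_of_sq_le_sq ?_ (norm_nonneg _)
  rw [e']
  have : 0 ≤ ∑ e ∈ Finset.range c, ‖star (Z e m) v‖ ^ 2 := by positivity
  linarith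

include hJ

/-- An invariant subspace of the common kernel generates the whole space. -/
theorem dense_of_invariant {W : Submodule ℂ K} (hW0 : W ≠ ⊥)
    (hinv : ∀ d < N, d ≠ c → ∀ α < m, ∀ v ∈ W, compress J (Z d α) v ∈ W ∧
      star (compress J (Z d α)) v ∈ W)
    (hbox : c < N → ∀ v ∈ W, compress J (Z c m) v ∈ W ∧ star (compress J (Z c m)) v ∈ W) :
    (genSpan (fun d => toEnd H (Z d m)) c (W.map J.toLinearMap)).topologicalClosure = ⊤ := by
  have hcN := h.le
  set V : Submodule ℂ H := W.map J.toLinearMap with hV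
  have hVmem : ∀ {v}, v ∈ W → J v ∈ V := fun {v} hv => ⟨v, hv, rfl⟩
  set L := genSpan (fun d => toEnd H (Z d m)) c V with hL
  have hVL : V ≤ L := le_genSpan
  set T := L.topologicalClosure with hT
  have hTc : IsClosed (T : Set H) := L.isClosed_topologicalClosure
  have hLT : L ≤ T := L.le_topologicalClosure
  have rel := h.rel.map (toEnd H)
  have hZL : ∀ d < N, ∀ α < m + 1, ∀ v ∈ L, Z d α v ∈ L := by
    intro d hd α hα v hv
    refine rel.mem_genSpan hcN ?_ hd hα hv
    rintro d hd α hα _ ⟨u, hu, rfl⟩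
    change Z d α (J u) ∈ L
    rcases (Nat.lt_succ_iff_lt_or_eq.1 hα) with hα | rfl
    · by_cases hdc : d = c
      · subst hdc
        rw [h.column hJ hd hα]; exact zero_mem _
      · rw [← (h.preserves hJ hd hα).map_compress]
        exact hVL (hVmem (hinv d hd hdc α hα u hu).1)
    · rcases lt_trichotomy d c with hdc | rfl | hdc
      · exact genSpan_invariant (x := fun d => toEnd H (Z d α)) hdc (hVL (hVmem hu))
      · rw [← (h.preserves_box hJ hd).map_compress]
        exact hVL (hVmem (hbox hd u hu).1)
      · rw [h.eq_zero d hdc hd]; exact zero_mem _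
  have hZT : ∀ d < N, ∀ α < m + 1, ∀ v ∈ T, Z d α v ∈ T := fun d hd α hα v hv =>
    mem_topologicalClosure_of_mem hTc (fun v hv => hLT (hZL d hd α hα v hv)) hv
  have hsL : ∀ d < N, ∀ v ∈ L, star (Z d m) v ∈ L := by
    intro d hd v hv
    refine rel.star_last_mem_genSpan hcN le_rfl ?_ hd hv
    rintro d hd _ ⟨u, hu, rfl⟩
    change star (Z d m) (J u) ∈ L
    by_cases hdc : d = c
    · subst hdc
      rw [← (h.preserves_star_box hJ hd).map_compress, compress_star]
      exact hVL (hVmem (hbox hd u hu).2)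
    · rw [h.star_last hJ hd hdc]; exact zero_mem _
  -- the adjoints of the generators in the column of the box are treated modulo `T`, where they
  -- are multiplied by `q` under conjugation with a contraction
  have hcol : c < N → ∀ α < m, ∀ v ∈ W, star (Z c α) (J v) ∈ T := by
    intro hc α hα v hv
    have : CompleteSpace T := hTc.completeSpace_coe
    let P : H →L[ℂ] H := Tᗮ.starProjection
    have hP : ∀ w, P w = 0 ↔ w ∈ T := fun w => by
      rw [Submodule.starProjection_apply_eq_zero_iff, Submodule.orthogonal_orthogonal]
    have hPle : ∀ w, ‖P w‖ ≤ ‖w‖ := fun w => Tᗮ.norm_starProjection_apply_le w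
    have hPT : ∀ w, w - P w ∈ T := fun w => by
      rw [← hP, map_sub, sub_eq_zero]
      exact (Submodule.starProjection_eq_self_iff.2
        (Submodule.starProjection_apply_mem Tᗮ w)).symm
    rw [← hP, ← norm_eq_zero]
    refine eq_zero_of_le_mul h.pos.le h.lt_one (f := fun v => ‖P (star (Z c α) (J v))‖)
      (g := fun v => star (compress J (Z c m)) v) (W := W) (C := ‖star (Z c α)‖)
      (fun _ _ => norm_nonneg _) (fun v _ => ?_) (fun v hv => (hbox hc v hv).2)
      (fun v _ => h.norm_star_compress_box hJ hc v) (fun v hv => ?_) hv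
    · refine (hPle _).trans (((star (Z c α)).le_opNorm _).trans ?_)
      rw [J.norm_map]
    · set w := star (compress J (Z c m)) v with hw
      have hwW : w ∈ W := (hbox hc v hv).2
      have e1 : J v = Z c m (J w) := by
        rw [hw, ← compress_star, (h.preserves_star_box hJ hc).map_compress, ← clm_mul_apply,
          h.box_mul_star hJ hc]
      have e2 : star (Z c α) (Z c m (J w)) = (q : ℂ) • Z c m (star (Z c α) (J w)) -
          ((q : ℂ)⁻¹ - q) • ∑ e ∈ Finset.range c, Z e m (star (Z e α) (J w)) := by
        rw [← clm_mul_apply, h.rel.star_mul_lastRow hc hα, sub_apply,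
          smul_apply, smul_apply,
          sum_apply]
        rfl
      have e3 : P (∑ e ∈ Finset.range c, Z e m (star (Z e α) (J w))) = 0 := by
        rw [hP]
        refine Submodule.sum_mem _ fun e he => ?_
        have he := Finset.mem_range.1 he
        refine hZT e (by omega) m (by omega) _ (hLT (hVL ?_))
        rw [← (h.preserves_star hJ (by omega) he.ne hα).map_compress, compress_star]
        exact hVmem (hinv e (by omega) he.ne α hα w hwW).2
      have e4 : P (Z c m (star (Z c α) (J w))) = P (Z c m (P (star (Z c α) (J w)))) := by
        rw [← sub_eq_zero, ← map_sub, ← map_sub, hP]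
        exact hZT c hc m (by omega) _ (hPT _)
      change ‖P (star (Z c α) (J v))‖ ≤ q * ‖P (star (Z c α) (J w))‖
      rw [e1, e2, map_sub, map_smul, map_smul, e3, smul_zero, sub_zero, norm_smul,
        Complex.norm_real, Real.norm_of_nonneg h.pos.le, e4]
      exact mul_le_mul_of_nonneg_left ((hPle _).trans (h.norm_box_le hc _)) h.pos.le
  have hsT : ∀ d < N, ∀ α < m + 1, ∀ v ∈ T, star (Z d α) v ∈ T := by
    intro d hd α hα v hv
    refine mem_topologicalClosure_of_mem hTc (fun v hv => ?_) hv
    rcases (Nat.lt_succ_iff_lt_or_eq.1 hα) with hα | rfl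
    · refine rel.star_mem_of_genSpan hcN (fun d hd v hv => hZT d (by omega) m (by omega) v hv)
        hα ?_ hd hv
      rintro d hd _ ⟨u, hu, rfl⟩
      change star (Z d α) (J u) ∈ T
      by_cases hdc : d = c
      · subst hdc
        exact hcol hd α hα u hu
      · rw [← (h.preserves_star hJ hd hdc hα).map_compress, compress_star]
        exact hLT (hVL (hVmem (hinv d hd hdc α hα u hu).2))
    · exact hLT (hsL d hd v hv)
  refine (h.irr.2 T hTc fun d hd α hα v hv =>
    ⟨hZT d hd α hα v hv, hsT d hd α hα v hv⟩).resolve_left fun hbot => hW0 ?_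
  rw [eq_bot_iff]
  intro v hv
  have : J v ∈ T := hLT (hVL (hVmem hv))
  rw [hbot, Submodule.mem_bot] at this
  exact (map_eq_zero_iff J J.injective).1 this

/-- The common kernel has no subspaces that are invariant under the generators which preserve it. -/
theorem eq_top_of_invariant {W : Submodule ℂ K} (hW : IsClosed (W : Set K)) (hW0 : W ≠ ⊥)
    (hinv : ∀ d < N, d ≠ c → ∀ α < m, ∀ v ∈ W, compress J (Z d α) v ∈ W ∧
      star (compress J (Z d α)) v ∈ W)
    (hbox : c < N → ∀ v ∈ W, compress J (Z c m) v ∈ W ∧ star (compress J (Z c m)) v ∈ W) :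
    W = ⊤ := by
  have hTtop := h.dense_of_invariant hJ hW0 hinv hbox
  have : CompleteSpace W := hW.completeSpace_coe
  rw [← Submodule.orthogonal_eq_bot_iff, eq_bot_iff]
  intro v hv
  have hLv : (⊤ : Submodule ℂ H) ≤ (ℂ ∙ J v)ᗮ := by
    rw [← hTtop]
    refine Submodule.topologicalClosure_minimal _ (genSpan_le ?_ ?_)
      (Submodule.isClosed_orthogonal _)
    · rintro _ ⟨w, hw, rfl⟩
      rw [Submodule.mem_orthogonal_singleton_iff_inner_left]
      exact (J.inner_map_map w v).trans ((Submodule.mem_orthogonal _ _).1 hv w hw)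
    · intro d hd w _
      rw [Submodule.mem_orthogonal_singleton_iff_inner_right, toEnd_apply, ← inner_star_left,
        (hJ _).2 ⟨v, rfl⟩ d hd, inner_zero_left]
  have := hLv (Submodule.mem_top (x := J v))
  rw [Submodule.mem_orthogonal_singleton_iff_inner_right, inner_self_eq_zero] at this
  exact (map_eq_zero_iff J J.injective).1 this

/-- By Schur's lemma the generator of the box to the left of the white boxes is a scalar on the
common kernel. -/
theorem exists_scalar (hc : c < N) [Nontrivial K] :
    ∃ l : ℂ, ‖l‖ = 1 ∧ compress J (Z c m) = l • 1 := by
  have hun := h.star_mul_compress_box hJ hc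
  have hn : IsStarNormal (compress J (Z c m)) :=
    ⟨(h.star_mul_compress_box hJ hc).trans (h.compress_box_mul_star hJ hc).symm⟩
  have hcomm : ∀ d < N, d ≠ c → ∀ α < m, Commute (compress J (Z c m)) (compress J (Z d α)) ∧
      Commute (star (compress J (Z c m))) (compress J (Z d α)) := by
    intro d hd hdc α hα
    constructor
    · rw [commute_iff_eq, ← compress_mul (h.preserves hJ hd hα),
        ← compress_mul (h.preserves_box hJ hc)]
      rcases Nat.lt_or_gt_of_ne hdc with hdc | hdc
      · rw [h.rel.comm d c hdc hc α m hα (by omega)]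
      · rw [h.rel.cross c d hdc hd α m hα (by omega), h.eq_zero d hdc hd]; simp
    · rw [commute_iff_eq, ← compress_star, ← compress_mul (h.preserves hJ hd hα),
        ← compress_mul (h.preserves_star_box hJ hc),
        h.rel.star_last_mul_of_ne hd hc hdc hα]
  obtain ⟨l, hl⟩ := schur hn fun M hM hg => by
    rw [or_iff_not_imp_left]
    intro hM0
    refine h.eq_top_of_invariant hJ hM hM0 (fun d hd hdc α hα v hv => ⟨?_, ?_⟩)
      fun _ v hv => ⟨?_, ?_⟩
    · exact hg _ (hcomm d hd hdc α hα).1 (hcomm d hd hdc α hα).2 v hv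
    · refine hg _ ?_ ?_ v hv
      · have := (hcomm d hd hdc α hα).2.star_star
        rwa [star_star] at this
      · exact (hcomm d hd hdc α hα).1.star_star
    · exact hg _ (Commute.refl _) hn.star_comm_self v hv
    · exact hg _ hn.star_comm_self.symm (Commute.refl _) v hv
  refine ⟨l, ?_, hl⟩
  rw [hl, star_smul, smul_mul_smul_comm, star_one, one_mul] at hun
  obtain ⟨v, hv⟩ := exists_ne (0 : K)
  have h1 := ContinuousLinearMap.ext_iff.1 hun v
  have h2 : star l * l = 1 := by
    refine smul_left_injective ℂ hv ?_
    simpa using h1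
  have h3 := congrArg norm h2
  rw [norm_mul, norm_star, norm_one] at h3
  nlinarith [norm_nonneg l]

end LastRow
end LastRow

/-! ### Relations on the common kernel -/

section RowMix

variable {A : Type*} [Ring A] [Algebra ℂ A]

theorem rowMix_sum {ι : Type*} (Q : ℂ) (m α β : ℕ) (s : Finset ι) (f : ι → ℕ → ℕ → A) :
    rowMix Q m α β (fun i j => ∑ e ∈ s, f e i j) = ∑ e ∈ s, rowMix Q m α β (f e) := by
  unfold rowMix
  split_ifs
  · rw [Finset.sum_sub_distrib, ← Finset.smul_sum, ← Finset.smul_sum, Finset.sum_comm]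
  · rfl

/-- The map `rowMix` is injective, as it is triangular on the diagonal entries. -/
theorem eq_zero_of_rowMix {Q : ℂ} (hQ : Q ≠ 0) {m : ℕ} {f : ℕ → ℕ → A}
    (h : ∀ α < m, ∀ β < m, rowMix Q m α β f = 0) : ∀ α < m, ∀ β < m, f α β = 0 := by
  have diag : ∀ k, ∀ α, α < m → m ≤ α + k → f α α = 0 := by
    intro k
    induction k with
    | zero => intro α h1 h2; omega
    | succ k ih =>
      intro α h1 h2
      have h3 := h α h1 α h1
      rw [rowMix_self, Finset.sum_eq_zero fun γ hγ => (by
        obtain ⟨h4, h5⟩ := Finset.mem_Ioo.1 hγ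
        exact ih γ h5 (by omega)), smul_zero, sub_zero] at h3
      exact (smul_eq_zero.1 h3).resolve_left hQ
  intro α hα β hβ
  by_cases hαβ : α = β
  · subst hαβ
    exact diag m α hα (by omega)
  · have := h α hα β hβ
    rwa [rowMix_of_ne hαβ] at this

end RowMix

section LastRow

variable {H : Type*} [NormedAddCommGroup H] [InnerProductSpace ℂ H] [CompleteSpace H]
variable {K : Type*} [NormedAddCommGroup K] [InnerProductSpace ℂ K] [CompleteSpace K]
variable {q : ℝ} {N m c : ℕ} {Z : ℕ → ℕ → H →L[ℂ] H} {J : K →ₗᵢ[ℂ] H}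

namespace LastRow

variable (h : LastRow q N m c Z) (hJ : ∀ v, v ∈ lastVac Z m c ↔ ∃ u, J u = v)

include h hJ

/-- The summands that belong to the last row do not contribute to the mixed relation on the common
kernel. -/
theorem compress_rowMix {e d α β : ℕ} (hd : d < N) (he : e < N) (hec : e ≠ c) (hα : α < m)
    (hβ : β < m) :
    compress J (rowMix q (m + 1) α β fun i j => Z d i * star (Z e j)) =
      rowMix q m α β fun i j => compress J (Z d i) * star (compress J (Z e j)) := by
  have h0 : compress J (Z d m * star (Z e m)) = 0 :=
    compress_eq_zero fun v => by rw [clm_mul_apply, h.star_last hJ he hec, map_zero]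
  have h1 : compress J (if α = β then ((q : ℂ)⁻¹ - q) • (Z d m * star (Z e m)) else 0) = 0 := by
    split_ifs
    · rw [map_smul, h0, smul_zero]
    · exact map_zero _
  rw [rowMix_succ hα, map_sub, h1, sub_zero, rowMix_map]
  refine rowMix_congr hα hβ fun i hi j hj => ?_
  rw [compress_mul (h.preserves_star hJ he hec hj), compress_star]

theorem star_compress_mul_of_ne {d e α β : ℕ} (hd : d < N) (he : e < N) (hec : e ≠ c)
    (hde : d ≠ e) (hα : α < m) (hβ : β < m) :
    star (compress J (Z e β)) * compress J (Z d α) =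
      rowMix q m α β fun i j => compress J (Z d i) * star (compress J (Z e j)) := by
  rw [← compress_star, ← compress_mul (h.preserves hJ hd hα),
    h.rel.mixed_ne d hd e he hde α (by omega) β (by omega), h.compress_rowMix hJ hd he hec hα hβ]

theorem star_compress_mul {d α β : ℕ} (hd : d < N) (hα : α < m) (hβ : β < m) :
    star (compress J (Z d β)) * compress J (Z d α) =
      (q : ℂ) • compress J (rowMix q (m + 1) α β fun i j => Z d i * star (Z d j))
      - ((q : ℂ)⁻¹ - q) • ∑ e ∈ Finset.range d,
        compress J (rowMix q (m + 1) α β fun i j => Z e i * star (Z e j))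
      + (if α = β then 1 - (q : ℂ) ^ 2 else 0) • (1 : K →L[ℂ] K) := by
  rw [← compress_star, ← compress_mul (h.preserves hJ hd hα),
    h.rel.mixed_eq d hd α (by omega) β (by omega), map_add, map_sub, map_smul, map_smul,
    map_smul, map_sum, compress_one]

/-- In the column of the box the summand that belongs to the last row is the identity. -/
theorem compress_rowMix_box (hc : c < N) {α β : ℕ} (hα : α < m) (hβ : β < m) :
    compress J (rowMix q (m + 1) α β fun i j => Z c i * star (Z c j)) =
      (rowMix q m α β fun i j => compress J (Z c i * star (Z c j))) -
        if α = β then ((q : ℂ)⁻¹ - q) • 1 else 0 := by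
  have h0 : compress J (Z c m * star (Z c m)) = 1 := compress_eq_one (h.box_mul_star hJ hc)
  rw [rowMix_succ hα, map_sub, rowMix_map]
  congr 1
  split_ifs
  · rw [map_smul, h0]
  · exact map_zero _

/-- The adjoints of the generators in the column of the box do not preserve the common kernel, but
the products that occur in the relations do not lead to new operators. -/
theorem compress_column_mul_star (hc : c < N) {α β : ℕ} (hα : α < m) (hβ : β < m) :
    compress J (Z c α * star (Z c β)) = ((q : ℂ)⁻¹ ^ 2 - 1) • ∑ e ∈ Finset.range c,
      compress J (Z e α) * star (compress J (Z e β)) := by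
  have hQ : (q : ℂ) ≠ 0 := by exact_mod_cast h.pos.ne'
  -- The left side of the mixed relation vanishes in the column `c`, and the contribution of the
  -- last row cancels against the constant term.
  have key := eq_zero_of_rowMix (Q := q) hQ (m := m)
    (f := fun i j => (q : ℂ) • compress J (Z c i * star (Z c j)) + (-((q : ℂ)⁻¹ - q)) •
      ∑ e ∈ Finset.range c, compress J (Z e i) * star (compress J (Z e j))) ?_ α hα β hβ
  · have h1 := congrArg (fun x => (q : ℂ)⁻¹ • x) key
    simp only [smul_add, smul_smul, inv_mul_cancel₀ hQ, one_smul, smul_zero] at h1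
    rw [eq_neg_of_add_eq_zero_left h1, ← neg_smul]
    congr 1
    field_simp
  · intro α hα β hβ
    have h1 := h.star_compress_mul hJ hc hα hβ
    rw [h.compress_column hJ hc hα, mul_zero, h.compress_rowMix_box hJ hc hα hβ,
      Finset.sum_congr rfl fun e he => h.compress_rowMix hJ
        ((Finset.mem_range.1 he).trans hc) ((Finset.mem_range.1 he).trans hc)
        (Finset.mem_range.1 he).ne hα hβ] at h1
    rw [rowMix_add, rowMix_smul, rowMix_smul, rowMix_sum, h1]
    split_ifs
    · match_scalars
      all_goals field_simp
      all_goals ring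
    · module

theorem star_compress_mul_low {d α β : ℕ} (hd : d < N) (hdc : d < c) (hα : α < m) (hβ : β < m) :
    star (compress J (Z d β)) * compress J (Z d α) =
      (q : ℂ) • (rowMix q m α β fun i j => compress J (Z d i) * star (compress J (Z d j)))
      - ((q : ℂ)⁻¹ - q) • ∑ e ∈ Finset.range d,
        (rowMix q m α β fun i j => compress J (Z e i) * star (compress J (Z e j)))
      + (if α = β then 1 - (q : ℂ) ^ 2 else 0) • (1 : K →L[ℂ] K) := by
  rw [h.star_compress_mul hJ hd hα hβ, h.compress_rowMix hJ hd hd (by omega) hα hβ,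
    Finset.sum_congr rfl fun e he => h.compress_rowMix hJ
        ((Finset.mem_range.1 he).trans hd) ((Finset.mem_range.1 he).trans hd)
        ((Finset.mem_range.1 he).trans hdc).ne hα hβ]

/-- The mixed relation to the left of the removed column. The sum over the columns on the right
contains the removed one, which by `compress_column_mul_star` contributes a multiple of the columns
of the white boxes. -/
theorem star_compress_mul_high {d α β : ℕ} (hd : d + 1 < N) (hdc : c ≤ d) (hα : α < m)
    (hβ : β < m) :
    star (compress J (Z (d + 1) β)) * compress J (Z (d + 1) α) =
      (q : ℂ) • (rowMix q m α β fun i j =>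
        compress J (Z (d + 1) i) * star (compress J (Z (d + 1) j)))
      - ((q : ℂ)⁻¹ - q) • ((q : ℂ)⁻¹ ^ 2 • (∑ e ∈ Finset.range c,
        (rowMix q m α β fun i j => compress J (Z e i) * star (compress J (Z e j))))
        + ∑ e ∈ Finset.Ico c d, (rowMix q m α β fun i j =>
          compress J (Z (e + 1) i) * star (compress J (Z (e + 1) j))))
      + (if α = β then (q : ℂ)⁻¹ ^ 2 * (1 - (q : ℂ) ^ 2) else 0) • (1 : K →L[ℂ] K) := by
  have hQ : (q : ℂ) ≠ 0 := by exact_mod_cast h.pos.ne'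
  have hr : ∀ e < N, e ≠ c → compress J (rowMix q (m + 1) α β fun i j => Z e i * star (Z e j)) =
      rowMix q m α β fun i j => compress J (Z e i) * star (compress J (Z e j)) :=
    fun e he hec => h.compress_rowMix hJ he he hec hα hβ
  rw [h.star_compress_mul hJ hd hα hβ, hr _ hd (by omega), Finset.range_eq_Ico,
    ← Finset.sum_Ico_consecutive _ (Nat.zero_le c) (show c ≤ d + 1 by omega),
    Finset.sum_eq_sum_Ico_succ_bot (show c < d + 1 by omega), ← Finset.sum_Ico_add',
    h.compress_rowMix_box hJ (by omega) hα hβ,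
    rowMix_congr hα hβ fun i hi j hj => h.compress_column_mul_star hJ (by omega) hi hj,
    rowMix_smul, rowMix_sum, ← Finset.range_eq_Ico,
    Finset.sum_congr rfl fun e he => hr e (by have := Finset.mem_range.1 he; omega)
      (Finset.mem_range.1 he).ne,
    Finset.sum_congr rfl fun e he => hr (e + 1) (by have := Finset.mem_Ico.1 he; omega)
      (by have := Finset.mem_Ico.1 he; omega)]
  split_ifs
  · match_scalars
    all_goals field_simp
    all_goals ring
  · module

end LastRow
end LastRow

/-! ### The remaining quantum matrix -/

universe u

section NextFam

variable {H : Type*} [NormedAddCommGroup H] [InnerProductSpace ℂ H] [CompleteSpace H]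
variable {K : Type*} [NormedAddCommGroup K] [InnerProductSpace ℂ K] [CompleteSpace K]

/-- Renumbering of the columns after the column `c` is removed. -/
def skipCol (c d : ℕ) : ℕ := if d < c then d else d + 1

/-- The normalization of the generators after the column `c` is removed. -/
def nextCoef (Q l : ℂ) (c d : ℕ) : ℂ := if d < c then 1 else -Q * if d = c then l else 1

/-- The quantum matrix that remains after the last row and the column of its rightmost gray box are
removed. -/
def nextFam (Q l : ℂ) (c : ℕ) (Z : ℕ → ℕ → H →L[ℂ] H) (J : K →ₗᵢ[ℂ] H) (d α : ℕ) : K →L[ℂ] K :=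
  nextCoef Q l c d • compress J (Z (skipCol c d) α)

theorem skipCol_ne (c d : ℕ) : skipCol c d ≠ c := by
  unfold skipCol; split_ifs <;> omega

theorem skipCol_lt {N c d : ℕ} (hc : c ≤ N) (hd : d < nextCols N c) : skipCol c d < N := by
  unfold skipCol; unfold nextCols at hd; split_ifs at * <;> omega

theorem skipCol_strictMono (c : ℕ) : StrictMono (skipCol c) := by
  intro d e h; unfold skipCol; split_ifs <;> omega

theorem nextCoef_ne_zero {Q l : ℂ} (hQ : Q ≠ 0) (hl : l ≠ 0) (c d : ℕ) : nextCoef Q l c d ≠ 0 := by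
  unfold nextCoef; split_ifs <;> simp [hQ, hl]

theorem nextCoef_mul_star {q : ℝ} {l : ℂ} (hl : ‖l‖ = 1) (c d : ℕ) :
    nextCoef q l c d * star (nextCoef q l c d) = if d < c then 1 else (q : ℂ) ^ 2 := by
  have h1 : l * conj l = 1 := by rw [Complex.mul_conj, Complex.normSq_eq_norm_sq, hl]; simp
  unfold nextCoef
  split_ifs
  · simp
  · simp only [star_mul', star_neg, Complex.star_def, Complex.conj_ofReal]
    linear_combination (q : ℂ) ^ 2 * h1
  · simp [sq]

variable {q : ℝ} {N m c : ℕ} {Z : ℕ → ℕ → H →L[ℂ] H} {J : K →ₗᵢ[ℂ] H} {l : ℂ}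

theorem star_nextFam (d α : ℕ) : star (nextFam q l c Z J d α) =
    star (nextCoef q l c d) • star (compress J (Z (skipCol c d) α)) := star_smul _ _

theorem rowMix_nextFam (d e α β : ℕ) :
    (rowMix q m α β fun i j => nextFam q l c Z J d i * star (nextFam q l c Z J e j)) =
      (nextCoef q l c d * star (nextCoef q l c e)) • rowMix q m α β fun i j =>
        compress J (Z (skipCol c d) i) * star (compress J (Z (skipCol c e) j)) := by
  rw [← rowMix_smul]
  congr 1
  funext i j
  rw [star_nextFam, nextFam, smul_mul_smul_comm]

namespace LastRow

variable (h : LastRow q N m c Z) (hJ : ∀ v, v ∈ lastVac Z m c ↔ ∃ u, J u = v)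

include h hJ

/-- The relations of the remaining quantum matrix. -/
theorem nextFam_rel (hl : ‖l‖ = 1) : IsQMat q (nextCols N c) m (nextFam q l c Z J) := by
  have hQ : (q : ℂ) ≠ 0 := by exact_mod_cast h.pos.ne'
  have hc := h.le
  have hmul : ∀ {d e α β}, d < nextCols N c → e < nextCols N c → β < m →
      nextFam q l c Z J d α * nextFam q l c Z J e β =
        (nextCoef q l c d * nextCoef q l c e) •
          compress J (Z (skipCol c d) α * Z (skipCol c e) β) := by
    intro d e α β hd he hβ
    rw [nextFam, nextFam, smul_mul_smul_comm,
      ← compress_mul (h.preserves hJ (skipCol_lt hc he) hβ)]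
  constructor
  · intro d hd α β hαβ hβ
    rw [hmul hd hd hβ, hmul hd hd (by omega),
      h.rel.row _ (skipCol_lt hc hd) α β hαβ (by omega), map_smul, smul_comm]
  · intro α hα e d hed hd
    rw [hmul hd (by omega) hα, hmul (by omega) hd hα, h.rel.col α (by omega) _ _
      (skipCol_strictMono c hed) (skipCol_lt hc hd), map_smul, smul_comm,
      mul_comm (nextCoef _ _ _ _)]
  · intro d e hde he α β hαβ hβ
    rw [hmul (by omega) he hβ, hmul he (by omega) (by omega), h.rel.comm _ _
      (skipCol_strictMono c hde) (skipCol_lt hc he) α β hαβ (by omega), mul_comm (nextCoef _ _ _ _)]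
  · intro e d hed hd α β hαβ hβ
    rw [hmul hd (by omega) hβ, hmul (by omega) hd (by omega), hmul hd (by omega) (by omega),
      h.rel.cross _ _ (skipCol_strictMono c hed) (skipCol_lt hc hd) α β hαβ (by omega), map_add,
      map_smul, smul_add, smul_comm _ ((q : ℂ) - _), mul_comm (nextCoef _ _ _ e)]
  · intro d hd e he hde α hα β hβ
    rw [rowMix_nextFam, ← h.star_compress_mul_of_ne hJ (skipCol_lt hc hd) (skipCol_lt hc he)
      (skipCol_ne c e) ((skipCol_strictMono c).injective.ne hde) hα hβ, star_nextFam, nextFam,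
      smul_mul_smul_comm, mul_comm (star _)]
  · intro d hd α hα β hβ
    simp only [rowMix_nextFam, nextCoef_mul_star hl]
    rw [star_nextFam, nextFam, smul_mul_smul_comm, mul_comm (star _), nextCoef_mul_star hl]
    have hlow : ∀ {e}, e < c → skipCol c e = e := fun {e} he => if_pos he
    have hhigh : ∀ {e}, c ≤ e → skipCol c e = e + 1 := fun {e} he => if_neg (by omega)
    have hd' := skipCol_lt hc hd
    rcases lt_or_ge d c with hdc | hdc
    · rw [hlow hdc] at hd' ⊢
      rw [h.star_compress_mul_low hJ hd' hdc hα hβ, if_pos hdc, one_smul, one_smul]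
      congr 3
      refine Finset.sum_congr rfl fun e he => ?_
      have he := Finset.mem_range.1 he
      rw [if_pos (he.trans hdc), one_smul, hlow (he.trans hdc)]
    -- The factor `q^{-2}` of the white columns and of the constant term is the reason for the
    -- normalization of the other columns by a number of modulus `q`.
    · rw [hhigh hdc] at hd' ⊢
      rw [h.star_compress_mul_high hJ hd' hdc hα hβ, if_neg (by omega), Finset.range_eq_Ico,
        Finset.range_eq_Ico, ← Finset.sum_Ico_consecutive _ (Nat.zero_le c) hdc]
      have s1 := Finset.sum_congr (s₁ := Finset.Ico 0 c) rfl fun e he => by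
        have he := (Finset.mem_Ico.1 he).2
        exact show ((if e < c then 1 else (q : ℂ) ^ 2) • rowMix q m α β fun i j =>
          compress J (Z (skipCol c e) i) * star (compress J (Z (skipCol c e) j))) = rowMix q m α β
            fun i j => compress J (Z e i) * star (compress J (Z e j)) by
          rw [if_pos he, one_smul, hlow he]
      have s2 := Finset.sum_congr (s₁ := Finset.Ico c d) rfl fun e he => by
        have he := (Finset.mem_Ico.1 he).1
        exact show ((if e < c then 1 else (q : ℂ) ^ 2) • rowMix q m α β fun i j =>
          compress J (Z (skipCol c e) i) * star (compress J (Z (skipCol c e) j))) =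
            (q : ℂ) ^ 2 • rowMix q m α β fun i j =>
              compress J (Z (e + 1) i) * star (compress J (Z (e + 1) j)) by
          rw [if_neg (by omega), hhigh he]
      rw [s1, s2]
      rw [← Finset.smul_sum]
      split_ifs
      · match_scalars
        all_goals field_simp
      · match_scalars
        all_goals field_simp
        simp

/-- Irreducibility of the remaining quantum matrix. -/
theorem nextFam_irr [Nontrivial K] (hl : l ≠ 0) (hbox : c < N → compress J (Z c m) = l • 1) :
    IrrFam (nextCols N c) m (nextFam q l c Z J) := by
  have hQ : (q : ℂ) ≠ 0 := by exact_mod_cast h.pos.ne'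
  refine ⟨inferInstance, fun W hW hinv => ?_⟩
  rw [or_iff_not_imp_left]
  intro hW0
  refine h.eq_top_of_invariant hJ hW hW0 (fun D hD hDc α hα v hv => ?_) fun hc v hv => ?_
  · obtain ⟨d, hd, rfl⟩ : ∃ d < nextCols N c, skipCol c d = D := by
      rcases Nat.lt_or_gt_of_ne hDc with hDc | hDc
      · refine ⟨D, ?_, if_pos hDc⟩
        have := h.le
        unfold nextCols; split_ifs <;> omega
      · refine ⟨D - 1, ?_, ?_⟩
        · unfold nextCols; split_ifs <;> omega
        · unfold skipCol; split_ifs <;> omega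
    have hs := nextCoef_ne_zero hQ hl c d
    obtain ⟨h1, h2⟩ := hinv d hd α hα v hv
    rw [star_nextFam] at h2
    exact ⟨(W.smul_mem_iff hs).1 h1, (W.smul_mem_iff (star_ne_zero.2 hs)).1 h2⟩
  · rw [hbox hc, star_smul, star_one]
    exact ⟨W.smul_mem l hv, W.smul_mem _ hv⟩

/-- The given representation arises from the remaining quantum matrix by adding a row. -/
theorem rowExt [Nontrivial K] (hl : ‖l‖ = 1) (hbox : c < N → compress J (Z c m) = l • 1) :
    RowExt q N m c l Z (nextFam q l c Z J) J := by
  have hQ : (q : ℂ) ≠ 0 := by exact_mod_cast h.pos.ne'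
  have hc := h.le
  refine ⟨h.rel, hc, fun d hd v => (hJ _).2 ⟨v, rfl⟩ d hd, fun hc v => ?_, fun d hd hd' v => ?_,
    fun d hd α hα v => ?_, fun hc α hα v => h.column hJ hc hα v, fun d hd hd' α hα v => ?_, ?_⟩
  · rw [← (h.preserves_box hJ hc).map_compress, hbox hc, ← map_smul]; rfl
  · rw [h.eq_zero d hd hd']; rfl
  · rw [nextFam, nextCoef, if_pos hd, one_smul, skipCol, if_pos hd,
      (h.preserves hJ (hd.trans_le hc) hα).map_compress]
  · have h1 : l * conj l = 1 := by rw [Complex.mul_conj, Complex.normSq_eq_norm_sq, hl]; simp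
    have e1 : nextCoef q l c d = -(q : ℂ) * if d = c then l else 1 := if_neg (by omega)
    have e2 : skipCol c d = d + 1 := if_neg (by omega)
    rw [nextFam, e1, e2]
    change _ = _ • J ((-(q : ℂ) * if d = c then l else 1) • (compress J (Z (d + 1) α)) v)
    rw [map_smul, (h.preserves hJ hd' hα).map_compress, smul_smul]
    have : (-(q : ℂ)⁻¹ * if d = c then conj l else 1) * (-(q : ℂ) * if d = c then l else 1) = 1 := by
      split_ifs
      · field_simp
        linear_combination h1
      · field_simp
    rw [this, one_smul]
  · have := h.dense_of_invariant hJ (W := ⊤) top_ne_bot (fun _ _ _ _ _ _ _ => ⟨trivial, trivial⟩)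
      fun _ _ _ => ⟨trivial, trivial⟩
    rwa [Submodule.map_top] at this

end LastRow

/-- An irreducible representation with at least one row arises from an irreducible representation
with one row less. -/
theorem IrrFam.exists_rowExt {H : Type u} [NormedAddCommGroup H]
    [InnerProductSpace ℂ H] [CompleteSpace H] {Z : ℕ → ℕ → H →L[ℂ] H} (hq0 : 0 < q) (hq1 : q < 1)
    (hirr : IrrFam N (m + 1) Z) (hZ : IsQMat q N (m + 1) Z) :
    ∃ c l, ‖l‖ = 1 ∧ (c = N → l = 1) ∧ ∃ (K : Type u) (_ : NormedAddCommGroup K)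
      (_ : InnerProductSpace ℂ K) (_ : CompleteSpace K) (Z' : ℕ → ℕ → K →L[ℂ] K) (J : K →ₗᵢ[ℂ] H),
      RowExt q N m c l Z Z' J ∧ IsQMat q (nextCols N c) m Z' ∧ IrrFam (nextCols N c) m Z' := by
  obtain ⟨c, h⟩ := hirr.exists_lastRow hq0 hq1 hZ
  have hJ : ∀ v, v ∈ lastVac Z m c ↔ ∃ u, (lastVac Z m c).subtypeₗᵢ u = v := fun v =>
    ⟨fun hv => ⟨⟨v, hv⟩, rfl⟩, fun ⟨u, hu⟩ => hu ▸ u.2⟩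
  have : Nontrivial (lastVac Z m c) := Submodule.nontrivial_iff_ne_bot.2 h.lastVac_ne_bot
  rcases h.le.lt_or_eq with hc | hc
  · obtain ⟨l, hl, hbox⟩ := h.exists_scalar hJ hc
    exact ⟨c, l, hl, fun hc' => absurd hc' hc.ne, lastVac Z m c, _, _, inferInstance, _, _,
      h.rowExt hJ hl fun _ => hbox, h.nextFam_rel hJ hl,
      h.nextFam_irr hJ (norm_ne_zero_iff.1 (by rw [hl]; exact one_ne_zero)) fun _ => hbox⟩
  · have hbox : c < N → compress (lastVac Z m c).subtypeₗᵢ (Z c m) = (1 : ℂ) • 1 := fun h' =>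
      absurd hc h'.ne
    exact ⟨c, 1, norm_one, fun _ => rfl, lastVac Z m c, _, _, inferInstance, _, _,
      h.rowExt hJ norm_one hbox, h.nextFam_rel hJ norm_one, h.nextFam_irr hJ one_ne_zero hbox⟩

end NextFam

/-! ### Iterated addition of rows -/

universe v w

/-- The family `Z` with `N` columns and `m` rows arises from a one-dimensional space by adding rows
`j = 0, …, m - 1` with `k j` white boxes and with the scalars `l j`. -/
def Iter (Q : ℂ) (k : ℕ → ℕ) (l : ℕ → ℂ) : (m N : ℕ) → (H : Type v) → [NormedAddCommGroup H] →
    [InnerProductSpace ℂ H] → [CompleteSpace H] → (ℕ → ℕ → H →L[ℂ] H) → Prop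
  | 0, _, H, _, _, _, _ => Module.finrank ℂ H = 1
  | m + 1, N, H, _, _, _, Z => ∃ (H' : Type v) (_ : NormedAddCommGroup H')
      (_ : InnerProductSpace ℂ H') (_ : CompleteSpace H') (Z' : ℕ → ℕ → H' →L[ℂ] H')
      (J : H' →ₗᵢ[ℂ] H), RowExt Q N m (k m) (l m) Z Z' J ∧ Iter Q k l m (nextCols N (k m)) H' Z'

/-- Admissibility of the data for iterated addition of rows, the first of which leads to `m` rows
and `N` columns. -/
def Adm (k : ℕ → ℕ) (φ : ℕ → ℝ) : (m N : ℕ) → Prop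
  | 0, _ => True
  | m + 1, N => k m ≤ N ∧ φ m ∈ Set.Ico 0 (2 * Real.pi) ∧ (k m = N → φ m = 0) ∧
      Adm k φ m (nextCols N (k m))

/-- The phase `e^{iφ}`. -/
def phase (φ : ℝ) : ℂ := Complex.exp (Complex.I * φ)

theorem norm_phase (φ : ℝ) : ‖phase φ‖ = 1 := by
  rw [phase, mul_comm, Complex.norm_exp_ofReal_mul_I]

theorem phase_ne_zero (φ : ℝ) : phase φ ≠ 0 := Complex.exp_ne_zero _

theorem phase_zero : phase 0 = 1 := by simp [phase]

theorem phase_injOn : Set.InjOn phase (Set.Ico 0 (2 * Real.pi)) := by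
  intro x hx y hy h
  rw [phase, phase, mul_comm, mul_comm Complex.I, ← Circle.coe_exp, ← Circle.coe_exp,
    Circle.coe_inj] at h
  obtain ⟨m, hm⟩ := Circle.exp_eq_exp.1 h
  have hpi := Real.pi_pos
  have h1 : (m : ℝ) < 1 := by
    by_contra hc
    push Not at hc
    nlinarith [hx.1, hx.2, hy.1, hy.2]
  have h2 : (-1 : ℝ) < m := by
    by_contra hc
    push Not at hc
    nlinarith [hx.1, hx.2, hy.1, hy.2]
  have h3 : m = 0 := by
    have h1' : m < 1 := by exact_mod_cast h1
    have h2' : -1 < m := by exact_mod_cast h2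
    omega
  rw [hm, h3]; simp

theorem exists_phase {l : ℂ} (hl : ‖l‖ = 1) : ∃ φ ∈ Set.Ico 0 (2 * Real.pi), phase φ = l := by
  have hpi := Real.two_pi_pos
  refine ⟨toIcoMod hpi 0 l.arg, by simpa using toIcoMod_mem_Ico hpi 0 l.arg, ?_⟩
  have h1 : Circle.exp (toIcoMod hpi 0 l.arg) = Circle.exp l.arg := by
    rw [Circle.exp_eq_exp]
    refine ⟨-toIcoDiv hpi 0 l.arg, ?_⟩
    have := toIcoMod_add_toIcoDiv_zsmul hpi 0 l.arg
    rw [zsmul_eq_mul] at this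
    push_cast
    linarith
  have h2 := Complex.norm_mul_exp_arg_mul_I l
  rw [hl] at h2
  rw [phase, mul_comm, ← Circle.coe_exp, h1, Circle.coe_exp]
  simpa using h2

theorem Iter.succ {Q : ℂ} {k : ℕ → ℕ} {l : ℕ → ℂ} {m N : ℕ} {H H' : Type v}
    [NormedAddCommGroup H] [InnerProductSpace ℂ H] [CompleteSpace H] [NormedAddCommGroup H']
    [InnerProductSpace ℂ H'] [CompleteSpace H'] {Z : ℕ → ℕ → H →L[ℂ] H}
    {Z' : ℕ → ℕ → H' →L[ℂ] H'} {J : H' →ₗᵢ[ℂ] H} (h : RowExt Q N m (k m) (l m) Z Z' J)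
    (h' : Iter Q k l m (nextCols N (k m)) H' Z') : Iter Q k l (m + 1) N H Z :=
  ⟨H', _, _, _, Z', J, h, h'⟩

/-- Iterated addition of rows leads to irreducible families. -/
theorem Iter.irr {Q : ℂ} (hQ : Q ≠ 0) {k : ℕ → ℕ} {l : ℕ → ℂ} (hl : ∀ j, l j ≠ 0) (m : ℕ) :
    ∀ (N : ℕ) (H : Type v) [NormedAddCommGroup H] [InnerProductSpace ℂ H] [CompleteSpace H]
      (Z : ℕ → ℕ → H →L[ℂ] H), Iter Q k l m N H Z → IrrFam N m Z := by
  induction m with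
  | zero =>
    intro N H _ _ _ Z h
    have h : Module.finrank ℂ H = 1 := h
    have : Nontrivial H := Module.nontrivial_of_finrank_pos (R := ℂ) (by omega)
    have := isSimpleModule_iff_finrank_eq_one.2 h
    exact ⟨inferInstance, fun K _ _ => eq_bot_or_eq_top K⟩
  | succ m ih =>
    rintro N H _ _ _ Z ⟨H', _, _, _, Z', J, h, h'⟩
    exact h.irreducible hQ (hl m) (ih _ _ _ h')

/-- The data of the rows determine the family up to equivalence. -/
theorem Iter.famEquiv {Q : ℂ} {k : ℕ → ℕ} {l : ℕ → ℂ} (m : ℕ) :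
    ∀ (N : ℕ) (H : Type v) [NormedAddCommGroup H] [InnerProductSpace ℂ H] [CompleteSpace H]
      (H₂ : Type w) [NormedAddCommGroup H₂] [InnerProductSpace ℂ H₂] [CompleteSpace H₂]
      (Z : ℕ → ℕ → H →L[ℂ] H) (Z₂ : ℕ → ℕ → H₂ →L[ℂ] H₂), Iter Q k l m N H Z →
      Iter Q k l m N H₂ Z₂ → FamEquiv N m Z Z₂ := by
  induction m with
  | zero =>
    intro N H _ _ _ H₂ _ _ _ Z Z₂ h h₂
    have h : Module.finrank ℂ H = 1 := h
    have h₂ : Module.finrank ℂ H₂ = 1 := h₂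
    have : FiniteDimensional ℂ H := Module.finite_of_finrank_pos (by omega)
    have : FiniteDimensional ℂ H₂ := Module.finite_of_finrank_pos (by omega)
    exact ⟨((stdOrthonormalBasis ℂ H).reindex (finCongr (h.trans h₂.symm))).equiv
      (stdOrthonormalBasis ℂ H₂) (Equiv.refl _), fun d _ α hα => by omega⟩
  | succ m ih =>
    rintro N H _ _ _ H₂ _ _ _ Z Z₂ ⟨H', _, _, _, Z', J, h, h'⟩ ⟨H₂', _, _, _, Z₂', J₂, h₂, h₂'⟩
    obtain ⟨J', h₂⟩ := h₂.comp (ih _ _ _ _ _ h' h₂')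
    exact h.unique h₂

/-- The data of the rows are invariants, provided that they are admissible: the scalar of a row
without gray boxes does not occur in the family. -/
theorem Iter.invariants {Q : ℂ} (hQ : Q ≠ 0) {k k₂ : ℕ → ℕ} {φ φ₂ : ℕ → ℝ} (m : ℕ) :
    ∀ (N : ℕ) (H : Type v) [NormedAddCommGroup H] [InnerProductSpace ℂ H] [CompleteSpace H]
      (H₂ : Type w) [NormedAddCommGroup H₂] [InnerProductSpace ℂ H₂] [CompleteSpace H₂]
      (Z : ℕ → ℕ → H →L[ℂ] H) (Z₂ : ℕ → ℕ → H₂ →L[ℂ] H₂),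
      Iter Q k (fun j => phase (φ j)) m N H Z → Iter Q k₂ (fun j => phase (φ₂ j)) m N H₂ Z₂ →
      Adm k φ m N → Adm k₂ φ₂ m N → FamEquiv N m Z Z₂ → ∀ j < m, k j = k₂ j ∧ φ j = φ₂ j := by
  induction m with
  | zero => intros; omega
  | succ m ih =>
    rintro N H _ _ _ H₂ _ _ _ Z Z₂ ⟨H', _, _, _, Z', J, h, h'⟩ ⟨H₂', _, _, _, Z₂', J₂, h₂, h₂'⟩
      ⟨a1, a2, a3, a4⟩ ⟨b1, b2, b3, b4⟩ hE j hj
    have : Nontrivial H' := (h'.irr hQ (fun _ => phase_ne_zero _) m _ _ _).1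
    have : Nontrivial H₂' := (h₂'.irr hQ (fun _ => phase_ne_zero _) m _ _ _).1
    obtain ⟨hc, hl, hE'⟩ := h.invariants h₂ hQ (phase_ne_zero _) (phase_ne_zero _) hE
    rcases Nat.lt_succ_iff_lt_or_eq.1 hj with hj | rfl
    · rw [← hc] at b4 h₂'
      exact ih _ _ _ _ _ h' h₂' a4 b4 hE' j hj
    · refine ⟨hc, ?_⟩
      rcases a1.lt_or_eq with h1 | h1
      · exact phase_injOn a2 b2 (hl h1)
      · rw [a3 h1, b3 (hc ▸ h1)]

theorem Iter.congr {Q : ℂ} {k k₂ : ℕ → ℕ} {l l₂ : ℕ → ℂ} (m : ℕ) :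
    ∀ (N : ℕ) (H : Type v) [NormedAddCommGroup H] [InnerProductSpace ℂ H] [CompleteSpace H]
      (Z : ℕ → ℕ → H →L[ℂ] H), (∀ j < m, k j = k₂ j ∧ l j = l₂ j) → Iter Q k l m N H Z →
      Iter Q k₂ l₂ m N H Z := by
  induction m with
  | zero => exact fun _ _ _ _ _ _ _ h => h
  | succ m ih =>
    rintro N H _ _ _ Z hkl ⟨H', _, _, _, Z', J, h, h'⟩
    obtain ⟨h1, h2⟩ := hkl m (by omega)
    rw [h1] at h h'
    rw [h2] at h
    exact ⟨H', _, _, _, Z', J, h, ih _ _ _ (fun j hj => hkl j (by omega)) h'⟩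

theorem Adm.congr {k k₂ : ℕ → ℕ} {φ φ₂ : ℕ → ℝ} {m N : ℕ}
    (h : ∀ j < m, k j = k₂ j ∧ φ j = φ₂ j) (hA : Adm k φ m N) : Adm k₂ φ₂ m N := by
  induction m generalizing N with
  | zero => trivial
  | succ m ih =>
    obtain ⟨h1, h2⟩ := h m (by omega)
    have hA : k m ≤ N ∧ φ m ∈ Set.Ico 0 (2 * Real.pi) ∧ (k m = N → φ m = 0) ∧
      Adm k φ m (nextCols N (k m)) := hA
    rw [h1, h2] at hA
    exact ⟨hA.1, hA.2.1, hA.2.2.1, ih (fun j hj => h j (by omega)) hA.2.2.2⟩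

/-- Every irreducible representation arises by iterated addition of rows. -/
theorem IrrFam.exists_iter {q : ℝ} (hq0 : 0 < q) (hq1 : q < 1) (m : ℕ) :
    ∀ (N : ℕ) (H : Type v) [NormedAddCommGroup H] [InnerProductSpace ℂ H] [CompleteSpace H]
      (Z : ℕ → ℕ → H →L[ℂ] H), IrrFam N m Z → IsQMat q N m Z →
      ∃ k φ, Adm k φ m N ∧ Iter q k (fun j => phase (φ j)) m N H Z := by
  induction m with
  | zero =>
    intro N H _ _ _ Z hirr _
    refine ⟨0, 0, trivial, ?_⟩
    obtain ⟨hn, hirr⟩ := hirr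
    obtain ⟨v, hv⟩ := exists_ne (0 : H)
    have h1 : (ℂ ∙ v) = ⊤ := (hirr (ℂ ∙ v) (Submodule.closed_of_finiteDimensional _)
      fun d _ α hα => by omega).resolve_left (by simpa using hv)
    change Module.finrank ℂ H = 1
    rw [← finrank_top, ← h1, finrank_span_singleton hv]
  | succ m ih =>
    intro N H _ _ _ Z hirr hZ
    obtain ⟨c, l, hl, hl1, K, _, _, _, Z', J, hE, hZ', hirr'⟩ := hirr.exists_rowExt hq0 hq1 hZ
    obtain ⟨k, φ, hA, hI⟩ := ih _ _ _ hirr' hZ'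
    obtain ⟨φ₀, hφ, rfl⟩ := exists_phase hl
    have hu : ∀ j < m, k j = Function.update k m c j ∧ φ j = Function.update φ m φ₀ j :=
      fun j hj => by simp [Function.update_of_ne hj.ne]
    refine ⟨Function.update k m c, Function.update φ m φ₀, ?_, Iter.succ (Z' := Z') (J := J) ?_ ?_⟩
    · simp only [Adm, Function.update_self]
      refine ⟨hE.c_le, hφ, fun hc => ?_, hA.congr hu⟩
      exact phase_injOn hφ ⟨le_rfl, Real.two_pi_pos⟩ (by rw [hl1 hc, phase_zero])
    · simpa only [Function.update_self] using hE
    · rw [Function.update_self]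
      exact hI.congr m _ _ _ fun j hj => ⟨(hu j hj).1, congrArg phase (hu j hj).2⟩

/-! ### Admissible sequences -/

section Admissible

variable {n : ℕ}

/-- Extension of the data of a sequence to all natural numbers. -/
def extend {α : Type*} [Zero α] (f : Fin n → α) (j : ℕ) : α := if h : j < n then f ⟨j, h⟩ else 0

theorem extend_of_lt {α : Type*} [Zero α] (f : Fin n → α) {j : ℕ} (h : j < n) :
    extend f j = f ⟨j, h⟩ := dif_pos h

theorem kBound_last (k : Fin (n + 1) → ℕ) : kBound k (Fin.last n) = n + 1 := by
  have : Finset.Ioi (Fin.last n) = ∅ := by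
    ext i; simp [Fin.le_last]
  rw [kBound, this]; simp

/-- The recursion for the upper bounds in the definition of admissible sequences. -/
theorem kBound_pred (k : Fin n → ℕ) {j : ℕ} (hj : j + 1 < n) :
    kBound k ⟨j, by omega⟩ = max (k ⟨j + 1, hj⟩) (kBound k ⟨j + 1, hj⟩ - 1) := by
  have h1 : Finset.Ioi (⟨j, by omega⟩ : Fin n) = insert ⟨j + 1, hj⟩ (Finset.Ioi ⟨j + 1, hj⟩) := by
    ext i
    simp only [Finset.mem_Ioi, Finset.mem_insert, Fin.lt_def, Fin.ext_iff]
    omega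
  have h2 : ((Finset.Ioi (⟨j + 1, hj⟩ : Fin n)).sup fun i => k i + j + 1 - (i : ℕ)) =
      ((Finset.Ioi (⟨j + 1, hj⟩ : Fin n)).sup fun i => k i + (j + 1) + 1 - (i : ℕ)) - 1 := by
    have := Finset.apply_sup_eq_sup_comp (s := Finset.Ioi (⟨j + 1, hj⟩ : Fin n))
      (f := fun i => k i + (j + 1) + 1 - (i : ℕ)) (fun x : ℕ => x - 1)
      (fun x y => by simp only [Nat.max_def]; split_ifs <;> omega) rfl
    rw [this]
    refine Finset.sup_congr rfl fun i _ => ?_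
    simp only [Function.comp]
    omega
  rw [kBound, kBound, h1, Finset.sup_insert, h2]
  simp only [Nat.max_def]
  split_ifs <;> omega

/-- The upper bound for `k_j` is the number of columns that are left when the rows below have been
removed. -/
theorem kBound_eq_nextCols (k : Fin n → ℕ) {j : ℕ} (hj : j + 1 < n)
    (hk : k ⟨j + 1, hj⟩ ≤ kBound k ⟨j + 1, hj⟩) :
    kBound k ⟨j, by omega⟩ = nextCols (kBound k ⟨j + 1, hj⟩) (k ⟨j + 1, hj⟩) := by
  rw [kBound_pred k hj, nextCols]
  have : 0 < kBound k ⟨j + 1, hj⟩ := lt_of_lt_of_le (by simp) (le_max_left _ _)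
  simp only [Nat.max_def]
  split_ifs <;> omega

/-- An admissible sequence is admissible for the addition of rows to `n` columns. -/
theorem AdmissibleSeq.adm (κ : AdmissibleSeq n) : Adm (extend κ.k) (extend κ.φ) n n := by
  have key : ∀ j (hj : j < n), Adm (extend κ.k) (extend κ.φ) (j + 1) (kBound κ.k ⟨j, hj⟩) := by
    intro j
    induction j with
    | zero =>
      intro hj
      refine ⟨?_, ?_, ?_, trivial⟩
      · rw [extend_of_lt _ hj]; exact κ.k_le _
      · rw [extend_of_lt _ hj]; exact κ.φ_mem _
      · rw [extend_of_lt _ hj, extend_of_lt _ hj]; exact κ.φ_eq_zero _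
    | succ j ih =>
      intro hj
      have := ih (by omega)
      rw [kBound_eq_nextCols _ hj (κ.k_le _)] at this
      refine ⟨?_, ?_, ?_, ?_⟩
      · rw [extend_of_lt _ hj]; exact κ.k_le _
      · rw [extend_of_lt _ hj]; exact κ.φ_mem _
      · rw [extend_of_lt _ hj, extend_of_lt _ hj]; exact κ.φ_eq_zero _
      · rw [extend_of_lt _ hj]; exact this
  cases n with
  | zero => trivial
  | succ n =>
    have := key n (by omega)
    rwa [show (⟨n, _⟩ : Fin (n + 1)) = Fin.last n from rfl, kBound_last] at this

/-- All admissible data with `n` rows and columns come from admissible sequences. -/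
theorem Adm.exists_admissibleSeq {k : ℕ → ℕ} {φ : ℕ → ℝ} (h : Adm k φ n n) :
    ∃ κ : AdmissibleSeq n, ∀ j (hj : j < n), κ.k ⟨j, hj⟩ = k j ∧ κ.φ ⟨j, hj⟩ = φ j := by
  have key : ∀ i j, (hj : j < n) → i + j + 1 = n →
      Adm k φ (j + 1) (kBound (fun i : Fin n => k i) ⟨j, hj⟩) := by
    intro i
    induction i with
    | zero =>
      intro j hj hij
      obtain rfl : n = j + 1 := by omega
      rwa [show (⟨j, hj⟩ : Fin (j + 1)) = Fin.last j from rfl, kBound_last]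
    | succ i ih =>
      intro j hj hij
      obtain ⟨h1, _, _, h4⟩ := ih (j + 1) (by omega) (by omega)
      rw [kBound_eq_nextCols _ (by omega) h1]
      exact h4
  have key' : ∀ j : Fin n, Adm k φ (j + 1) (kBound (fun i : Fin n => k i) j) := fun j =>
    key (n - 1 - j) j j.2 (by omega)
  exact ⟨⟨fun i => k i, fun i => φ i, fun j => (key' j).1, fun j => (key' j).2.1,
    fun j => (key' j).2.2.1⟩, fun j hj => ⟨rfl, rfl⟩⟩

theorem Adm.le {k : ℕ → ℕ} {φ : ℕ → ℝ} {m N : ℕ} (h : Adm k φ m N) : ∀ j < m, k j ≤ N := by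
  induction m generalizing N with
  | zero => intro j hj; omega
  | succ m ih =>
    intro j hj
    obtain ⟨h1, _, _, h4⟩ := h
    rcases Nat.lt_succ_iff_lt_or_eq.1 hj with hj | rfl
    · refine (ih h4 j hj).trans ?_
      unfold nextCols; split_ifs <;> omega
    · exact h1

end Admissible

/-! ### Operators on the standard basis -/

section Basis

variable {B : Type}

theorem basisVec_apply (m m' : B → ℕ) [Decidable (m' = m)] :
    (basisVec m : Ell2 B) m' = if m' = m then 1 else 0 := by
  classical
  rw [basisVec, lp.single_apply]
  by_cases h : m' = m
  · subst h; simp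
  · simp [h]

theorem apply_eq_inner (f : Ell2 B) (m : B → ℕ) : f m = ⟪basisVec m, f⟫_ℂ := by
  classical
  rw [basisVec, lp.inner_single_left]
  simp

theorem basisVec_ne_zero (m : B → ℕ) : (basisVec m : Ell2 B) ≠ 0 := by
  classical
  intro h
  have h1 := basisVec_apply m m
  rw [h, if_pos rfl] at h1
  exact zero_ne_one h1

theorem hasSum_basisVec (f : Ell2 B) : HasSum (fun m => f m • (basisVec m : Ell2 B)) f := by
  classical
  have h := lp.hasSum_single (p := 2) (by simp) f
  refine h.congr_fun fun m => ?_
  rw [basisVec, ← lp.single_smul]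
  simp

theorem clm_ext_basisVec {E : Type*} [NormedAddCommGroup E] [NormedSpace ℂ E]
    {S T : Ell2 B →L[ℂ] E} (h : ∀ m, S (basisVec m) = T (basisVec m)) : S = T := by
  ext f
  have h1 := (hasSum_basisVec f).mapL S
  have h2 := (hasSum_basisVec f).mapL T
  simp only [map_smul, h] at h1 h2
  exact h1.unique h2

theorem eq_top_of_basisVec_mem {K : Submodule ℂ (Ell2 B)} (hK : IsClosed (K : Set (Ell2 B)))
    (h : ∀ m, basisVec m ∈ K) : K = ⊤ := by
  rw [eq_top_iff]
  intro f _
  exact hK.mem_of_tendsto (hasSum_basisVec f)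
    (Filter.Eventually.of_forall fun s => K.sum_mem fun m _ => K.smul_mem _ (h m))

theorem diagOp_basisVec {w : (B → ℕ) → ℂ} (hw : ∃ K : ℝ, ∀ m, ‖w m‖ ≤ K) (m : B → ℕ) :
    diagOp w (basisVec m) = w m • basisVec m := by
  classical
  ext m'
  rw [diagOp_apply w hw, lp.coeFn_smul, Pi.smul_apply, basisVec_apply]
  split_ifs with h
  · rw [h]; rfl
  · simp

theorem star_diagOp {w : (B → ℕ) → ℂ} (hw : ∃ K : ℝ, ∀ m, ‖w m‖ ≤ K)
    (hw' : ∀ m, conj (w m) = w m) : star (diagOp w) = diagOp w := by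
  ext f m
  rw [apply_eq_inner, inner_star_right, diagOp_basisVec hw, inner_smul_left, ← apply_eq_inner,
    diagOp_apply w hw, hw']

variable [DecidableEq B]

theorem star_shift (b : B) : star (shift b : Ell2 B →L[ℂ] Ell2 B) = backShift b := by
  rw [shift, ← ContinuousLinearMap.star_eq_adjoint, star_star]

theorem backShift_add (b : B) (m : B → ℕ) :
    backShift b (basisVec (m + Pi.single b 1)) = basisVec m := by
  ext m'
  change (basisVec (m + Pi.single b 1) : Ell2 B) (m' + Pi.single b 1) = basisVec m m'
  classical
  rw [basisVec_apply, basisVec_apply]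
  simp

theorem backShift_of_eq_zero {b : B} {m : B → ℕ} (h : m b = 0) :
    backShift b (basisVec m) = 0 := by
  ext m'
  change (basisVec m : Ell2 B) (m' + Pi.single b 1) = 0
  classical
  rw [basisVec_apply, if_neg]
  intro h'
  have := congrFun h' b
  simp [h] at this

/-- A box is in its vacuum state or arises from another state by the shift. -/
theorem exists_eq_add_single (b : B) (m : B → ℕ) :
    m b = 0 ∨ ∃ m' : B → ℕ, m = m' + Pi.single b 1 := by
  rcases Nat.eq_zero_or_pos (m b) with h | h
  · exact Or.inl h
  · refine Or.inr ⟨Function.update m b (m b - 1), ?_⟩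
    ext b'
    by_cases hb : b' = b
    · subst hb; simp; omega
    · simp [hb]

variable {q : ℝ}

theorem bounded_pow (hq0 : 0 < q) (hq1 : q < 1) (b : B) :
    ∃ K : ℝ, ∀ m : B → ℕ, ‖((q ^ m b : ℝ) : ℂ)‖ ≤ K :=
  ⟨1, fun m => by
    rw [Complex.norm_real, Real.norm_of_nonneg (by positivity)]
    exact pow_le_one₀ hq0.le hq1.le⟩

theorem bounded_sqrt (hq0 : 0 < q) (b : B) :
    ∃ K : ℝ, ∀ m : B → ℕ, ‖((Real.sqrt (1 - q ^ (2 * m b)) : ℝ) : ℂ)‖ ≤ K :=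
  ⟨1, fun m => by
    rw [Complex.norm_real, Real.norm_of_nonneg (Real.sqrt_nonneg _), Real.sqrt_le_iff]
    have := pow_pos hq0 (2 * m b)
    exact ⟨zero_le_one, by linarith⟩⟩

theorem opD_basisVec (hq0 : 0 < q) (hq1 : q < 1) (b : B) (m : B → ℕ) :
    opD q b (basisVec m) = ((q ^ m b : ℝ) : ℂ) • basisVec m :=
  diagOp_basisVec (bounded_pow hq0 hq1 b) m

theorem opC_basisVec (hq0 : 0 < q) (b : B) (m : B → ℕ) :
    opC q b (basisVec m) = ((Real.sqrt (1 - q ^ (2 * m b)) : ℝ) : ℂ) • basisVec m :=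
  diagOp_basisVec (bounded_sqrt hq0 b) m

theorem star_opD (hq0 : 0 < q) (hq1 : q < 1) (b : B) : star (opD q b) = opD q b :=
  star_diagOp (bounded_pow hq0 hq1 b) fun _ => Complex.conj_ofReal _

theorem star_opC (hq0 : 0 < q) (b : B) : star (opC q b) = opC q b :=
  star_diagOp (bounded_sqrt hq0 b) fun _ => Complex.conj_ofReal _

theorem star_T22 (hq0 : 0 < q) (b : B) : star (T22 q b) = T11 q b := by
  rw [T22, T11, star_mul, star_opC hq0, ContinuousLinearMap.star_eq_adjoint]

theorem T22_basisVec (hq0 : 0 < q) (b : B) (m : B → ℕ) : T22 q b (basisVec m) =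
    ((Real.sqrt (1 - q ^ (2 * (m b + 1))) : ℝ) : ℂ) • basisVec (m + Pi.single b 1) := by
  rw [T22, clm_mul_apply, shift_basisVec, opC_basisVec hq0]
  simp

theorem T11_eq (b : B) : T11 q b = backShift b * opC q b := by
  rw [T11, ← ContinuousLinearMap.star_eq_adjoint, star_shift]

theorem T11_of_eq_zero (hq0 : 0 < q) {b : B} {m : B → ℕ} (h : m b = 0) :
    T11 q b (basisVec m) = 0 := by
  rw [T11_eq, clm_mul_apply, opC_basisVec hq0, map_smul, backShift_of_eq_zero h, smul_zero]

theorem T11_add (hq0 : 0 < q) (b : B) (m : B → ℕ) : T11 q b (basisVec (m + Pi.single b 1)) =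
    ((Real.sqrt (1 - q ^ (2 * (m b + 1))) : ℝ) : ℂ) • basisVec m := by
  rw [T11_eq, clm_mul_apply, opC_basisVec hq0, map_smul, backShift_add]
  simp

theorem sqrt_mul_sqrt_self (hq0 : 0 < q) (hq1 : q < 1) (k : ℕ) :
    ((Real.sqrt (1 - q ^ (2 * k)) : ℝ) : ℂ) * ((Real.sqrt (1 - q ^ (2 * k)) : ℝ) : ℂ) =
      1 - (q : ℂ) ^ (2 * k) := by
  rw [← Complex.ofReal_mul, Real.mul_self_sqrt]
  · push_cast; rfl
  · have := pow_le_one₀ (n := 2 * k) hq0.le hq1.le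
    linarith

theorem T11_mul_T22 (hq0 : 0 < q) (hq1 : q < 1) (b : B) :
    T11 q b * T22 q b = 1 - (q : ℂ) ^ 2 • (opD q b * opD q b) := by
  refine clm_ext_basisVec fun m => ?_
  rw [clm_mul_apply, T22_basisVec hq0, map_smul, T11_add hq0, smul_smul,
    sqrt_mul_sqrt_self hq0 hq1, sub_apply, smul_apply,
    clm_mul_apply, opD_basisVec hq0 hq1, map_smul, opD_basisVec hq0 hq1, clm_one_apply]
  match_scalars
  push_cast
  ring

theorem T22_mul_T11 (hq0 : 0 < q) (hq1 : q < 1) (b : B) :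
    T22 q b * T11 q b = 1 - opD q b * opD q b := by
  refine clm_ext_basisVec fun m => ?_
  rw [clm_mul_apply, sub_apply,
    clm_mul_apply, opD_basisVec hq0 hq1, map_smul, opD_basisVec hq0 hq1, clm_one_apply]
  rcases exists_eq_add_single b m with h | ⟨m, rfl⟩
  · rw [T11_of_eq_zero hq0 h, map_zero, h]; simp
  · rw [T11_add hq0, map_smul, T22_basisVec hq0, smul_smul, sqrt_mul_sqrt_self hq0 hq1]
    match_scalars
    simp
    ring

theorem opD_mul_T22 (hq0 : 0 < q) (hq1 : q < 1) (b : B) :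
    opD q b * T22 q b = (q : ℂ) • (T22 q b * opD q b) := by
  refine clm_ext_basisVec fun m => ?_
  rw [clm_mul_apply, smul_apply, clm_mul_apply, opD_basisVec hq0 hq1,
    T22_basisVec hq0, map_smul, map_smul, opD_basisVec hq0 hq1, T22_basisVec hq0]
  match_scalars
  simp
  ring

theorem commute_diagOp {w w' : (B → ℕ) → ℂ} (hw : ∃ K : ℝ, ∀ m, ‖w m‖ ≤ K)
    (hw' : ∃ K : ℝ, ∀ m, ‖w' m‖ ≤ K) : Commute (diagOp w) (diagOp w') := by
  refine clm_ext_basisVec fun m => ?_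
  rw [clm_mul_apply, clm_mul_apply, diagOp_basisVec hw, diagOp_basisVec hw', map_smul, map_smul,
    diagOp_basisVec hw, diagOp_basisVec hw', smul_comm]

theorem commute_shift_diagOp {w : (B → ℕ) → ℂ} (hw : ∃ K : ℝ, ∀ m, ‖w m‖ ≤ K) {b : B}
    (hb : ∀ m, w (m + Pi.single b 1) = w m) : Commute (shift b) (diagOp w) := by
  refine clm_ext_basisVec fun m => ?_
  rw [clm_mul_apply, clm_mul_apply, diagOp_basisVec hw, map_smul, shift_basisVec,
    diagOp_basisVec hw, hb]

theorem commute_shift_shift (b b' : B) : Commute (shift b : Ell2 B →L[ℂ] Ell2 B) (shift b') := by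
  refine clm_ext_basisVec fun m => ?_
  simp only [clm_mul_apply, shift_basisVec, add_right_comm]

theorem commute_shift_backShift {b b' : B} (h : b ≠ b') :
    Commute (shift b : Ell2 B →L[ℂ] Ell2 B) (backShift b') := by
  refine clm_ext_basisVec fun m => ?_
  rw [clm_mul_apply, clm_mul_apply, shift_basisVec]
  rcases exists_eq_add_single b' m with h' | ⟨m, rfl⟩
  · rw [backShift_of_eq_zero h', map_zero, backShift_of_eq_zero (by simpa [h.symm] using h')]
  · rw [backShift_add, shift_basisVec, add_right_comm, backShift_add]

theorem commute_shift_opC (hq0 : 0 < q) {b b' : B} (h : b ≠ b') :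
    Commute (shift b : Ell2 B →L[ℂ] Ell2 B) (opC q b') :=
  commute_shift_diagOp (bounded_sqrt hq0 b') fun m => by simp [h.symm]

theorem commute_shift_opD (hq0 : 0 < q) (hq1 : q < 1) {b b' : B} (h : b ≠ b') :
    Commute (shift b : Ell2 B →L[ℂ] Ell2 B) (opD q b') :=
  commute_shift_diagOp (bounded_pow hq0 hq1 b') fun m => by simp [h.symm]

theorem commute_backShift_opC (hq0 : 0 < q) {b b' : B} (h : b ≠ b') :
    Commute (backShift b : Ell2 B →L[ℂ] Ell2 B) (opC q b') := by
  have := (commute_shift_opC hq0 h).star_star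
  rwa [star_shift, star_opC hq0] at this

theorem commute_T22_T22 (hq0 : 0 < q) {b b' : B} (h : b ≠ b') : Commute (T22 q b) (T22 q b') :=
  ((commute_diagOp (bounded_sqrt hq0 b) (bounded_sqrt hq0 b')).mul_right
    (commute_shift_opC hq0 h.symm).symm).mul_left
    ((commute_shift_opC hq0 h).mul_right (commute_shift_shift b b'))

theorem commute_T22_T11 (hq0 : 0 < q) {b b' : B} (h : b ≠ b') : Commute (T22 q b) (T11 q b') := by
  rw [T11_eq]
  exact ((commute_backShift_opC hq0 h.symm).symm.mul_right
    (commute_diagOp (bounded_sqrt hq0 b) (bounded_sqrt hq0 b'))).mul_left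
    ((commute_shift_backShift h).mul_right (commute_shift_opC hq0 h))

theorem commute_T22_opD (hq0 : 0 < q) (hq1 : q < 1) {b b' : B} (h : b ≠ b') :
    Commute (T22 q b) (opD q b') :=
  (commute_diagOp (bounded_sqrt hq0 b) (bounded_pow hq0 hq1 b')).mul_left
    (commute_shift_opD hq0 hq1 h)

end Basis

/-! ### Grids with white and gray boxes -/

section Grid

variable {B : Type} [DecidableEq B]

/-- The operator `T₂₂` of the box that belongs to the given position, or the phase of this position
if the box there is gray. White boxes are given by their positions `pos`: the row and the distance
from the right side. -/
def boxA (q : ℝ) (pos : B → ℕ × ℕ) (θ : ℕ → ℕ → ℂ) (r d : ℕ) : Ell2 B →L[ℂ] Ell2 B :=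
  open Classical in if h : ∃ b, pos b = (r, d) then T22 q h.choose else θ r d • 1

/-- The operator `T₂₁` of the box that belongs to the given position, or zero if the box there is
gray. -/
def boxD (q : ℝ) (pos : B → ℕ × ℕ) (r d : ℕ) : Ell2 B →L[ℂ] Ell2 B :=
  open Classical in if h : ∃ b, pos b = (r, d) then opD q h.choose else 0

variable {q : ℝ} {pos : B → ℕ × ℕ} {θ : ℕ → ℕ → ℂ}

theorem boxA_of_eq (hpos : Function.Injective pos) {b : B} {r d : ℕ} (h : pos b = (r, d)) :
    boxA q pos θ r d = T22 q b := by
  have h' : ∃ b, pos b = (r, d) := ⟨b, h⟩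
  rw [boxA, dif_pos h', hpos (h'.choose_spec.trans h.symm)]

theorem boxD_of_eq (hpos : Function.Injective pos) {b : B} {r d : ℕ} (h : pos b = (r, d)) :
    boxD q pos r d = opD q b := by
  have h' : ∃ b, pos b = (r, d) := ⟨b, h⟩
  rw [boxD, dif_pos h', hpos (h'.choose_spec.trans h.symm)]

theorem boxA_of_not {r d : ℕ} (h : ∀ b, pos b ≠ (r, d)) :
    boxA q pos θ r d = θ r d • 1 := dif_neg (by simpa using h)

theorem boxD_of_not {r d : ℕ} (h : ∀ b, pos b ≠ (r, d)) :
    boxD q pos r d = 0 := dif_neg (by simpa using h)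

/-- White boxes satisfy the relations of the operators `T_{ij}`, gray ones satisfy them with `D =
0`. -/
theorem boxRel (hq0 : 0 < q) (hq1 : q < 1) (hpos : Function.Injective pos)
    (hθ : ∀ r d, ‖θ r d‖ = 1) : BoxRel (q : ℂ) (boxA q pos θ) (boxD q pos) := by
  have cases : ∀ r d, (∃ b, pos b = (r, d)) ∨ ∀ b, pos b ≠ (r, d) := fun r d => by
    by_cases h : ∃ b, pos b = (r, d)
    · exact Or.inl h
    · exact Or.inr (by simpa using h)
  have hθ1 : ∀ r d, θ r d * star (θ r d) = 1 := fun r d => by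
    rw [Complex.star_def, Complex.mul_conj, Complex.normSq_eq_norm_sq, hθ]; simp
  constructor
  · intro r d
    rcases cases r d with ⟨b, hb⟩ | hb
    · rw [boxD_of_eq hpos hb, star_opD hq0 hq1]
    · rw [boxD_of_not hb, star_zero]
  · intro r d
    rcases cases r d with ⟨b, hb⟩ | hb
    · rw [boxD_of_eq hpos hb, boxA_of_eq hpos hb, star_T22 hq0, T11_mul_T22 hq0 hq1]
    · rw [boxD_of_not hb, boxA_of_not hb, star_smul, smul_mul_smul_comm, mul_comm, hθ1]; simp
  · intro r d
    rcases cases r d with ⟨b, hb⟩ | hb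
    · rw [boxD_of_eq hpos hb, boxA_of_eq hpos hb, star_T22 hq0, T22_mul_T11 hq0 hq1]
    · rw [boxD_of_not hb, boxA_of_not hb, star_smul, smul_mul_smul_comm, hθ1]; simp
  · intro r d
    rcases cases r d with ⟨b, hb⟩ | hb
    · rw [boxD_of_eq hpos hb, boxA_of_eq hpos hb, opD_mul_T22 hq0 hq1]
    · rw [boxD_of_not hb]; simp
  · intro r d r' d' hne
    rcases cases r d with ⟨b, hb⟩ | hb
    · rcases cases r' d' with ⟨b', hb'⟩ | hb'
      · rw [boxA_of_eq hpos hb, boxA_of_eq hpos hb']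
        exact commute_T22_T22 hq0 fun h => hne (by rw [← hb, h, hb'])
      · rw [boxA_of_not hb']
        exact (Commute.one_right _).smul_right _
    · rw [boxA_of_not hb]
      exact (Commute.one_left _).smul_left _
  · intro r d r' d' hne
    rcases cases r d with ⟨b, hb⟩ | hb
    · rcases cases r' d' with ⟨b', hb'⟩ | hb'
      · rw [boxA_of_eq hpos hb, boxA_of_eq hpos hb', star_T22 hq0]
        exact commute_T22_T11 hq0 fun h => hne (by rw [← hb, h, hb'])
      · rw [boxA_of_not hb', star_smul, star_one]
        exact (Commute.one_right _).smul_right _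
    · rw [boxA_of_not hb]
      exact (Commute.one_left _).smul_left _
  · intro r d r' d' hne
    rcases cases r d with ⟨b, hb⟩ | hb
    · rcases cases r' d' with ⟨b', hb'⟩ | hb'
      · rw [boxA_of_eq hpos hb, boxD_of_eq hpos hb']
        exact commute_T22_opD hq0 hq1 fun h => hne (by rw [← hb, h, hb'])
      · rw [boxD_of_not hb']
        exact Commute.zero_right _
    · rw [boxA_of_not hb]
      exact (Commute.one_left _).smul_left _
  · intro r d r' d' hne
    rcases cases r d with ⟨b, hb⟩ | hb
    · rcases cases r' d' with ⟨b', hb'⟩ | hb'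
      · rw [boxD_of_eq hpos hb, boxD_of_eq hpos hb']
        exact commute_diagOp (bounded_pow hq0 hq1 b) (bounded_pow hq0 hq1 b')
      · rw [boxD_of_not hb']
        exact Commute.zero_right _
    · rw [boxD_of_not hb]
      exact Commute.zero_left _

end Grid

/-! ### Grids and the addition of rows -/

section Intertwine

variable {H H' : Type*} [NormedAddCommGroup H] [InnerProductSpace ℂ H] [CompleteSpace H]
  [NormedAddCommGroup H'] [InnerProductSpace ℂ H'] [CompleteSpace H'] (J : H' →ₗᵢ[ℂ] H)

theorem rowPath_intertwine {Q : ℂ} {a D u : ℕ → H →L[ℂ] H} {a' D' u' : ℕ → H' →L[ℂ] H'}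
    {δ : H →L[ℂ] H} {δ' : H' →L[ℂ] H'} (ha : ∀ d v, star (a d) (J v) = J (star (a' d) v))
    (hD : ∀ d v, D d (J v) = J (D' d v)) (hu : ∀ d v, u d (J v) = J (u' d v))
    (hδ : ∀ v, δ (J v) = J (δ' v)) (d : ℕ) (v : H') :
    rowPath Q a D u δ d (J v) = J (rowPath Q a' D' u' δ' d v) := by
  induction d generalizing v with
  | zero => exact hδ v
  | succ d ih =>
    simp only [rowPath, sub_apply, smul_apply,
      clm_mul_apply, ih, hD, hu, ha, map_sub, map_smul]

/-- Sums over paths are intertwined if the operators of the visited rows and their adjoints are. -/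
theorem gridPath_intertwine {Q : ℂ} {a D : ℕ → ℕ → H →L[ℂ] H} {a' D' : ℕ → ℕ → H' →L[ℂ] H'}
    {r : ℕ} (ha : ∀ i < r, ∀ d v, a i d (J v) = J (a' i d v))
    (has : ∀ i < r, ∀ d v, star (a i d) (J v) = J (star (a' i d) v))
    (hD : ∀ i < r, ∀ d v, D i d (J v) = J (D' i d v)) (d α : ℕ) (v : H') :
    gridPath Q a D r d α (J v) = J (gridPath Q a' D' r d α v) := by
  induction r generalizing d v with
  | zero => simp [gridPath_zero]
  | succ r ih =>
    have ih' := ih (fun i hi => ha i (by omega)) (fun i hi => has i (by omega))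
      (fun i hi => hD i (by omega))
    have hrow : ∀ v, rowPath Q (a r) (D r) (fun d => gridPath Q a D r d α)
          (if α = r then 1 else 0) d (J v) =
        J (rowPath Q (a' r) (D' r) (fun d => gridPath Q a' D' r d α)
          (if α = r then 1 else 0) d v) := fun v =>
      rowPath_intertwine J (has r (by omega)) (hD r (by omega)) (fun d v => ih' d v)
        (fun v => by split_ifs <;> simp) d v
    rw [gridPath_succ, gridPath_succ]
    simp only [add_apply, clm_mul_apply, ih', hD r (by omega), hrow,
      ha r (by omega), map_add]

end Intertwine

section Vacuum

variable {B : Type} (p : B → Prop)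

/-- Extension of an occupation of some boxes by the vacuum state in the other boxes. -/
def vacExt [DecidablePred p] (m : {b // p b} → ℕ) (b : B) : ℕ := if h : p b then m ⟨b, h⟩ else 0

variable [DecidablePred p]

theorem vacExt_coe (m : {b // p b} → ℕ) (b : {b // p b}) : vacExt p m b = m b := by
  rw [vacExt, dif_pos b.2]

theorem vacExt_of_not (m : {b // p b} → ℕ) {b : B} (h : ¬ p b) : vacExt p m b = 0 := dif_neg h

theorem vacExt_injective : Function.Injective (vacExt p) := fun m m' h => by
  ext b
  rw [← vacExt_coe p m, h, vacExt_coe]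

theorem vacExt_add_single [DecidableEq B] (m : {b // p b} → ℕ) (b : {b // p b}) :
    vacExt p (m + Pi.single b 1) = vacExt p m + Pi.single b.1 1 := by
  ext b'
  by_cases h : p b'
  · rw [Pi.add_apply, vacExt, dif_pos h, vacExt, dif_pos h, Pi.add_apply]
    by_cases hb : b' = b
    · subst hb; simp
    · rw [Pi.single_eq_of_ne hb, Pi.single_eq_of_ne fun h' => hb (congrArg Subtype.val h')]
  · have hb : b' ≠ b := fun h' => h (h' ▸ b.2)
    rw [Pi.add_apply, vacExt_of_not p _ h, vacExt_of_not p _ h, Pi.single_eq_of_ne hb, add_zero]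

theorem exists_vacExt {m : B → ℕ} (h : ∀ b, ¬ p b → m b = 0) :
    ∃ m', vacExt p m' = m := by
  refine ⟨fun b => m b, ?_⟩
  ext b
  by_cases hb : p b
  · rw [vacExt, dif_pos hb]
  · rw [vacExt_of_not p _ hb, h b hb]

theorem norm_extend (f : Ell2 {b // p b}) (m : B → ℕ) :
    ‖Function.extend (vacExt p) f 0 m‖ ^ (2 : ℝ≥0∞).toReal =
      Function.extend (vacExt p) (fun m => ‖f m‖ ^ (2 : ℝ≥0∞).toReal) 0 m := by
  by_cases h : ∃ m', vacExt p m' = m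
  · obtain ⟨m, rfl⟩ := h
    rw [(vacExt_injective p).extend_apply, (vacExt_injective p).extend_apply]
  · rw [Function.extend_apply' _ _ _ h, Function.extend_apply' _ _ _ h]
    simp

/-- The embedding of the states of some boxes into the states of all boxes by the vacuum state in
the other boxes. -/
def vacEmb : Ell2 {b // p b} →ₗᵢ[ℂ] Ell2 B where
  toFun f := ⟨Function.extend (vacExt p) f 0, memℓp_gen (by
    have hf := (memℓp_gen_iff (p := 2) (by simp)).1 (lp.memℓp f)
    have := (hasSum_extend_zero (vacExt_injective p)).2 hf.hasSum
    exact (this.congr_fun (fun m => norm_extend p f m)).summable)⟩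
  map_add' f g := by
    ext m
    change Function.extend (vacExt p) (f + g : Ell2 {b // p b}) 0 m =
      Function.extend (vacExt p) f 0 m + Function.extend (vacExt p) g 0 m
    by_cases h : ∃ m', vacExt p m' = m
    · obtain ⟨m, rfl⟩ := h
      simp only [(vacExt_injective p).extend_apply]
      rfl
    · simp only [Function.extend_apply' _ _ _ h]; simp
  map_smul' c f := by
    ext m
    change Function.extend (vacExt p) (c • f : Ell2 {b // p b}) 0 m =
      c • Function.extend (vacExt p) f 0 m
    by_cases h : ∃ m', vacExt p m' = m
    · obtain ⟨m, rfl⟩ := h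
      simp only [(vacExt_injective p).extend_apply]
      rfl
    · simp only [Function.extend_apply' _ _ _ h]; simp
  norm_map' f := by
    rw [lp.norm_eq_tsum_rpow (by simp), lp.norm_eq_tsum_rpow (by simp)]
    congr 1
    have hf := (memℓp_gen_iff (p := 2) (by simp)).1 (lp.memℓp f)
    have := (hasSum_extend_zero (vacExt_injective p)).2 hf.hasSum
    exact (this.congr_fun (fun m => norm_extend p f m)).tsum_eq

theorem vacEmb_basisVec (m : {b // p b} → ℕ) : vacEmb p (basisVec m) = basisVec (vacExt p m) := by
  classical
  ext m'
  change Function.extend (vacExt p) (basisVec m : Ell2 {b // p b}) 0 m' = basisVec (vacExt p m) m'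
  by_cases h : ∃ m₀, vacExt p m₀ = m'
  · obtain ⟨m', rfl⟩ := h
    rw [(vacExt_injective p).extend_apply, basisVec_apply, basisVec_apply]
    simp [(vacExt_injective p).eq_iff]
  · rw [Function.extend_apply' _ _ _ h, basisVec_apply, if_neg fun h' => h ⟨m, h'.symm⟩]; rfl

theorem eq_of_vacEmb_basisVec {S : Ell2 B →L[ℂ] Ell2 B}
    {S' : Ell2 {b // p b} →L[ℂ] Ell2 {b // p b}}
    (h : ∀ m, S (basisVec (vacExt p m)) = vacEmb p (S' (basisVec m))) (v : Ell2 {b // p b}) :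
    S (vacEmb p v) = vacEmb p (S' v) := by
  have : S ∘L (vacEmb p).toContinuousLinearMap = (vacEmb p).toContinuousLinearMap ∘L S' := by
    refine clm_ext_basisVec fun m => ?_
    change S (vacEmb p (basisVec m)) = vacEmb p (S' (basisVec m))
    rw [vacEmb_basisVec, h]
  exact ContinuousLinearMap.ext_iff.1 this v

variable [DecidableEq B] {q : ℝ}

theorem T22_vacEmb (hq0 : 0 < q) (b : {b // p b}) (v : Ell2 {b // p b}) :
    T22 q b.1 (vacEmb p v) = vacEmb p (T22 q b v) :=
  eq_of_vacEmb_basisVec p (fun m => by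
    rw [T22_basisVec hq0, T22_basisVec hq0, map_smul, vacEmb_basisVec, vacExt_add_single,
      vacExt_coe]) v

theorem T11_vacEmb (hq0 : 0 < q) (b : {b // p b}) (v : Ell2 {b // p b}) :
    T11 q b.1 (vacEmb p v) = vacEmb p (T11 q b v) :=
  eq_of_vacEmb_basisVec p (fun m => by
    rcases exists_eq_add_single b m with h | ⟨m, rfl⟩
    · rw [T11_of_eq_zero hq0 h, T11_of_eq_zero hq0 (by rw [vacExt_coe, h]), map_zero]
    · rw [T11_add hq0, vacExt_add_single, T11_add hq0, map_smul, vacEmb_basisVec, vacExt_coe]) v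

theorem opD_vacEmb (hq0 : 0 < q) (hq1 : q < 1) (b : {b // p b}) (v : Ell2 {b // p b}) :
    opD q b.1 (vacEmb p v) = vacEmb p (opD q b v) :=
  eq_of_vacEmb_basisVec p (fun m => by
    rw [opD_basisVec hq0 hq1, opD_basisVec hq0 hq1, map_smul, vacEmb_basisVec, vacExt_coe]) v

theorem T11_vacEmb_of_not (hq0 : 0 < q) {b : B} (hb : ¬ p b) (v : Ell2 {b // p b}) :
    T11 q b (vacEmb p v) = 0 := by
  have := eq_of_vacEmb_basisVec p (S := T11 q b) (S' := 0) (fun m => by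
    rw [T11_of_eq_zero hq0 (vacExt_of_not p m hb)]; simp) v
  simpa using this

theorem opD_vacEmb_of_not (hq0 : 0 < q) (hq1 : q < 1) {b : B} (hb : ¬ p b)
    (v : Ell2 {b // p b}) : opD q b (vacEmb p v) = vacEmb p v := by
  have := eq_of_vacEmb_basisVec p (S := opD q b) (S' := 1) (fun m => by
    rw [opD_basisVec hq0 hq1, vacExt_of_not p m hb]; simp [vacEmb_basisVec]) v
  simpa using this

end Vacuum

section Model

/-- The phases of the gray boxes: the rightmost gray box of the row `r` carries the angle `φ r`. -/
def grayPhase (k : ℕ → ℕ) (φ : ℕ → ℝ) (r d : ℕ) : ℂ := if d = k r then phase (φ r) else 1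

theorem norm_grayPhase (k : ℕ → ℕ) (φ : ℕ → ℝ) (r d : ℕ) : ‖grayPhase k φ r d‖ = 1 := by
  unfold grayPhase; split_ifs
  · exact norm_phase _
  · exact norm_one

/-- The operators that belong to a grid with white boxes at the positions `pos`. -/
def gridFam {B : Type} [DecidableEq B] (q : ℝ) (pos : B → ℕ × ℕ) (θ : ℕ → ℕ → ℂ) (m : ℕ) :
    ℕ → ℕ → Ell2 B →L[ℂ] Ell2 B :=
  gridPath q (boxA q pos θ) (boxD q pos) m

variable {B : Type} [DecidableEq B] {q : ℝ} {pos : B → ℕ × ℕ} {θ : ℕ → ℕ → ℂ}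
  {k : ℕ → ℕ} {φ : ℕ → ℝ}

/-- The paths that leave the grid in its last row do not visit the other rows. -/
theorem gridFam_last (m d : ℕ) : gridFam q pos θ (m + 1) d m =
    boxA q pos θ m d * rowPath q (boxA q pos θ m) (boxD q pos m) 0 1 d := by
  have h0 : (fun d => gridPath (q : ℂ) (boxA q pos θ) (boxD q pos) m d m) = 0 := by
    funext d; exact gridPath_of_le le_rfl d
  rw [gridFam, gridPath_succ, h0, gridPath_of_le le_rfl, mul_zero, zero_add, if_pos rfl]

/-- The paths that leave the grid in another row leave the last row at its top. -/
theorem gridFam_low {m α : ℕ} (hα : α < m) (d : ℕ) : gridFam q pos θ (m + 1) d α =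
    boxD q pos m d * gridFam q pos θ m d α + boxA q pos θ m d *
      rowPath q (boxA q pos θ m) (boxD q pos m) (fun d => gridFam q pos θ m d α) 0 d := by
  rw [gridFam, gridPath_succ, if_neg (by omega)]
  rfl

/-- The paths in the last row act on a vector of the standard basis by a non-zero scalar if they
leave the grid in the same row. -/
theorem rowPath_basisVec (hq0 : 0 < q) (hq1 : q < 1) (hpos : Function.Injective pos) {m c : ℕ}
    (hw : ∀ d < c, ∃ b, pos b = (m, d)) (v : B → ℕ) {d : ℕ} (hd : d ≤ c) :
    ∃ s : ℂ, s ≠ 0 ∧ rowPath (q : ℂ) (boxA q pos θ m) (boxD q pos m) 0 1 d (basisVec v) =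
      s • basisVec v := by
  induction d with
  | zero => exact ⟨1, one_ne_zero, by rw [one_smul]; rfl⟩
  | succ d ih =>
    obtain ⟨s, hs, e⟩ := ih (by omega)
    obtain ⟨b, hb⟩ := hw d hd
    refine ⟨s * ((q ^ v b : ℝ) : ℂ), mul_ne_zero hs ?_, ?_⟩
    · exact_mod_cast (pow_pos hq0 _).ne'
    · rw [rowPath, sub_apply, clm_mul_apply, e, map_smul,
        boxD_of_eq hpos hb, opD_basisVec hq0 hq1, smul_smul]
      simp

/-- The paths that leave the grid in its last row generate all states of this row from the
vacuum. -/
theorem basisVec_mem_genSpan [Fintype B] (hq0 : 0 < q) (hq1 : q < 1)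
    (hpos : Function.Injective pos) {m c : ℕ} (hw : ∀ d < c, ∃ b, pos b = (m, d))
    (hw' : ∀ b, (pos b).1 < m ∨ (pos b).1 = m ∧ (pos b).2 < c) (W : Submodule ℂ (Ell2 B))
    (hW : ∀ v : B → ℕ, (∀ b, ¬ (pos b).1 < m → v b = 0) → basisVec v ∈ W) (v : B → ℕ) :
    basisVec v ∈ genSpan (fun d => toEnd _ (gridFam q pos θ (m + 1) d m)) c W := by
  have key : ∀ s, ∀ v : B → ℕ, ∑ b, v b = s → basisVec v ∈
      genSpan (fun d => toEnd _ (gridFam q pos θ (m + 1) d m)) c W := by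
    intro s
    induction s with
    | zero =>
      intro v hv
      refine le_genSpan (hW v fun b _ => ?_)
      exact (Finset.sum_eq_zero_iff.1 hv) b (Finset.mem_univ b)
    | succ s ih =>
      intro v hv
      by_cases h : ∀ b, ¬ (pos b).1 < m → v b = 0
      · exact le_genSpan (hW v h)
      · push Not at h
        obtain ⟨b, hb, hvb⟩ := h
        obtain ⟨v, rfl⟩ := (exists_eq_add_single b v).resolve_left hvb
        obtain ⟨hb1, hb2⟩ := (hw' b).resolve_left (by omega)
        have hbp : pos b = (m, (pos b).2) := Prod.ext hb1 rfl
        have hvs : ∑ b, v b = s := by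
          simp only [Pi.add_apply, Finset.sum_add_distrib, Finset.sum_pi_single', Finset.mem_univ,
            if_true] at hv
          omega
        have h1 := genSpan_invariant (x := fun d => toEnd _ (gridFam q pos θ (m + 1) d m))
          hb2 (ih v hvs)
        obtain ⟨s', hs', e⟩ := rowPath_basisVec (θ := θ) hq0 hq1 hpos hw v hb2.le
        rw [toEnd_apply, gridFam_last, clm_mul_apply, e, boxA_of_eq hpos hbp, map_smul,
          T22_basisVec hq0, smul_smul] at h1
        refine (Submodule.smul_mem_iff _ (mul_ne_zero hs' ?_)).1 h1
        rw [Complex.ofReal_ne_zero]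
        refine (Real.sqrt_pos.2 ?_).ne'
        have := pow_lt_one₀ hq0.le hq1 (n := 2 * (v b + 1)) (by omega)
        linarith
  exact key _ v rfl

theorem boxA_vacEmb (hq0 : 0 < q) (hpos : Function.Injective pos) {m i : ℕ} (hi : i < m) (d : ℕ)
    (v : Ell2 {b // (pos b).1 < m}) :
    boxA q pos θ i d (vacEmb (fun b => (pos b).1 < m) v) = vacEmb (fun b => (pos b).1 < m)
      (boxA q (fun b : {b // (pos b).1 < m} => pos b.1) θ i d v) ∧
    star (boxA q pos θ i d) (vacEmb (fun b => (pos b).1 < m) v) = vacEmb (fun b => (pos b).1 < m)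
      (star (boxA q (fun b : {b // (pos b).1 < m} => pos b.1) θ i d) v) := by
  have hpos' : Function.Injective fun b : {b // (pos b).1 < m} => pos b.1 :=
    hpos.comp Subtype.val_injective
  by_cases h : ∃ b, pos b = (i, d)
  · obtain ⟨b, hb⟩ := h
    have hbm : (pos b).1 < m := by rw [hb]; exact hi
    rw [boxA_of_eq hpos hb, boxA_of_eq hpos' (b := ⟨b, hbm⟩) hb, star_T22 hq0, star_T22 hq0]
    exact ⟨T22_vacEmb _ hq0 ⟨b, hbm⟩ v, T11_vacEmb _ hq0 ⟨b, hbm⟩ v⟩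
  · push Not at h
    rw [boxA_of_not h, boxA_of_not (B := {b // (pos b).1 < m}) fun b => h b.1,
      star_smul, star_smul, star_one, star_one]
    simp only [smul_apply, clm_one_apply, map_smul, and_self]

theorem boxD_vacEmb (hq0 : 0 < q) (hq1 : q < 1) (hpos : Function.Injective pos) {m i : ℕ}
    (hi : i < m) (d : ℕ) (v : Ell2 {b // (pos b).1 < m}) :
    boxD q pos i d (vacEmb (fun b => (pos b).1 < m) v) = vacEmb (fun b => (pos b).1 < m)
      (boxD q (fun b : {b // (pos b).1 < m} => pos b.1) i d v) := by
  have hpos' : Function.Injective fun b : {b // (pos b).1 < m} => pos b.1 :=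
    hpos.comp Subtype.val_injective
  by_cases h : ∃ b, pos b = (i, d)
  · obtain ⟨b, hb⟩ := h
    have hbm : (pos b).1 < m := by rw [hb]; exact hi
    rw [boxD_of_eq hpos hb, boxD_of_eq hpos' (b := ⟨b, hbm⟩) hb]
    exact opD_vacEmb _ hq0 hq1 ⟨b, hbm⟩ v
  · push Not at h
    rw [boxD_of_not h, boxD_of_not (B := {b // (pos b).1 < m}) fun b => h b.1]
    exact (map_zero _).symm

/-- The grid is obtained from the grid with one row less by adding a row. -/
theorem gridFam_rowExt [Fintype B] (hq0 : 0 < q) (hq1 : q < 1) (hpos : Function.Injective pos)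
    {m N : ℕ} (hw : ∀ d < k m, ∃ b, pos b = (m, d))
    (hw' : ∀ b, (pos b).1 < m ∨ (pos b).1 = m ∧ (pos b).2 < k m) (hkN : k m ≤ N) :
    RowExt q N m (k m) (phase (φ m)) (gridFam q pos (grayPhase k φ) (m + 1))
      (gridFam q (fun b : {b // (pos b).1 < m} => pos b.1) (grayPhase k φ) m)
      (vacEmb fun b => (pos b).1 < m) := by
  set θ := grayPhase k φ with hθ
  set J := vacEmb fun b => (pos b).1 < m with hJ
  set pos' := fun b : {b // (pos b).1 < m} => pos b.1 with hpos'
  have hQ : (q : ℂ) ≠ 0 := by exact_mod_cast hq0.ne'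
  -- the boxes in the last row
  have hgray : ∀ d, k m ≤ d → ∀ b, pos b ≠ (m, d) := by
    intro d hd b hb
    rcases hw' b with h | ⟨_, h⟩
    · rw [hb] at h; exact lt_irrefl _ h
    · rw [hb] at h; exact absurd h (not_lt.2 hd)
  have hD1 : ∀ d < k m, ∀ v, boxD q pos m d (J v) = J v := by
    intro d hd v
    obtain ⟨b, hb⟩ := hw d hd
    rw [boxD_of_eq hpos hb]
    exact opD_vacEmb_of_not _ hq0 hq1 (by rw [hb]; exact lt_irrefl _) v
  have hA0 : ∀ d < k m, ∀ v, star (boxA q pos θ m d) (J v) = 0 := by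
    intro d hd v
    obtain ⟨b, hb⟩ := hw d hd
    rw [boxA_of_eq hpos hb, star_T22 hq0]
    exact T11_vacEmb_of_not _ hq0 (by rw [hb]; exact lt_irrefl _) v
  have hD0 : ∀ d, k m ≤ d → boxD q pos m d = 0 := fun d hd => boxD_of_not (hgray d hd)
  have hAg : ∀ d, k m ≤ d → boxA q pos θ m d = θ m d • 1 := fun d hd => boxA_of_not (hgray d hd)
  have hθk : θ m (k m) = phase (φ m) := if_pos rfl
  have hθ1 : ∀ d, k m < d → θ m d = 1 := fun d hd => if_neg hd.ne'
  -- the rows above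
  have hup : ∀ d α v, gridFam q pos θ m d α (J v) = J (gridFam q pos' θ m d α v) := fun d α v =>
    gridPath_intertwine J (fun i hi d v => (boxA_vacEmb hq0 hpos hi d v).1)
      (fun i hi d v => (boxA_vacEmb hq0 hpos hi d v).2)
      (fun i hi d v => boxD_vacEmb hq0 hq1 hpos hi d v) d α v
  -- the paths through the white boxes of the last row
  have hr1 : ∀ d ≤ k m, ∀ v,
      rowPath q (boxA q pos θ m) (boxD q pos m) 0 1 d (J v) = J v := by
    intro d
    induction d with
    | zero => intro _ v; rfl
    | succ d ih =>
      intro hd v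
      rw [rowPath, sub_apply, clm_mul_apply, ih (by omega), hD1 d hd]
      simp
  have hr0 : ∀ d ≤ k m, ∀ α v, rowPath q (boxA q pos θ m) (boxD q pos m)
      (fun d => gridFam q pos θ m d α) 0 d (J v) = 0 := by
    intro d
    induction d with
    | zero => intro _ α v; rfl
    | succ d ih =>
      intro hd α v
      rw [rowPath, sub_apply, clm_mul_apply, ih (by omega), map_zero,
        smul_apply, clm_mul_apply, hup, hA0 d hd]
      simp
  refine ⟨(boxRel hq0 hq1 hpos (norm_grayPhase k φ)).qMatRel hQ (Complex.conj_ofReal q) N (m + 1),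
    hkN, ?_, ?_, ?_, ?_, ?_, ?_, ?_⟩
  · intro d hd v
    rw [gridFam_last, star_mul, clm_mul_apply, hA0 d hd, map_zero]
  · intro _ v
    rw [gridFam_last, clm_mul_apply, hr1 _ le_rfl, hAg _ le_rfl, hθk]
    rfl
  · intro d hd _ v
    obtain ⟨d, rfl⟩ : ∃ d', d = d' + 1 := ⟨d - 1, by omega⟩
    rw [gridFam_last, rowPath, hD0 d (by omega)]
    simp
  · intro d hd α hα v
    rw [gridFam_low hα, add_apply, clm_mul_apply, clm_mul_apply, hup,
      hr0 d hd.le, hD1 d hd, map_zero, add_zero]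
  · intro _ α hα v
    rw [gridFam_low hα, add_apply, clm_mul_apply, clm_mul_apply,
      hr0 _ le_rfl, hD0 _ le_rfl, map_zero, add_zero]
    rfl
  · intro d hd _ α hα v
    rw [gridFam_low hα, hD0 (d + 1) (by omega), hAg (d + 1) (by omega), hθ1 (d + 1) (by omega),
      rowPath, hD0 d hd, hAg d hd]
    have hc : star (θ m d) = if d = k m then conj (phase (φ m)) else 1 := by
      split_ifs with h
      · rw [h, hθk]; rfl
      · rw [hθ1 d (by omega), star_one]
    simp only [zero_mul, zero_add, zero_sub, one_smul, one_mul, star_smul, star_one, smul_mul_assoc,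
      neg_apply, smul_apply, hup, hc, smul_smul, neg_mul,
      neg_smul]
  · have h := eq_top_of_basisVec_mem (Submodule.isClosed_topologicalClosure
      (genSpan (fun d => toEnd _ (gridFam q pos θ (m + 1) d m)) (k m)
        (LinearMap.range J.toLinearMap))) fun v =>
      Submodule.le_topologicalClosure _ (basisVec_mem_genSpan hq0 hq1 hpos hw hw' _ (fun v hv => by
        obtain ⟨v', rfl⟩ := exists_vacExt (fun b => (pos b).1 < m) hv
        exact ⟨basisVec v', vacEmb_basisVec _ v'⟩) v)
    exact h

/-- The grid arises from a point by adding rows. -/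
theorem gridFam_iter (hq0 : 0 < q) (hq1 : q < 1) (m : ℕ) :
    ∀ (B : Type) [DecidableEq B] [Fintype B] (pos : B → ℕ × ℕ), Function.Injective pos →
      (∀ i < m, ∀ d < k i, ∃ b, pos b = (i, d)) →
      (∀ b, (pos b).1 < m ∧ (pos b).2 < k (pos b).1) → ∀ N, Adm k φ m N →
      Iter q k (fun j => phase (φ j)) m N (Ell2 B) (gridFam q pos (grayPhase k φ) m) := by
  induction m with
  | zero =>
    intro B _ _ pos _ _ hb N _
    have : IsEmpty B := ⟨fun b => absurd (hb b).1 (by omega)⟩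
    refine finrank_eq_one (basisVec 0) (basisVec_ne_zero 0) fun f => ⟨f 0, ?_⟩
    classical
    ext v
    rw [lp.coeFn_smul, Pi.smul_apply, basisVec_apply, if_pos (Subsingleton.elim _ _),
      Subsingleton.elim v 0]
    simp
  | succ m ih =>
    intro B _ _ pos hpos hw hb N hA
    refine Iter.succ (gridFam_rowExt hq0 hq1 hpos (hw m (by omega)) (fun b => ?_) hA.1)
      (ih _ _ (hpos.comp Subtype.val_injective) (fun i hi d hd => ?_) (fun b => ⟨b.2, (hb b.1).2⟩)
        _ hA.2.2.2)
    · obtain ⟨h1, h2⟩ := hb b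
      rcases Nat.lt_succ_iff_lt_or_eq.1 h1 with h | h
      · exact Or.inl h
      · exact Or.inr ⟨h, h ▸ h2⟩
    · obtain ⟨b, hb⟩ := hw i (by omega) d hd
      exact ⟨⟨b, by rw [hb]; exact hi⟩, hb⟩

end Model

/-! ### Diagonal operators in the Toeplitz algebra -/

section Diagonal

variable {B : Type}

theorem norm_diagOp_le {w : (B → ℕ) → ℂ} {K : ℝ} (hK : 0 ≤ K) (hw : ∀ m, ‖w m‖ ≤ K) :
    ‖diagOp w‖ ≤ K := by
  have h : diagOp w = lp.mapCLM 2 (fun m => w m • ContinuousLinearMap.id ℂ ℂ) hK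
      (fun m => by simpa [norm_smul] using hw m) := by
    ext f m
    rw [diagOp_apply w ⟨K, hw⟩]
    rfl
  rw [h]
  exact lp.norm_mapCLM_le _ _ _ _

variable [DecidableEq B]

/-- The projection to the states with `k` particles in a box, expressed by the shift. -/
def levelProj {A : Type*} [Ring A] [StarRing A] (s : A) (k : ℕ) : A :=
  s ^ k * star s ^ k - s ^ (k + 1) * star s ^ (k + 1)

theorem levelProj_mem {A : Type*} [Ring A] [StarRing A] [Algebra ℂ A] [StarModule ℂ A]
    {R : StarSubalgebra ℂ A} {s : A} (hs : s ∈ R) (k : ℕ) : levelProj s k ∈ R :=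
  sub_mem (mul_mem (pow_mem hs _) (pow_mem (star_mem hs) _))
    (mul_mem (pow_mem hs _) (pow_mem (star_mem hs) _))

theorem levelProj_of_unitary {A : Type*} [Ring A] [StarRing A] {s : A} (hs : s * star s = 1)
    (k : ℕ) : levelProj s k = 0 := by
  have h : ∀ k : ℕ, s ^ k * star s ^ k = 1 := by
    intro k
    induction k with
    | zero => simp
    | succ k ih =>
      rw [pow_succ, pow_succ', mul_assoc, ← mul_assoc s, hs, one_mul, ih]
  rw [levelProj, h, h, sub_self]

theorem shift_pow_mul_basisVec (b : B) (k : ℕ) (m : B → ℕ) :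
    (shift b ^ k * star (shift b) ^ k) (basisVec m) = if k ≤ m b then basisVec m else 0 := by
  induction k generalizing m with
  | zero => simp
  | succ k ih =>
    rw [pow_succ', pow_succ, star_shift] at *
    have : shift b * shift b ^ k * (backShift b ^ k * backShift b) =
      shift b * (shift b ^ k * backShift b ^ k) * (backShift b : Ell2 B →L[ℂ] Ell2 B) := by
      simp only [mul_assoc]
    rw [this, clm_mul_apply]
    rcases exists_eq_add_single b m with h | ⟨m, rfl⟩
    · rw [backShift_of_eq_zero h, map_zero, if_neg (by omega)]
    · rw [backShift_add, clm_mul_apply]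
      rw [ih m]
      simp only [Pi.add_apply, Pi.single_eq_same, add_le_add_iff_right]
      split_ifs
      · rw [shift_basisVec]
      · rw [map_zero]

theorem levelProj_basisVec (b : B) (k : ℕ) (m : B → ℕ) :
    levelProj (shift b) k (basisVec m) = if m b = k then basisVec m else 0 := by
  rw [levelProj, sub_apply, shift_pow_mul_basisVec, shift_pow_mul_basisVec]
  split_ifs
  any_goals omega
  all_goals simp

/-- Diagonal operators whose entries tend to zero are limits of combinations of the projections to
the levels of a box. -/
theorem tendsto_levelProj {w : ℕ → ℂ} (hw : Filter.Tendsto w Filter.atTop (nhds 0)) (b : B) :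
    Filter.Tendsto (fun K => ∑ k ∈ Finset.range K, w k • levelProj (shift b) k) Filter.atTop
      (nhds (diagOp fun m : B → ℕ => w (m b))) := by
  have hb : ∃ C, ∀ k, ‖w k‖ ≤ C := by
    obtain ⟨C, hC⟩ := hw.norm.bddAbove_range
    exact ⟨C, fun k => hC ⟨k, rfl⟩⟩
  obtain ⟨C, hC⟩ := hb
  rw [Metric.tendsto_atTop]
  intro ε hε
  obtain ⟨K₀, hK₀⟩ := (Metric.tendsto_atTop.1 hw) (ε / 2) (by linarith)
  refine ⟨K₀, fun K hK => ?_⟩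
  have e : (diagOp fun m : B → ℕ => w (m b)) -
      ∑ k ∈ Finset.range K, w k • levelProj (shift b) k =
      diagOp fun m : B → ℕ => if K ≤ m b then w (m b) else 0 := by
    refine clm_ext_basisVec fun m => ?_
    have hC' : ∃ C : ℝ, ∀ m : B → ℕ, ‖if K ≤ m b then w (m b) else 0‖ ≤ C := by
      refine ⟨C, fun m => ?_⟩
      split_ifs
      · exact hC _
      · rw [norm_zero]; exact (norm_nonneg _).trans (hC 0)
    rw [sub_apply, diagOp_basisVec ⟨C, fun m => hC _⟩, diagOp_basisVec hC',
      sum_apply]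
    simp only [smul_apply, levelProj_basisVec, smul_ite, smul_zero,
      Finset.sum_ite_eq, Finset.mem_range]
    split_ifs
    any_goals omega
    all_goals simp
  rw [dist_eq_norm, norm_sub_rev, e]
  refine lt_of_le_of_lt (norm_diagOp_le (K := ε / 2) (by linarith) fun m => ?_) (by linarith)
  split_ifs with h
  · have := hK₀ (m b) (by omega)
    rw [dist_zero_right] at this
    exact this.le
  · rw [norm_zero]; linarith

variable {q : ℝ}

theorem tendsto_pow_zero (hq0 : 0 < q) (hq1 : q < 1) :
    Filter.Tendsto (fun k : ℕ => ((q ^ k : ℝ) : ℂ)) Filter.atTop (nhds 0) := by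
  have := (Complex.continuous_ofReal.tendsto 0).comp
    (tendsto_pow_atTop_nhds_zero_of_lt_one hq0.le hq1)
  simpa [Function.comp_def] using this

theorem tendsto_sqrt_sub_one (hq0 : 0 < q) (hq1 : q < 1) :
    Filter.Tendsto (fun k : ℕ => ((Real.sqrt (1 - q ^ (2 * k)) : ℝ) : ℂ) - 1) Filter.atTop
      (nhds 0) := by
  have h1 : Filter.Tendsto (fun k : ℕ => (q ^ 2) ^ k) Filter.atTop (nhds 0) :=
    tendsto_pow_atTop_nhds_zero_of_lt_one (by positivity) (by nlinarith)
  have h2 : Continuous fun x : ℝ => ((Real.sqrt (1 - x) : ℝ) : ℂ) - 1 := by fun_prop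
  have := (h2.tendsto 0).comp h1
  simpa [Function.comp_def, pow_mul] using this

theorem opC_eq (hq0 : 0 < q) (b : B) : opC q b =
    diagOp (fun m : B → ℕ => ((Real.sqrt (1 - q ^ (2 * m b)) : ℝ) : ℂ) - 1) + 1 := by
  have hb : ∃ K : ℝ, ∀ m : B → ℕ, ‖((Real.sqrt (1 - q ^ (2 * m b)) : ℝ) : ℂ) - 1‖ ≤ K := by
    obtain ⟨K, hK⟩ := bounded_sqrt hq0 b
    exact ⟨K + 1, fun m => (norm_sub_le _ _).trans (by rw [norm_one]; linarith [hK m])⟩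
  refine clm_ext_basisVec fun m => ?_
  rw [opC_basisVec hq0, add_apply, diagOp_basisVec hb, clm_one_apply]
  module

theorem shift_mem_toeplitz (b : B) : shift b ∈ Toeplitz B := (toeplitzGen b).2

theorem diagOp_mem_toeplitz {w : ℕ → ℂ} (hw : Filter.Tendsto w Filter.atTop (nhds 0)) (b : B) :
    (diagOp fun m : B → ℕ => w (m b)) ∈ Toeplitz B := by
  have hc : IsClosed ((Toeplitz B : StarSubalgebra ℂ _) : Set (Ell2 B →L[ℂ] Ell2 B)) :=
    StarSubalgebra.isClosed_topologicalClosure _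
  refine hc.mem_of_tendsto (tendsto_levelProj hw b) (Filter.Eventually.of_forall fun K => ?_)
  exact sum_mem fun k _ => SMulMemClass.smul_mem _ (levelProj_mem (shift_mem_toeplitz b) k)

theorem opD_mem_toeplitz (hq0 : 0 < q) (hq1 : q < 1) (b : B) : opD q b ∈ Toeplitz B :=
  diagOp_mem_toeplitz (tendsto_pow_zero hq0 hq1) b

theorem opC_mem_toeplitz (hq0 : 0 < q) (hq1 : q < 1) (b : B) : opC q b ∈ Toeplitz B := by
  rw [opC_eq hq0]
  exact add_mem (diagOp_mem_toeplitz (tendsto_sqrt_sub_one hq0 hq1) b) (one_mem _)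

theorem T22_mem_toeplitz (hq0 : 0 < q) (hq1 : q < 1) (b : B) : T22 q b ∈ Toeplitz B :=
  mul_mem (opC_mem_toeplitz hq0 hq1 b) (shift_mem_toeplitz b)

end Diagonal

/-! ### Values of homomorphisms on the Toeplitz algebra -/

section CharacterMap

variable {B : Type} [DecidableEq B] {H : Type*} [NormedAddCommGroup H] [InnerProductSpace ℂ H]
  [CompleteSpace H]

instance : IsClosed ((Toeplitz B : StarSubalgebra ℂ _) : Set (Ell2 B →L[ℂ] Ell2 B)) :=
  StarSubalgebra.isClosed_topologicalClosure _

theorem continuous_toeplitz_hom (θ : Toeplitz B →⋆ₐ[ℂ] (H →L[ℂ] H)) : Continuous θ :=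
  AddMonoidHomClass.continuous_of_bound θ 1 fun x => by
    rw [one_mul]; exact NonUnitalStarAlgHom.norm_apply_le θ x

/-- A homomorphism on the Toeplitz algebra is determined by its values on the shifts. -/
theorem toeplitz_hom_ext {θ θ' : Toeplitz B →⋆ₐ[ℂ] (H →L[ℂ] H)}
    (h : ∀ b, θ (toeplitzGen b) = θ' (toeplitzGen b)) : θ = θ' := by
  refine StarAlgHom.ext_topologicalClosure (continuous_toeplitz_hom θ)
    (continuous_toeplitz_hom θ') ?_
  refine StarAlgHom.ext_adjoin ?_
  rintro ⟨_, _⟩ ⟨b, rfl⟩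
  exact h b

/-- The value of a character map on diagonal operators. -/
theorem tendsto_toeplitz_hom (θ : Toeplitz B →⋆ₐ[ℂ] (H →L[ℂ] H)) {w : ℕ → ℂ}
    (hw : Filter.Tendsto w Filter.atTop (nhds 0)) (b : B) :
    Filter.Tendsto (fun K => ∑ k ∈ Finset.range K, w k • levelProj (θ (toeplitzGen b)) k)
      Filter.atTop (nhds (θ ⟨_, diagOp_mem_toeplitz hw b⟩)) := by
  have h1 : Filter.Tendsto (fun K => ∑ k ∈ Finset.range K, w k • levelProj (toeplitzGen b) k)
      Filter.atTop (nhds (⟨_, diagOp_mem_toeplitz hw b⟩ : Toeplitz B)) := by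
    rw [tendsto_subtype_rng]
    refine (tendsto_levelProj hw b).congr fun K => ?_
    rw [AddSubmonoidClass.coe_finsetSum]
    rfl
  refine ((continuous_toeplitz_hom θ).tendsto _ |>.comp h1).congr fun K => ?_
  simp only [Function.comp, map_sum, map_smul, levelProj, map_sub, map_mul, map_pow, map_star]

variable {q : ℝ}

/-- If the image of the shift is unitary, then the images of the level projections vanish, and so
does that of `D_q`. -/
theorem toeplitz_hom_opD_of_unitary (hq0 : 0 < q) (hq1 : q < 1)
    {θ : Toeplitz B →⋆ₐ[ℂ] (H →L[ℂ] H)} {b : B}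
    (h : θ (toeplitzGen b) * star (θ (toeplitzGen b)) = 1) :
    θ ⟨_, opD_mem_toeplitz hq0 hq1 b⟩ = 0 := by
  have := tendsto_toeplitz_hom θ (tendsto_pow_zero hq0 hq1) b
  simp only [levelProj_of_unitary h, smul_zero, Finset.sum_const_zero] at this
  exact (tendsto_nhds_unique tendsto_const_nhds this).symm

theorem toeplitz_hom_opD_of_shift {B' : Type} [DecidableEq B'] (hq0 : 0 < q) (hq1 : q < 1)
    {θ : Toeplitz B →⋆ₐ[ℂ] (Ell2 B' →L[ℂ] Ell2 B')} {b : B} {b' : B'}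
    (h : θ (toeplitzGen b) = shift b') : θ ⟨_, opD_mem_toeplitz hq0 hq1 b⟩ = opD q b' := by
  have := tendsto_toeplitz_hom θ (tendsto_pow_zero hq0 hq1) b
  rw [h] at this
  exact tendsto_nhds_unique this (tendsto_levelProj (tendsto_pow_zero hq0 hq1) b')

theorem toeplitz_opC_eq (hq0 : 0 < q) (hq1 : q < 1) (b : B) :
    (⟨_, opC_mem_toeplitz hq0 hq1 b⟩ : Toeplitz B) =
      ⟨_, diagOp_mem_toeplitz (tendsto_sqrt_sub_one hq0 hq1) b⟩ + 1 :=
  Subtype.ext (opC_eq hq0 b)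

theorem toeplitz_T22_eq (hq0 : 0 < q) (hq1 : q < 1) (b : B) :
    (⟨_, T22_mem_toeplitz hq0 hq1 b⟩ : Toeplitz B) =
      ⟨_, opC_mem_toeplitz hq0 hq1 b⟩ * toeplitzGen b := rfl

/-- If the image of the shift is unitary, then it is also the image of `T₂₂`. -/
theorem toeplitz_hom_T22_of_unitary (hq0 : 0 < q) (hq1 : q < 1)
    {θ : Toeplitz B →⋆ₐ[ℂ] (H →L[ℂ] H)} {b : B}
    (h : θ (toeplitzGen b) * star (θ (toeplitzGen b)) = 1) :
    θ ⟨_, T22_mem_toeplitz hq0 hq1 b⟩ = θ (toeplitzGen b) := by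
  have := tendsto_toeplitz_hom θ (tendsto_sqrt_sub_one hq0 hq1) b
  simp only [levelProj_of_unitary h, smul_zero, Finset.sum_const_zero] at this
  rw [toeplitz_T22_eq hq0 hq1, map_mul, toeplitz_opC_eq hq0 hq1, map_add,
    ← tendsto_nhds_unique tendsto_const_nhds this, map_one, zero_add, one_mul]

theorem toeplitz_hom_T22_of_shift {B' : Type} [DecidableEq B'] (hq0 : 0 < q) (hq1 : q < 1)
    {θ : Toeplitz B →⋆ₐ[ℂ] (Ell2 B' →L[ℂ] Ell2 B')} {b : B} {b' : B'}
    (h : θ (toeplitzGen b) = shift b') : θ ⟨_, T22_mem_toeplitz hq0 hq1 b⟩ = T22 q b' := by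
  have := tendsto_toeplitz_hom θ (tendsto_sqrt_sub_one hq0 hq1) b
  rw [h] at this
  rw [toeplitz_T22_eq hq0 hq1, map_mul, toeplitz_opC_eq hq0 hq1, map_add, map_one, h,
    tendsto_nhds_unique this (tendsto_levelProj (tendsto_sqrt_sub_one hq0 hq1) b'), ← opC_eq hq0]
  rfl

end CharacterMap

/-! ### Asymptotic compressions -/

section AsymptoticCompression

variable {H H' : Type*} [NormedAddCommGroup H] [InnerProductSpace ℂ H] [CompleteSpace H]
  [NormedAddCommGroup H'] [InnerProductSpace ℂ H'] [CompleteSpace H'] {W : ℕ → H' →L[ℂ] H}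

/-- The isometries `W N` intertwine `y` and `x` in the limit `N → ∞`. -/
def AsympIntertwine (W : ℕ → H' →L[ℂ] H) (x : H →L[ℂ] H) (y : H' →L[ℂ] H') : Prop :=
  Filter.Tendsto (fun N => x ∘L W N - W N ∘L y) Filter.atTop (nhds 0)

theorem AsympIntertwine.add {x x' : H →L[ℂ] H} {y y' : H' →L[ℂ] H'} (h : AsympIntertwine W x y)
    (h' : AsympIntertwine W x' y') : AsympIntertwine W (x + x') (y + y') := by
  have := Filter.Tendsto.add h h'
  rw [add_zero] at this
  refine this.congr fun N => ?_
  ext v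
  simp only [add_apply, sub_apply,
    ContinuousLinearMap.comp_apply, map_add]
  abel

theorem AsympIntertwine.mul {x x' : H →L[ℂ] H} {y y' : H' →L[ℂ] H'} (h : AsympIntertwine W x y)
    (h' : AsympIntertwine W x' y') : AsympIntertwine W (x * x') (y * y') := by
  have h1 := ((ContinuousLinearMap.compL ℂ H' H H x).continuous.tendsto 0).comp h'
  have h2 := (((ContinuousLinearMap.compL ℂ H' H' H).flip y').continuous.tendsto 0).comp h
  rw [map_zero] at h1 h2
  have := h1.add h2
  rw [add_zero] at this
  refine this.congr fun N => ?_
  ext v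
  simp [clm_mul_apply]

theorem AsympIntertwine.algebraMap (c : ℂ) :
    AsympIntertwine W (algebraMap ℂ (H →L[ℂ] H) c) (algebraMap ℂ (H' →L[ℂ] H') c) := by
  refine tendsto_const_nhds.congr fun N => ?_
  ext v
  simp [Algebra.algebraMap_eq_smul_one]

theorem AsympIntertwine.of_norm_le {x : H →L[ℂ] H} {y : H' →L[ℂ] H'} {ε : ℕ → ℝ}
    (hε : Filter.Tendsto ε Filter.atTop (nhds 0)) (hε0 : ∀ N, 0 ≤ ε N)
    (h : ∀ N v, ‖x (W N v) - W N (y v)‖ ≤ ε N * ‖v‖) : AsympIntertwine W x y :=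
  squeeze_zero_norm (fun N => ContinuousLinearMap.opNorm_le_bound _ (hε0 N) (h N)) hε

/-- The `C^*`-algebra of the pairs of operators which, together with their adjoints, are
intertwined in the limit. -/
def asympAlgebra (W : ℕ → H' →L[ℂ] H) :
    StarSubalgebra ℂ ((H →L[ℂ] H) × (H' →L[ℂ] H')) where
  carrier := {p | AsympIntertwine W p.1 p.2 ∧ AsympIntertwine W (star p.1) (star p.2)}
  mul_mem' {p p'} h h' := ⟨h.1.mul h'.1, by
    simpa only [Prod.fst_mul, Prod.snd_mul, star_mul] using h'.2.mul h.2⟩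
  add_mem' {p p'} h h' := ⟨h.1.add h'.1, by
    simpa only [Prod.fst_add, Prod.snd_add, star_add] using h.2.add h'.2⟩
  algebraMap_mem' c := ⟨AsympIntertwine.algebraMap c, by
    simpa only [Prod.algebraMap_apply, ← algebraMap_star_comm] using
      AsympIntertwine.algebraMap (W := W) (star c)⟩
  star_mem' {p} h := ⟨h.2, by simpa only [Prod.fst_star, Prod.snd_star, star_star] using h.1⟩

variable (hW : ∀ N v, ‖W N v‖ = ‖v‖)
include hW

/-- The first component of an intertwined pair determines the second one. -/
theorem AsympIntertwine.eq_zero {y : H' →L[ℂ] H'} (h : AsympIntertwine W 0 y) : y = 0 := by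
  ext v
  have h1 := (((ContinuousLinearMap.apply ℂ H v).continuous.tendsto 0).comp h).norm
  simp only [Function.comp_def, ContinuousLinearMap.apply_apply, sub_apply,
    ContinuousLinearMap.comp_apply, zero_apply, zero_sub, norm_neg, hW,
    norm_zero] at h1
  simpa using tendsto_nhds_unique tendsto_const_nhds h1

theorem isClosed_asympIntertwine :
    IsClosed {p : (H →L[ℂ] H) × (H' →L[ℂ] H') | AsympIntertwine W p.1 p.2} := by
  refine isClosed_of_closure_subset fun p hp => ?_
  refine Metric.tendsto_atTop.2 fun ε hε => ?_
  obtain ⟨p', hp', hd⟩ := Metric.mem_closure_iff.1 hp (ε / 3) (by linarith)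
  obtain ⟨N₀, hN₀⟩ := Metric.tendsto_atTop.1 hp' (ε / 3) (by linarith)
  refine ⟨N₀, fun N hN => ?_⟩
  have hN := hN₀ N hN
  have h1 : ‖W N‖ ≤ 1 :=
    ContinuousLinearMap.opNorm_le_bound _ zero_le_one fun v => by rw [hW, one_mul]
  rw [dist_zero_right] at hN ⊢
  rw [dist_eq_norm] at hd
  have hd1 := (norm_fst_le (p - p')).trans_lt hd
  have hd2 := (norm_snd_le (p - p')).trans_lt hd
  have e : p.1 ∘L W N - W N ∘L p.2 =
      (p'.1 ∘L W N - W N ∘L p'.2) + (p - p').1 ∘L W N - W N ∘L (p - p').2 := by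
    ext v
    simp
  rw [e]
  have e1 : ‖(p - p').1 ∘L W N‖ ≤ ‖(p - p').1‖ :=
    (ContinuousLinearMap.opNorm_comp_le _ _).trans (mul_le_of_le_one_right (norm_nonneg _) h1)
  have e2 : ‖W N ∘L (p - p').2‖ ≤ ‖(p - p').2‖ :=
    (ContinuousLinearMap.opNorm_comp_le _ _).trans (mul_le_of_le_one_left (norm_nonneg _) h1)
  have := norm_sub_le ((p'.1 ∘L W N - W N ∘L p'.2) + (p - p').1 ∘L W N) (W N ∘L (p - p').2)
  have := norm_add_le (p'.1 ∘L W N - W N ∘L p'.2) ((p - p').1 ∘L W N)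
  linarith

theorem isClosed_asympAlgebra : IsClosed (asympAlgebra W : Set ((H →L[ℂ] H) × (H' →L[ℂ] H'))) :=
  (isClosed_asympIntertwine hW).inter ((isClosed_asympIntertwine hW).preimage continuous_star)

/-- A `C^*`-algebra generated by operators that are intertwined, in the limit, by isometries with
further operators has a `*`-homomorphism that carries the former operators to the latter ones. -/
theorem exists_hom_of_asympIntertwine {ι : Type*} (x : ι → H →L[ℂ] H) (y : ι → H' →L[ℂ] H')
    (h : ∀ i, AsympIntertwine W (x i) (y i))
    (h' : ∀ i, AsympIntertwine W (star (x i)) (star (y i))) :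
    ∃ θ : (StarAlgebra.adjoin ℂ (Set.range x)).topologicalClosure →⋆ₐ[ℂ] (H' →L[ℂ] H'),
      ∀ i, ∀ hi, θ ⟨x i, hi⟩ = y i := by
  have : IsClosed (asympAlgebra W : Set ((H →L[ℂ] H) × (H' →L[ℂ] H'))) := isClosed_asympAlgebra hW
  let f : asympAlgebra W →⋆ₐ[ℂ] (H →L[ℂ] H) :=
    (StarAlgHom.fst ℂ _ _).comp (asympAlgebra W).subtype
  let g : asympAlgebra W →⋆ₐ[ℂ] (H' →L[ℂ] H') :=
    (StarAlgHom.snd ℂ _ _).comp (asympAlgebra W).subtype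
  have hf : Function.Injective f := by
    refine (injective_iff_map_eq_zero f).2 ?_
    rintro ⟨⟨a, b⟩, hp⟩ (h0 : a = 0)
    subst h0
    have : b = 0 := AsympIntertwine.eq_zero hW hp.1
    subst this
    rfl
  -- An injective homomorphism of `C^*`-algebras is isometric, so that its range is closed.
  have hiso : Isometry f := NonUnitalStarAlgHom.isometry f hf
  have hcl : IsClosed (f.range : Set (H →L[ℂ] H)) := by
    have : (f.range : Set (H →L[ℂ] H)) = Set.range f := rfl
    rw [this]
    exact hiso.isClosedEmbedding.isClosed_range
  have hle : (StarAlgebra.adjoin ℂ (Set.range x)).topologicalClosure ≤ f.range := by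
    refine StarSubalgebra.topologicalClosure_minimal (StarAlgebra.adjoin_le ?_) hcl
    rintro _ ⟨i, rfl⟩
    exact ⟨⟨(x i, y i), h i, h' i⟩, rfl⟩
  let e := StarAlgEquiv.ofInjective f hf
  refine ⟨(g.comp (e.symm : f.range →⋆ₐ[ℂ] asympAlgebra W)).comp (StarSubalgebra.inclusion hle),
    fun i hi => ?_⟩
  have he : e.symm ⟨x i, hle hi⟩ = (⟨(x i, y i), h i, h' i⟩ : asympAlgebra W) :=
    e.symm_apply_apply (⟨(x i, y i), h i, h' i⟩ : asympAlgebra W)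
  change g (e.symm ⟨x i, hle hi⟩) = y i
  rw [he]
  rfl

end AsymptoticCompression

/-! ### Wave packets of an isometry -/

section Packet

variable {H : Type*} [NormedAddCommGroup H] [InnerProductSpace ℂ H] [CompleteSpace H]

/-- The normalized sum of the first `N + 1` powers of an isometry `T`. It carries a vector that is
orthogonal to the range of `T` to a unit multiple which is almost an eigenvector of `T`. -/
def packet (T : H →L[ℂ] H) (N : ℕ) : H →L[ℂ] H :=
  (((Real.sqrt (N + 1))⁻¹ : ℝ) : ℂ) • ∑ j ∈ Finset.range (N + 1), T ^ j

theorem commute_packet {X T : H →L[ℂ] H} (h : Commute X T) (N : ℕ) : Commute X (packet T N) :=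
  Commute.smul_right (Commute.sum_right _ _ _ fun j _ => h.pow_right j) _

variable {T : H →L[ℂ] H} (hT : star T * T = 1)
include hT

/-- The vectors `T ^ j v` are orthogonal to each other if `v` is orthogonal to the range of `T`. -/
theorem norm_sum_pow_sq {v : H} (hv : star T v = 0) (N : ℕ) :
    ‖(∑ j ∈ Finset.range N, T ^ j) v‖ ^ 2 = N * ‖v‖ ^ 2 := by
  induction N with
  | zero => simp
  | succ N ih =>
    have e : (∑ j ∈ Finset.range (N + 1), T ^ j) v = v + T ((∑ j ∈ Finset.range N, T ^ j) v) := by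
      rw [Finset.sum_range_succ', ← clm_mul_apply, Finset.mul_sum, add_comm]
      simp only [pow_succ', pow_zero, add_apply, clm_one_apply]
    set w := (∑ j ∈ Finset.range N, T ^ j) v
    have h0 : ⟪v, T w⟫_ℂ = 0 := by
      rw [← inner_star_left, hv, inner_zero_left]
    have hw : ‖T w‖ ^ 2 = ‖w‖ ^ 2 := by
      have : ⟪T w, T w⟫_ℂ = ⟪w, w⟫_ℂ := by
        rw [← inner_star_right, ← clm_mul_apply, hT, clm_one_apply]
      rw [inner_self_eq_norm_sq_to_K, inner_self_eq_norm_sq_to_K] at this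
      exact_mod_cast this
    rw [e, @norm_add_sq ℂ, h0, hw, ih]
    push_cast
    simp
    ring

theorem norm_packet {v : H} (hv : star T v = 0) (N : ℕ) : ‖packet T N v‖ = ‖v‖ := by
  have h := norm_sum_pow_sq hT hv (N + 1)
  have hs : 0 < Real.sqrt (N + 1) := Real.sqrt_pos.2 (by positivity)
  rw [packet, smul_apply, norm_smul, Complex.norm_real, Real.norm_eq_abs,
    abs_of_pos (inv_pos.2 hs), inv_mul_eq_iff_eq_mul₀ hs.ne',
    ← sq_eq_sq₀ (norm_nonneg _) (by positivity), h, mul_pow, Real.sq_sqrt (by positivity)]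
  push_cast
  ring

theorem norm_pow_apply (j : ℕ) (v : H) : ‖(T ^ j) v‖ = ‖v‖ := by
  induction j with
  | zero => simp
  | succ j ih =>
    rw [pow_succ', clm_mul_apply, ← ih, ← sq_eq_sq₀ (norm_nonneg _) (norm_nonneg _)]
    have : ⟪T ((T ^ j) v), T ((T ^ j) v)⟫_ℂ = ⟪(T ^ j) v, (T ^ j) v⟫_ℂ := by
      rw [← inner_star_right, ← clm_mul_apply, hT, clm_one_apply]
    rw [inner_self_eq_norm_sq_to_K, inner_self_eq_norm_sq_to_K] at this
    exact_mod_cast this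

theorem norm_apply_packet_sub (v : H) (N : ℕ) :
    ‖T (packet T N v) - packet T N v‖ ≤ 2 * (Real.sqrt (N + 1))⁻¹ * ‖v‖ := by
  have e : T (packet T N v) - packet T N v =
      (((Real.sqrt (N + 1))⁻¹ : ℝ) : ℂ) • ((T ^ (N + 1)) v - v) := by
    rw [packet, smul_apply, map_smul, ← smul_sub, ← clm_mul_apply]
    congr 1
    have := congrArg (fun S : H →L[ℂ] H => S v) (mul_geom_sum T (N + 1))
    simpa [sub_mul] using this
  have := norm_sub_le ((T ^ (N + 1)) v) v
  rw [norm_pow_apply hT] at this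
  rw [e, norm_smul, Complex.norm_real, Real.norm_eq_abs, abs_of_nonneg (by positivity)]
  nlinarith [inv_nonneg.2 (Real.sqrt_nonneg ((N : ℝ) + 1))]

theorem norm_star_packet_sub {v : H} (hv : star T v = 0) (N : ℕ) :
    ‖star T (packet T N v) - packet T N v‖ ≤ 2 * (Real.sqrt (N + 1))⁻¹ * ‖v‖ := by
  have e : star T (packet T N v) - packet T N v =
      (((Real.sqrt (N + 1))⁻¹ : ℝ) : ℂ) • (-(T ^ N) v) := by
    rw [packet, smul_apply, map_smul, ← smul_sub, ← clm_mul_apply]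
    congr 1
    have e1 : star T * (∑ j ∈ Finset.range (N + 1), T ^ j) =
        star T + ∑ j ∈ Finset.range N, T ^ j := by
      rw [Finset.sum_range_succ', mul_add, pow_zero, mul_one, Finset.mul_sum, add_comm]
      simp only [pow_succ', ← mul_assoc, hT, one_mul]
    rw [e1, Finset.sum_range_succ]
    simp only [add_apply, hv]
    abel
  rw [e, norm_smul, Complex.norm_real, Real.norm_eq_abs, abs_of_nonneg (by positivity), norm_neg,
    norm_pow_apply hT]
  nlinarith [inv_nonneg.2 (Real.sqrt_nonneg ((N : ℝ) + 1)), norm_nonneg v,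
    mul_nonneg (inv_nonneg.2 (Real.sqrt_nonneg ((N : ℝ) + 1))) (norm_nonneg v)]

end Packet

/-! ### Existence of the character maps -/

section Wave

variable {B : Type} [DecidableEq B] (p : B → Prop) [DecidablePred p] (u : B → ℂ)

/-- The embedding of the states of the boxes in `p` into the states of all boxes that is obtained
from the vacuum by wave packets of width `N + 1` in the boxes of the list. -/
def wave (N : ℕ) : List B → (Ell2 {b // p b} →L[ℂ] Ell2 B)
  | [] => (vacEmb p).toContinuousLinearMap
  | g :: L => packet (conj (u g) • shift g) N ∘L wave N L

theorem wave_cons (N : ℕ) (g : B) (L : List B) (v : Ell2 {b // p b}) :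
    wave p u N (g :: L) v = packet (conj (u g) • shift g) N (wave p u N L v) := rfl

theorem shift_vacEmb (b : {b // p b}) (v : Ell2 {b // p b}) :
    shift b.1 (vacEmb p v) = vacEmb p (shift b v) :=
  eq_of_vacEmb_basisVec p (fun m => by
    rw [shift_basisVec, shift_basisVec, vacEmb_basisVec, vacExt_add_single]) v

theorem backShift_vacEmb (b : {b // p b}) (v : Ell2 {b // p b}) :
    backShift b.1 (vacEmb p v) = vacEmb p (backShift b v) :=
  eq_of_vacEmb_basisVec p (fun m => by
    rcases exists_eq_add_single b m with h | ⟨m, rfl⟩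
    · rw [backShift_of_eq_zero h, backShift_of_eq_zero (by rw [vacExt_coe, h]), map_zero]
    · rw [backShift_add, vacExt_add_single, backShift_add, vacEmb_basisVec]) v

theorem backShift_vacEmb_of_not {b : B} (hb : ¬ p b) (v : Ell2 {b // p b}) :
    backShift b (vacEmb p v) = 0 := by
  have := eq_of_vacEmb_basisVec p (S := backShift b) (S' := 0) (fun m => by
    rw [backShift_of_eq_zero (vacExt_of_not p m hb)]; simp) v
  simpa using this

variable {p u}

theorem backShift_packet {b g : B} (h : b ≠ g) (c : ℂ) (N : ℕ) (v : Ell2 B) :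
    backShift b (packet (c • shift g) N v) = packet (c • shift g) N (backShift b v) := by
  rw [← clm_mul_apply, ← clm_mul_apply,
    (commute_packet ((commute_shift_backShift h.symm).symm.smul_right c) N).eq]

theorem shift_packet (b g : B) (c : ℂ) (N : ℕ) (v : Ell2 B) :
    shift b (packet (c • shift g) N v) = packet (c • shift g) N (shift b v) := by
  rw [← clm_mul_apply, ← clm_mul_apply,
    (commute_packet ((commute_shift_shift b g).smul_right c) N).eq]

theorem backShift_wave_of_not_mem {b : B} (hb : ¬ p b) {L : List B} (hL : b ∉ L) (N : ℕ)
    (v : Ell2 {b // p b}) : backShift b (wave p u N L v) = 0 := by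
  induction L with
  | nil => exact backShift_vacEmb_of_not p hb v
  | cons g L ih =>
    rw [List.mem_cons, not_or] at hL
    rw [wave_cons, backShift_packet hL.1, ih hL.2, map_zero]

theorem shift_wave (b : {b // p b}) (L : List B) (N : ℕ) (v : Ell2 {b // p b}) :
    shift b.1 (wave p u N L v) = wave p u N L (shift b v) := by
  induction L with
  | nil => exact shift_vacEmb p b v
  | cons g L ih => rw [wave_cons, shift_packet, ih, wave_cons]

theorem backShift_wave (b : {b // p b}) {L : List B} (hL : b.1 ∉ L) (N : ℕ)
    (v : Ell2 {b // p b}) : backShift b.1 (wave p u N L v) = wave p u N L (backShift b v) := by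
  induction L with
  | nil => exact backShift_vacEmb p b v
  | cons g L ih =>
    rw [List.mem_cons, not_or] at hL
    rw [wave_cons, backShift_packet hL.1, ih hL.2, wave_cons]

theorem backShift_mul_shift (b : B) : (backShift b : Ell2 B →L[ℂ] Ell2 B) * shift b = 1 :=
  clm_ext_basisVec fun m => by rw [clm_mul_apply, shift_basisVec, backShift_add, clm_one_apply]

variable (hu : ∀ b, ‖u b‖ = 1)
include hu

theorem conj_mul_self_of_norm_one (b : B) : conj (u b) * u b = 1 := by
  rw [Complex.conj_mul', hu]; simp

theorem star_mul_smul_shift (b : B) :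
    star (conj (u b) • (shift b : Ell2 B →L[ℂ] Ell2 B)) * (conj (u b) • shift b) = 1 := by
  rw [star_smul, star_shift, smul_mul_smul_comm, backShift_mul_shift, starRingEnd_apply,
    star_star, mul_comm, ← starRingEnd_apply, conj_mul_self_of_norm_one hu, one_smul]

theorem star_smul_shift_eq_zero {b : B} {v : Ell2 B} (hv : backShift b v = 0) :
    star (conj (u b) • (shift b : Ell2 B →L[ℂ] Ell2 B)) v = 0 := by
  rw [star_smul, star_shift, smul_apply, hv, smul_zero]

theorem norm_wave {L : List B} (hL : L.Nodup) (hp : ∀ g ∈ L, ¬ p g) (N : ℕ)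
    (v : Ell2 {b // p b}) : ‖wave p u N L v‖ = ‖v‖ := by
  induction L with
  | nil => exact (vacEmb p).norm_map v
  | cons g L ih =>
    rw [List.nodup_cons] at hL
    rw [wave_cons, norm_packet (star_mul_smul_shift hu g) (star_smul_shift_eq_zero hu
      (backShift_wave_of_not_mem (hp g (by simp)) hL.1 N v)),
      ih hL.2 fun g hg => hp g (by simp [hg])]

/-- A wave packet in the box `b` is almost an eigenvector of the shift and its adjoint. -/
theorem norm_shift_wave_sub {L : List B} (hL : L.Nodup) (hp : ∀ g ∈ L, ¬ p g) {b : B}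
    (hb : b ∈ L) (N : ℕ) (v : Ell2 {b // p b}) :
    ‖shift b (wave p u N L v) - u b • wave p u N L v‖ ≤ 2 * (Real.sqrt (N + 1))⁻¹ * ‖v‖ ∧
      ‖backShift b (wave p u N L v) - conj (u b) • wave p u N L v‖ ≤
        2 * (Real.sqrt (N + 1))⁻¹ * ‖v‖ := by
  induction L with
  | nil => simp at hb
  | cons g L ih =>
    rw [List.nodup_cons] at hL
    have hp' : ∀ g ∈ L, ¬ p g := fun g hg => hp g (by simp [hg])
    have h0 := backShift_wave_of_not_mem (u := u) (hp g (by simp)) hL.1 N v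
    by_cases hbg : b = g
    · subst hbg
      have hc := conj_mul_self_of_norm_one hu b
      have h1 := norm_apply_packet_sub (star_mul_smul_shift hu b) (wave p u N L v) N
      have h2 := norm_star_packet_sub (star_mul_smul_shift hu b) (star_smul_shift_eq_zero hu h0) N
      rw [norm_wave hu hL.2 hp'] at h1 h2
      rw [wave_cons]
      set w := packet (conj (u b) • shift b) N (wave p u N L v)
      constructor
      · refine le_trans (le_of_eq ?_) h1
        have e : shift b w - u b • w = u b • ((conj (u b) • shift b : Ell2 B →L[ℂ] Ell2 B) w - w) := by
          rw [smul_apply, smul_sub, smul_smul, mul_comm, hc, one_smul]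
        rw [e, norm_smul, hu, one_mul]
      · refine le_trans (le_of_eq ?_) h2
        have e : backShift b w - conj (u b) • w =
            conj (u b) • (star (conj (u b) • shift b : Ell2 B →L[ℂ] Ell2 B) w - w) := by
          rw [star_smul, star_shift, smul_apply, smul_sub, smul_smul,
            starRingEnd_apply, star_star, ← starRingEnd_apply, hc, one_smul]
        rw [e, norm_smul, RCLike.norm_conj, hu, one_mul]
    · have hbL : b ∈ L := by simpa [hbg] using hb
      obtain ⟨h1, h2⟩ := ih hL.2 hp' hbL
      have key : ∀ w : Ell2 B, backShift g w = 0 →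
          ‖packet (conj (u g) • shift g) N w‖ = ‖w‖ := fun w hw =>
        norm_packet (star_mul_smul_shift hu g) (star_smul_shift_eq_zero hu hw) N
      rw [wave_cons, shift_packet, backShift_packet hbg, ← map_smul (packet _ N), ← map_sub,
        ← map_smul (packet _ N), ← map_sub, key, key]
      · exact ⟨h1, h2⟩
      · rw [map_sub, map_smul, h0, smul_zero, sub_zero, ← clm_mul_apply]
        have : Commute (backShift g : Ell2 B →L[ℂ] Ell2 B) (backShift b) := by
          rw [← star_shift, ← star_shift]
          exact (commute_shift_shift g b).star_star
        rw [this.eq, clm_mul_apply, h0, map_zero]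
      · rw [map_sub, map_smul, h0, smul_zero, sub_zero, ← clm_mul_apply,
          ← (commute_shift_backShift (Ne.intro hbg)).eq, clm_mul_apply, h0, map_zero]

/-- The character map for a set of white boxes and for phases of the other ones: the shifts of the
white boxes are kept, those of the gray boxes are replaced by their phases. -/
theorem exists_character_map [Fintype B] :
    ∃ θ : Toeplitz B →⋆ₐ[ℂ] (Ell2 {b // p b} →L[ℂ] Ell2 {b // p b}),
      (∀ b : {b // p b}, θ (toeplitzGen b.1) = shift b) ∧
      ∀ b, ¬ p b → θ (toeplitzGen b) = u b • 1 := by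
  let L : List B := (Finset.univ.filter fun b => ¬ p b).toList
  have hL : L.Nodup := Finset.nodup_toList _
  have hpL : ∀ b, b ∈ L ↔ ¬ p b := fun b => by simp [L]
  let y : B → (Ell2 {b // p b} →L[ℂ] Ell2 {b // p b}) := fun b =>
    if h : p b then shift ⟨b, h⟩ else u b • 1
  have hlim : Filter.Tendsto (fun N : ℕ => 2 * (Real.sqrt (N + 1))⁻¹) Filter.atTop (nhds 0) := by
    have h1 : Filter.Tendsto (fun N : ℕ => Real.sqrt ((N : ℝ) + 1)) Filter.atTop Filter.atTop :=
      Real.tendsto_sqrt_atTop.comp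
        (Filter.tendsto_atTop_add_const_right _ _ tendsto_natCast_atTop_atTop)
    simpa using (tendsto_inv_atTop_zero.comp h1).const_mul 2
  obtain ⟨θ, hθ⟩ := exists_hom_of_asympIntertwine (W := fun N => wave p u N L)
    (fun N v => norm_wave hu hL (fun b hb => (hpL b).1 hb) N v) (shift : B → Ell2 B →L[ℂ] Ell2 B) y
    (fun b => AsympIntertwine.of_norm_le hlim (fun N => by positivity) fun N v => by
      by_cases h : p b
      · simp only [y, dif_pos h]
        rw [shift_wave ⟨b, h⟩, sub_self, norm_zero]
        positivity
      · simp only [y, dif_neg h]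
        rw [smul_apply, clm_one_apply, map_smul]
        exact (norm_shift_wave_sub hu hL (fun b hb => (hpL b).1 hb) ((hpL b).2 h) N v).1)
    (fun b => AsympIntertwine.of_norm_le hlim (fun N => by positivity) fun N v => by
      by_cases h : p b
      · simp only [y, dif_pos h, star_shift]
        rw [backShift_wave ⟨b, h⟩ (fun hb => (hpL b).1 hb h), sub_self, norm_zero]
        positivity
      · simp only [y, dif_neg h, star_shift, star_smul, star_one]
        rw [smul_apply, clm_one_apply, map_smul]
        exact (norm_shift_wave_sub hu hL (fun b hb => (hpL b).1 hb) ((hpL b).2 h) N v).2)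
  refine ⟨θ, fun b => ?_, fun b hb => ?_⟩
  · exact (hθ b.1 (shift_mem_toeplitz b.1)).trans (dif_pos b.2)
  · exact (hθ b (shift_mem_toeplitz b)).trans (dif_neg hb)

end Wave

/-! ### Representations of the algebra as families of operators -/

section Coefficients

variable {n : ℕ} {A : Type*} [Ring A] [Algebra ℂ A]

/-- Summation with the coefficients `R`. -/
theorem sum_RCoeff (q : ℝ) (i j : Fin n) (g : Fin n → Fin n → A) :
    ∑ i', ∑ j', ((RCoeff q j i j' i' : ℝ) : ℂ) • g i' j' =
      if i = j then g i i - ((q : ℂ)⁻¹ ^ 2 - 1) • ∑ c ∈ Finset.Ioi i, g c c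
      else (q : ℂ)⁻¹ • g i j := by
  split_ifs with h
  · subst h
    have h1 : ∀ i' j' : Fin n, ((RCoeff q i i j' i' : ℝ) : ℂ) • g i' j' =
        if j' = i' then (if i' = i then g i i else 0) +
          (if i < i' then -(((q : ℂ)⁻¹ ^ 2 - 1) • g i' i') else 0) else 0 := by
      intro i' j'
      unfold RCoeff
      rcases lt_trichotomy i i' with hi | rfl | hi
      · by_cases hj : j' = i'
        · subst hj; simp [hi, hi.ne, hi.ne']; module
        · simp [hj, hi.ne, hi.ne']
      · by_cases hj : j' = i
        · subst hj; simp
        · simp [hj, Ne.symm hj]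
      · by_cases hj : j' = i'
        · subst hj; simp [hi.not_gt, hi.ne, hi.ne']
        · simp [hj, hi.not_gt, hi.ne']
    simp only [h1, Finset.sum_ite_eq', Finset.mem_univ, if_true, Finset.sum_add_distrib]
    rw [← Finset.sum_filter, show Finset.univ.filter (fun c => i < c) = Finset.Ioi i by ext; simp,
      Finset.sum_neg_distrib, ← Finset.smul_sum]
    abel
  · have h1 : ∀ i' j' : Fin n, ((RCoeff q j i j' i' : ℝ) : ℂ) • g i' j' =
        if i' = i then (if j' = j then (q : ℂ)⁻¹ • g i j else 0) else 0 := by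
      intro i' j'
      unfold RCoeff
      by_cases hi : i' = i
      · subst hi
        by_cases hj : j' = j
        · subst hj; simp [Ne.symm h]
        · simp [hj, Ne.symm hj, Ne.symm h]
      · simp [hi, Ne.symm hi, Ne.symm h]
    simp [h1]

theorem sum_Ioi_eq (i : Fin n) (f : ℕ → A) :
    ∑ c ∈ Finset.Ioi i, f c = ∑ γ ∈ Finset.Ioo (i : ℕ) n, f γ := by
  refine Finset.sum_nbij (fun c => (c : ℕ)) ?_ (fun _ _ _ _ h => Fin.ext h) ?_ fun _ _ => rfl
  · intro c hc
    exact Finset.mem_Ioo.2 ⟨Fin.lt_def.1 (Finset.mem_Ioi.1 hc), c.2⟩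
  · intro γ hγ
    obtain ⟨h1, h2⟩ := Finset.mem_Ioo.1 (Finset.mem_coe.1 hγ)
    exact ⟨⟨γ, h2⟩, Finset.mem_coe.2 (Finset.mem_Ioi.2 h1), rfl⟩

/-- Larger lower indices belong to columns that are closer to the right side. -/
theorem sum_Ioi_rev (i : Fin n) (f : ℕ → A) :
    ∑ c ∈ Finset.Ioi i, f (Fin.rev c) = ∑ d ∈ Finset.range (Fin.rev i), f d := by
  refine Finset.sum_nbij (fun c => (Fin.rev c : ℕ)) ?_
    (fun _ _ _ _ h => Fin.rev_injective (Fin.ext h)) ?_ fun _ _ => rfl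
  · intro c hc
    exact Finset.mem_range.2 (Fin.rev_lt_rev.2 (Finset.mem_Ioi.1 hc))
  · intro d hd
    have hd := Finset.mem_range.1 (Finset.mem_coe.1 hd)
    have hdn : d < n := hd.trans (Fin.rev i).2
    refine ⟨Fin.rev ⟨d, hdn⟩, Finset.mem_coe.2 (Finset.mem_Ioi.2 ?_), by simp⟩
    rw [← Fin.rev_lt_rev, Fin.rev_rev]
    exact hd

theorem sum_RCoeff_eq_rowMix {q : ℝ} (hq : q ≠ 0) (α β : Fin n) (f : ℕ → ℕ → A) :
    ∑ α' : Fin n, ∑ β' : Fin n, ((RCoeff q β α β' α' : ℝ) : ℂ) • f α' β' =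
      (q : ℂ)⁻¹ • rowMix q n α β f := by
  have hQ : (q : ℂ) ≠ 0 := by exact_mod_cast hq
  rw [sum_RCoeff q α β fun i j => f i j]
  by_cases h : α = β
  · subst h
    rw [if_pos rfl, rowMix, if_pos rfl, sum_Ioi_eq α fun c => f c c]
    match_scalars <;> field_simp
  · rw [if_neg h, rowMix, if_neg fun h' => h (Fin.ext h')]

/-- The right hand side of the mixed relation in terms of the distances `a.rev` of the columns from
the right side. -/
theorem mixed_sum {q : ℝ} (hq : q ≠ 0) (a b α β : Fin n) (z w : ℕ → ℕ → A) :
    ((q ^ 2 : ℝ) : ℂ) • (∑ a' : Fin n, ∑ b' : Fin n, ∑ α' : Fin n, ∑ β' : Fin n,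
        ((RCoeff q b a b' a' * RCoeff q β α β' α' : ℝ) : ℂ) • (z a'.rev α' * w b'.rev β')) =
      if a = b then (q : ℂ) • (rowMix q n α β fun i j => z a.rev i * w a.rev j) -
        ((q : ℂ)⁻¹ - q) • ∑ c ∈ Finset.range a.rev, (rowMix q n α β fun i j => z c i * w c j)
      else rowMix q n α β fun i j => z a.rev i * w b.rev j := by
  have hQ : (q : ℂ) ≠ 0 := by exact_mod_cast hq
  have h1 : ∀ a' b' : Fin n, ∑ α' : Fin n, ∑ β' : Fin n,
      ((RCoeff q b a b' a' * RCoeff q β α β' α' : ℝ) : ℂ) • (z a'.rev α' * w b'.rev β') =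
      ((RCoeff q b a b' a' : ℝ) : ℂ) •
        ((q : ℂ)⁻¹ • rowMix q n α β fun i j => z a'.rev i * w b'.rev j) := by
    intro a' b'
    rw [← sum_RCoeff_eq_rowMix hq]
    simp only [Finset.smul_sum, smul_smul, Complex.ofReal_mul]
  simp only [h1]
  rw [sum_RCoeff q a b fun a' b' => (q : ℂ)⁻¹ • rowMix q n α β fun i j => z a'.rev i * w b'.rev j]
  push_cast
  split_ifs with h
  · rw [← Finset.smul_sum, sum_Ioi_rev a fun d => rowMix q n α β fun i j => z d i * w d j]
    match_scalars <;> field_simp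
  · match_scalars; field_simp

end Coefficients

section Families

variable {n : ℕ} {q : ℝ}

theorem pol_induction {P : Pol n q → Prop} (h0 : ∀ c, P (algebraMap ℂ _ c))
    (hz : ∀ a α, P (z q a α)) (hzs : ∀ a α, P (star (z q a α)))
    (hadd : ∀ x y, P x → P y → P (x + y)) (hmul : ∀ x y, P x → P y → P (x * y)) (x : Pol n q) :
    P x := by
  obtain ⟨x, rfl⟩ := polMk_surjective n q x
  induction x using FreeAlgebra.induction with
  | grade0 c => rw [AlgHom.commutes]; exact h0 c
  | grade1 g =>
    rcases g with ⟨a, α⟩ | ⟨a, α⟩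
    · exact hz a α
    · have := hzs a α
      rwa [star_z] at this
  | mul x y hx hy => rw [map_mul]; exact hmul _ _ hx hy
  | add x y hx hy => rw [map_add]; exact hadd _ _ hx hy

/-- The images of the generators under a homomorphism form a quantum matrix. -/
theorem qMatRel_pol (hq : q ≠ 0) {A : Type*} [Ring A] [Algebra ℂ A] (ρ : Pol n q →ₐ[ℂ] A)
    {Z W : ℕ → ℕ → A} (hZ : ∀ a α : Fin n, ρ (z q a α) = Z a.rev α)
    (hW : ∀ a α : Fin n, ρ (star (z q a α)) = W a.rev α) : QMatRel q n n Z W := by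
  have hZ' : ∀ a α : Fin n, ρ (polMk n q (fz a α)) = Z a.rev α := hZ
  have hW' : ∀ a α : Fin n, ρ (polMk n q (fzs a α)) = W a.rev α := fun a α => by
    rw [← star_z, hW]
  have hrev : ∀ d, d < n → ∃ a : Fin n, (a.rev : ℕ) = d := fun d hd =>
    ⟨Fin.rev ⟨d, hd⟩, by rw [Fin.rev_rev]⟩
  have hfin : ∀ d, d < n → ∃ a : Fin n, (a : ℕ) = d := fun d hd => ⟨⟨d, hd⟩, rfl⟩
  have hmix : ∀ a b α β : Fin n, W b.rev β * Z a.rev α =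
      (if a = b then (q : ℂ) • (rowMix q n α β fun i j => Z a.rev i * W a.rev j) -
        ((q : ℂ)⁻¹ - q) • ∑ c ∈ Finset.range a.rev, (rowMix q n α β fun i j => Z c i * W c j)
      else rowMix q n α β fun i j => Z a.rev i * W b.rev j) +
      ((if a = b ∧ α = β then 1 - q ^ 2 else 0 : ℝ) : ℂ) • (1 : A) := by
    intro a b α β
    have := congrArg ρ (polMk_rel (Rel.mixed (q := q) a b α β))
    simp only [map_mul, map_add, map_smul, map_sum, map_one, hZ', hW'] at this
    rw [this, mixed_sum hq]
  constructor
  · intro d hd α β hαβ hβ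
    obtain ⟨a, rfl⟩ := hrev d hd
    obtain ⟨β, rfl⟩ := hfin β hβ
    obtain ⟨α, rfl⟩ := hfin α (hαβ.trans hβ)
    have := congrArg ρ (polMk_rel (Rel.sameLower (q := q) a α β hαβ))
    simpa only [map_mul, map_smul, hZ'] using this
  · intro α hα e d hed hd
    obtain ⟨a, rfl⟩ := hrev d hd
    obtain ⟨b, rfl⟩ := hrev e (hed.trans hd)
    obtain ⟨α, rfl⟩ := hfin α hα
    have := congrArg ρ (polMk_rel (Rel.sameUpper (q := q) a b α (Fin.rev_lt_rev.1 hed)))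
    simpa only [map_mul, map_smul, hZ'] using this
  · intro d e hde he α β hαβ hβ
    obtain ⟨a, rfl⟩ := hrev d (hde.trans he)
    obtain ⟨b, rfl⟩ := hrev e he
    obtain ⟨β, rfl⟩ := hfin β hβ
    obtain ⟨α, rfl⟩ := hfin α (hαβ.trans hβ)
    have := congrArg ρ (polMk_rel (Rel.comm (q := q) a b α β hαβ (Fin.rev_lt_rev.1 hde)))
    simpa only [map_mul, hZ'] using this
  · intro e d hed hd α β hαβ hβ
    obtain ⟨a, rfl⟩ := hrev d hd
    obtain ⟨b, rfl⟩ := hrev e (hed.trans hd)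
    obtain ⟨β, rfl⟩ := hfin β hβ
    obtain ⟨α, rfl⟩ := hfin α (hαβ.trans hβ)
    have := congrArg ρ (polMk_rel (Rel.cross (q := q) a b α β hαβ (Fin.rev_lt_rev.1 hed)))
    simp only [map_mul, map_sub, map_smul, hZ'] at this
    rw [eq_add_of_sub_eq' this]
    push_cast
    rfl
  · intro d hd e he hde α hα β hβ
    obtain ⟨a, rfl⟩ := hrev d hd
    obtain ⟨b, rfl⟩ := hrev e he
    obtain ⟨β, rfl⟩ := hfin β hβ
    obtain ⟨α, rfl⟩ := hfin α hα
    have hab : a ≠ b := fun h => hde (by rw [h])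
    have := hmix a b α β
    rw [if_neg hab, if_neg fun h => hab h.1, Complex.ofReal_zero, zero_smul, add_zero] at this
    exact this
  · intro d hd α hα β hβ
    obtain ⟨a, rfl⟩ := hrev d hd
    obtain ⟨β, rfl⟩ := hfin β hβ
    obtain ⟨α, rfl⟩ := hfin α hα
    have := hmix a a α β
    rw [if_pos rfl] at this
    rw [this]
    by_cases h : α = β
    · subst h; simp
    · have h' : (α : ℕ) ≠ β := fun h' => h (Fin.ext h')
      simp [h, h']

variable {H : Type*} [NormedAddCommGroup H] [InnerProductSpace ℂ H] [CompleteSpace H]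
  {H₂ : Type*} [NormedAddCommGroup H₂] [InnerProductSpace ℂ H₂] [CompleteSpace H₂]

/-- The representation `ρ` maps the generators to the operators of the family `Z`, where the first
index of a family is the distance of the lower index from the largest one. -/
def HasFam (ρ : Pol n q →⋆ₐ[ℂ] (H →L[ℂ] H)) (Z : ℕ → ℕ → H →L[ℂ] H) : Prop :=
  ∀ a α : Fin n, ρ (z q a α) = Z a.rev α

theorem exists_hasFam (ρ : Pol n q →⋆ₐ[ℂ] (H →L[ℂ] H)) : ∃ Z, HasFam ρ Z :=
  ⟨fun d α => if h : d < n ∧ α < n then ρ (z q (Fin.rev ⟨d, h.1⟩) ⟨α, h.2⟩) else 0, fun a α => by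
    simp only [dif_pos (show (a.rev : ℕ) < n ∧ (α : ℕ) < n from ⟨a.rev.2, α.2⟩), Fin.eta,
      Fin.rev_rev]⟩

theorem HasFam.star {ρ : Pol n q →⋆ₐ[ℂ] (H →L[ℂ] H)} {Z : ℕ → ℕ → H →L[ℂ] H} (h : HasFam ρ Z)
    (a α : Fin n) : ρ (star (z q a α)) = star (Z a.rev α) := by rw [map_star, h]

theorem HasFam.isQMat (hq : q ≠ 0) {ρ : Pol n q →⋆ₐ[ℂ] (H →L[ℂ] H)} {Z : ℕ → ℕ → H →L[ℂ] H}
    (h : HasFam ρ Z) : IsQMat q n n Z :=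
  qMatRel_pol hq (ρ : Pol n q →ₐ[ℂ] (H →L[ℂ] H)) h h.star

/-- The image of a representation is contained in any `*`-algebra that contains the images of the
generators. -/
theorem rep_mem {A : Type*} [Ring A] [StarRing A] [Algebra ℂ A] [StarModule ℂ A]
    (S : StarSubalgebra ℂ A) (ρ : Pol n q →⋆ₐ[ℂ] A) (h : ∀ a α, ρ (z q a α) ∈ S) (x : Pol n q) :
    ρ x ∈ S := by
  induction x using pol_induction with
  | h0 c => rw [AlgHomClass.commutes ρ c]; exact algebraMap_mem S c
  | hz a α => exact h a α
  | hzs a α => rw [map_star]; exact star_mem (h a α)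
  | hadd x y hx hy => rw [map_add]; exact add_mem hx hy
  | hmul x y hx hy => rw [map_mul]; exact mul_mem hx hy

/-- A family that satisfies the relations together with its adjoints defines a representation. -/
theorem IsQMat.exists_rep (hq : q ≠ 0) {Z : ℕ → ℕ → H →L[ℂ] H} (h : IsQMat q n n Z) :
    ∃ ρ : Pol n q →⋆ₐ[ℂ] (H →L[ℂ] H), HasFam ρ Z := by
  let ℓ : Free n →ₐ[ℂ] (H →L[ℂ] H) := FreeAlgebra.lift ℂ
    (Sum.elim (fun p => Z p.1.rev p.2) fun p => Star.star (Z p.1.rev p.2))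
  have hfz : ∀ a α : Fin n, ℓ (fz a α) = Z a.rev α := fun a α => FreeAlgebra.lift_ι_apply _ _
  have hfzs : ∀ a α : Fin n, ℓ (fzs a α) = Star.star (Z a.rev α) := fun a α =>
    FreeAlgebra.lift_ι_apply _ _
  have hs : Star.star (q : ℂ) = q := Complex.conj_ofReal q
  have hrel : ∀ ⦃x y : Free n⦄, Rel n q x y → ℓ x = ℓ y := by
    intro x y hxy
    have row : ∀ a α β : Fin n, α < β →
        Z a.rev α * Z a.rev β = (q : ℂ) • (Z a.rev β * Z a.rev α) := fun a α β hαβ =>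
      h.row a.rev a.rev.2 α β hαβ β.2
    have col : ∀ a b α : Fin n, a < b →
        Z a.rev α * Z b.rev α = (q : ℂ) • (Z b.rev α * Z a.rev α) := fun a b α hab =>
      h.col α α.2 b.rev a.rev (Fin.rev_lt_rev.2 hab) a.rev.2
    have comm : ∀ a b α β : Fin n, α < β → b < a →
        Z a.rev α * Z b.rev β = Z b.rev β * Z a.rev α := fun a b α β hαβ hab =>
      h.comm a.rev b.rev (Fin.rev_lt_rev.2 hab) b.rev.2 α β hαβ β.2
    have cross : ∀ a b α β : Fin n, α < β → a < b →
        Z a.rev α * Z b.rev β - Z b.rev β * Z a.rev α =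
          ((q : ℂ) - (q : ℂ)⁻¹) • (Z a.rev β * Z b.rev α) := fun a b α β hαβ hab =>
      sub_eq_of_eq_add' (h.cross b.rev a.rev (Fin.rev_lt_rev.2 hab) a.rev.2 α β hαβ β.2)
    cases hxy with
    | sameLower a α β hαβ => simpa only [map_mul, map_smul, hfz] using row a α β hαβ
    | sameUpper a b α hab => simpa only [map_mul, map_smul, hfz] using col a b α hab
    | comm a b α β hαβ hab => simpa only [map_mul, hfz] using comm a b α β hαβ hab
    | cross a b α β hαβ hab =>
      simpa only [map_mul, map_sub, map_smul, hfz, Complex.ofReal_sub, Complex.ofReal_inv] using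
        cross a b α β hαβ hab
    | sameLowerStar a α β hαβ =>
      simpa only [map_mul, map_smul, hfzs, star_mul, star_smul, hs] using
        congrArg Star.star (row a α β hαβ)
    | sameUpperStar a b α hab =>
      simpa only [map_mul, map_smul, hfzs, star_mul, star_smul, hs] using
        congrArg Star.star (col a b α hab)
    | commStar a b α β hαβ hab =>
      simpa only [map_mul, hfzs, star_mul] using congrArg Star.star (comm a b α β hαβ hab)
    | crossStar a b α β hαβ hab =>
      simpa only [map_mul, map_sub, map_smul, hfzs, Complex.ofReal_sub, Complex.ofReal_inv,
        star_sub, star_mul, star_smul, star_inv₀, hs] using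
        congrArg Star.star (cross a b α β hαβ hab)
    | mixed a b α β =>
      simp only [map_mul, map_add, map_smul, map_sum, map_one, hfz, hfzs]
      rw [mixed_sum hq a b α β Z fun d α => Star.star (Z d α)]
      by_cases hab : a = b
      · subst hab
        rw [if_pos rfl, h.mixed_eq a.rev a.rev.2 α α.2 β β.2]
        by_cases hαβ : α = β
        · subst hαβ; simp
        · have h' : (α : ℕ) ≠ β := fun h' => hαβ (Fin.ext h')
          simp [hαβ, h']
      · rw [if_neg hab, if_neg fun h => hab h.1, Complex.ofReal_zero, zero_smul, add_zero]
        exact h.mixed_ne a.rev a.rev.2 b.rev b.rev.2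
          (fun h' => hab (Fin.rev_injective (Fin.ext h'))) α α.2 β β.2
  let ρ₀ : Pol n q →ₐ[ℂ] (H →L[ℂ] H) := RingQuot.liftAlgHom ℂ ⟨ℓ, hrel⟩
  have hρ : ∀ x, ρ₀ (polMk n q x) = ℓ x := fun x =>
    RingQuot.liftAlgHom_mkAlgHom_apply ℂ ℓ hrel x
  refine ⟨{ ρ₀ with map_star' := fun x => ?_ }, fun a α => (hρ _).trans (hfz a α)⟩
  change ρ₀ (Star.star x) = Star.star (ρ₀ x)
  induction x using pol_induction with
  | h0 c =>
    rw [← algebraMap_star_comm, AlgHom.commutes, AlgHom.commutes, algebraMap_star_comm]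
  | hz a α => rw [star_z, hρ, hfzs, z, hρ, hfz]
  | hzs a α => rw [star_star, star_z, hρ, hfzs, z, hρ, hfz, star_star]
  | hadd x y hx hy => rw [star_add, map_add, hx, hy, map_add, star_add]
  | hmul x y hx hy => rw [star_mul, map_mul, hx, hy, map_mul, star_mul]

theorem HasFam.isIrreducibleRep {ρ : Pol n q →⋆ₐ[ℂ] (H →L[ℂ] H)} {Z : ℕ → ℕ → H →L[ℂ] H}
    (h : HasFam ρ Z) (hZ : IrrFam n n Z) : IsIrreducibleRep ρ := by
  refine ⟨hZ.1, fun K hK hinv => hZ.2 K hK fun d hd α hα v hv => ?_⟩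
  have e := h (Fin.rev ⟨d, hd⟩) ⟨α, hα⟩
  rw [Fin.rev_rev] at e
  have e' : Z d α = ρ (z q (Fin.rev ⟨d, hd⟩) ⟨α, hα⟩) := e.symm
  rw [e', ← map_star]
  exact ⟨hinv _ v hv, hinv _ v hv⟩

theorem HasFam.irrFam {ρ : Pol n q →⋆ₐ[ℂ] (H →L[ℂ] H)} {Z : ℕ → ℕ → H →L[ℂ] H}
    (h : HasFam ρ Z) (hρ : IsIrreducibleRep ρ) : IrrFam n n Z := by
  refine ⟨hρ.1, fun K hK hinv => hρ.2 K hK fun x => ?_⟩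
  induction x using pol_induction with
  | h0 c =>
    intro v hv
    rw [AlgHomClass.commutes ρ c]
    exact K.smul_mem c hv
  | hz a α => intro v hv; rw [h]; exact (hinv a.rev a.rev.2 α α.2 v hv).1
  | hzs a α => intro v hv; rw [h.star]; exact (hinv a.rev a.rev.2 α α.2 v hv).2
  | hadd x y hx hy => intro v hv; rw [map_add]; exact K.add_mem (hx v hv) (hy v hv)
  | hmul x y hx hy => intro v hv; rw [map_mul]; exact hx _ (hy v hv)

theorem HasFam.famEquiv {ρ : Pol n q →⋆ₐ[ℂ] (H →L[ℂ] H)} {ρ₂ : Pol n q →⋆ₐ[ℂ] (H₂ →L[ℂ] H₂)}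
    {Z : ℕ → ℕ → H →L[ℂ] H} {Z₂ : ℕ → ℕ → H₂ →L[ℂ] H₂} (h : HasFam ρ Z) (h₂ : HasFam ρ₂ Z₂)
    (hE : UnitarilyEquivalent ρ ρ₂) : FamEquiv n n Z Z₂ := by
  obtain ⟨U, hU⟩ := hE
  refine ⟨U, fun d hd α hα v => ?_⟩
  have e := h (Fin.rev ⟨d, hd⟩) ⟨α, hα⟩
  have e₂ := h₂ (Fin.rev ⟨d, hd⟩) ⟨α, hα⟩
  rw [Fin.rev_rev] at e e₂
  have e' : Z d α = ρ (z q (Fin.rev ⟨d, hd⟩) ⟨α, hα⟩) := e.symm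
  have e₂' : Z₂ d α = ρ₂ (z q (Fin.rev ⟨d, hd⟩) ⟨α, hα⟩) := e₂.symm
  rw [e', e₂', hU]

theorem HasFam.unitarilyEquivalent {ρ : Pol n q →⋆ₐ[ℂ] (H →L[ℂ] H)}
    {ρ₂ : Pol n q →⋆ₐ[ℂ] (H₂ →L[ℂ] H₂)} {Z : ℕ → ℕ → H →L[ℂ] H} {Z₂ : ℕ → ℕ → H₂ →L[ℂ] H₂}
    (h : HasFam ρ Z) (h₂ : HasFam ρ₂ Z₂) (hE : FamEquiv n n Z Z₂) :
    UnitarilyEquivalent ρ ρ₂ := by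
  obtain ⟨U, hU⟩ := hE
  have hs := FamEquiv.star hU
  refine ⟨U, fun x => ?_⟩
  induction x using pol_induction with
  | h0 c =>
    intro v
    rw [AlgHomClass.commutes ρ c, AlgHomClass.commutes ρ₂ c]
    exact U.map_smul c v
  | hz a α => intro v; rw [h, h₂, hU _ a.rev.2 _ α.2]
  | hzs a α => intro v; rw [h.star, h₂.star, hs _ a.rev.2 _ α.2]
  | hadd x y hx hy =>
    intro v
    rw [map_add, map_add, add_apply, map_add, hx, hy]; rfl
  | hmul x y hx hy =>
    intro v
    rw [map_mul, map_mul, clm_mul_apply, hx, hy]; rfl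

end Families

/-! ### The Fock representation -/

section Fock

variable {n : ℕ} {q : ℝ}

theorem gridPath_map {A A' : Type*} [Ring A] [StarRing A] [Algebra ℂ A] [StarModule ℂ A] [Ring A']
    [StarRing A'] [Algebra ℂ A'] [StarModule ℂ A'] (f : A →⋆ₐ[ℂ] A') (Q : ℂ) (a D : ℕ → ℕ → A)
    (r d α : ℕ) : f (gridPath Q a D r d α) =
      gridPath Q (fun r d => f (a r d)) (fun r d => f (D r d)) r d α := by
  induction r generalizing d with
  | zero => exact map_zero f
  | succ r ih =>
    have hrow : ∀ d, f (rowPath Q (a r) (D r) (fun d => gridPath Q a D r d α)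
        (if α = r then 1 else 0) d) = rowPath Q (fun d => f (a r d)) (fun d => f (D r d))
          (fun d => gridPath Q (fun r d => f (a r d)) (fun r d => f (D r d)) r d α)
          (if α = r then 1 else 0) d := by
      intro d
      induction d with
      | zero => simp only [rowPath]; split_ifs <;> simp
      | succ d ih' => simp only [rowPath, map_sub, map_mul, map_smul, map_star, ih', ih]
    rw [gridPath_succ, gridPath_succ, map_add, map_mul, map_mul, ih, hrow]

/-- The box in the row `r` at the distance `d` from the right side. -/
def boxAt {r d : ℕ} (hr : r < n) (hd : d < n) : Box n := (⟨r, hr⟩, ⟨n - (d + 1), by omega⟩)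

section PathSum

variable {a D : ℕ → ℕ → Ell2 (Box n) →L[ℂ] Ell2 (Box n)}
  (ha : ∀ r d (hr : r < n) (hd : d < n), a r d = T22 q (boxAt hr hd))
  (hD : ∀ r d (hr : r < n) (hd : d < n), D r d = opD q (boxAt hr hd))
include ha hD

theorem pathSum_left_eq (hq0 : 0 < q) (α : Fin n) {r : ℕ} (hr : r < n)
    (ih : ∀ d (hd : d < n), pathSum q α .below r (d + 1) hr.le hd =
      (-(q : ℂ)) ^ d • gridPath (q : ℂ) a D r d α) (d : ℕ) (hd : d ≤ n) :
    pathSum q α .left (r + 1) d hr hd = (-(q : ℂ)) ^ d •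
      rowPath (q : ℂ) (a r) (D r) (fun d => gridPath (q : ℂ) a D r d α)
        (if (α : ℕ) = r then 1 else 0) d := by
  have hQ : (q : ℂ) ≠ 0 := by exact_mod_cast hq0.ne'
  induction d with
  | zero =>
    rw [pathSum, pow_zero, one_smul, rowPath]
    by_cases h : (α : ℕ) = r
    · rw [if_pos h, if_pos (by omega)]
    · rw [if_neg h, if_neg (by omega)]
  | succ d ihd =>
    rw [pathSum, ihd (by omega), ih d (by omega), rowPath, ha r d hr hd, hD r d hr hd,
      star_T22 hq0, T12, boxAt]
    simp only [mul_smul_comm, smul_mul_assoc, smul_sub, smul_smul, pow_succ]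
    have : (-(q : ℂ)) ^ d * -(q : ℂ) * (q : ℂ)⁻¹ = -(-(q : ℂ)) ^ d := by field_simp
    rw [this, neg_smul, sub_neg_eq_add]

theorem pathSum_below_eq (hq0 : 0 < q) (α : Fin n) (r : ℕ) (hr : r ≤ n) (d : ℕ) (hd : d < n) :
    pathSum q α .below r (d + 1) hr hd = (-(q : ℂ)) ^ d • gridPath (q : ℂ) a D r d α := by
  induction r generalizing d with
  | zero => rw [pathSum, gridPath_zero, smul_zero]
  | succ r ih =>
    rw [pathSum, ih (by omega) d hd, pathSum_left_eq ha hD hq0 α hr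
        (fun d hd => ih (by omega) d hd),
      gridPath_succ, ha r d hr hd, hD r d hr hd, T21, boxAt]
    simp only [mul_smul_comm, smul_add]

/-- The sum over paths without normalization has the additional factor `(-q)^d` at distance `d` from
the right side, which the factor `(-q)^{a - n}` in the definition of the Fock representation
cancels. -/
theorem fockOp_eq_gridPath (hq0 : 0 < q) (x α : Fin n) :
    fockOp q x α = gridPath (q : ℂ) a D n x.rev α := by
  have hQ : (-(q : ℂ)) ≠ 0 := by rw [neg_ne_zero]; exact_mod_cast hq0.ne'
  have h := pathSum_below_eq ha hD hq0 α n le_rfl x.rev x.rev.2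
  have e : n - (x : ℕ) = x.rev + 1 := by rw [Fin.val_rev]; omega
  have h' : pathSum q α .below n (n - x) le_rfl (Nat.sub_le _ _) =
      pathSum q α .below n (x.rev + 1) le_rfl x.rev.2 := by congr 1
  rw [fockOp, h', h, smul_smul, ← zpow_natCast, ← zpow_add₀ hQ]
  have : (x : ℤ) + 1 - n + ((x.rev : Fin n) : ℕ) = 0 := by rw [Fin.val_rev]; omega
  rw [this, zpow_zero, one_smul]

end PathSum

/-- The position of a box: its row and its distance from the right side. -/
def boxPos (b : Box n) : ℕ × ℕ := (b.1, b.2.rev)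

theorem boxPos_injective : Function.Injective (boxPos : Box n → ℕ × ℕ) := by
  rintro ⟨i, j⟩ ⟨i', j'⟩ h
  obtain ⟨h1, h2⟩ := Prod.ext_iff.1 h
  exact Prod.ext (Fin.ext h1) (Fin.rev_injective (Fin.ext h2))

theorem boxPos_boxAt {r d : ℕ} (hr : r < n) (hd : d < n) : boxPos (boxAt hr hd) = (r, d) :=
  Prod.ext rfl (by simp only [boxPos, boxAt, Fin.val_rev]; omega)

/-- The family of operators of the Fock representation. -/
def fockFam (n : ℕ) (q : ℝ) : ℕ → ℕ → Ell2 (Box n) →L[ℂ] Ell2 (Box n) :=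
  gridFam q boxPos (grayPhase (fun _ => n) 0) n

theorem fockOp_eq_fockFam (hq0 : 0 < q) (x α : Fin n) : fockOp q x α = fockFam n q x.rev α :=
  fockOp_eq_gridPath (fun _ _ hr hd => boxA_of_eq boxPos_injective (boxPos_boxAt hr hd))
    (fun _ _ hr hd => boxD_of_eq boxPos_injective (boxPos_boxAt hr hd)) hq0 x α

theorem adm_const (n m : ℕ) : Adm (fun _ => n) 0 m n := by
  induction m with
  | zero => trivial
  | succ m ih =>
    refine ⟨le_rfl, ⟨le_rfl, Real.two_pi_pos⟩, fun _ => rfl, ?_⟩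
    rwa [nextCols, if_pos rfl]

theorem fockFam_irrFam (hq0 : 0 < q) (hq1 : q < 1) : IrrFam n n (fockFam n q) := by
  have hQ : (q : ℂ) ≠ 0 := by exact_mod_cast hq0.ne'
  refine Iter.irr hQ (fun j => phase_ne_zero _) n _ _ _ (gridFam_iter hq0 hq1 n (Box n) boxPos
    boxPos_injective (fun i hi d hd => ⟨boxAt hi hd, boxPos_boxAt hi hd⟩)
    (fun b => ⟨b.1.2, b.2.rev.2⟩) n (adm_const n n))

theorem fockFam_isQMat (hq0 : 0 < q) (hq1 : q < 1) : IsQMat q n n (fockFam n q) :=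
  (boxRel hq0 hq1 boxPos_injective (norm_grayPhase _ _)).qMatRel (by exact_mod_cast hq0.ne')
    (Complex.conj_ofReal q) n n

/-- A path goes upwards with `T₂₁`, which fixes the vacuum, until it turns to the right in some box
with `T₂₂`, whose adjoint annihilates the vacuum. -/
theorem star_fockFam_basisVec (hq0 : 0 < q) (hq1 : q < 1) {d : ℕ} (hd : d < n) (α : ℕ) :
    star (fockFam n q d α) (basisVec 0) = 0 := by
  have key : ∀ r ≤ n, star (gridFam q (boxPos (n := n)) (grayPhase (fun _ => n) 0) r d α)
      (basisVec 0) = 0 := by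
    intro r
    induction r with
    | zero => intro _; rw [gridFam, gridPath_zero, star_zero]; rfl
    | succ r ih =>
      intro hr
      have hb := boxPos_boxAt (n := n) hr hd
      rw [gridFam, gridPath_succ, star_add, star_mul, star_mul, boxA_of_eq boxPos_injective hb,
        boxD_of_eq boxPos_injective hb, star_opD hq0 hq1, star_T22 hq0,
        add_apply, clm_mul_apply, clm_mul_apply, opD_basisVec hq0 hq1,
        T11_of_eq_zero hq0 (m := 0) rfl, map_zero, add_zero, map_smul]
      exact (congrArg _ (ih (by omega))).trans (smul_zero _)
  exact key n le_rfl

/-- The operators `T₂₂` of the boxes as elements of `C^*(S)^{⊗ n²}`, extended by the scalars `c` to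
the positions outside the grid. -/
def toeplitzA (hq0 : 0 < q) (hq1 : q < 1) (c : ℕ → ℕ → ℂ) (r d : ℕ) : Toeplitz (Box n) :=
  if h : r < n ∧ d < n then ⟨_, T22_mem_toeplitz hq0 hq1 (boxAt h.1 h.2)⟩ else c r d • 1

/-- The operators `T₂₁` of the boxes as elements of `C^*(S)^{⊗ n²}`. -/
def toeplitzD (hq0 : 0 < q) (hq1 : q < 1) (r d : ℕ) : Toeplitz (Box n) :=
  if h : r < n ∧ d < n then ⟨_, opD_mem_toeplitz hq0 hq1 (boxAt h.1 h.2)⟩ else 0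

theorem fockOp_eq_coe (hq0 : 0 < q) (hq1 : q < 1) (c : ℕ → ℕ → ℂ) (x α : Fin n) :
    fockOp q x α =
      (gridPath (q : ℂ) (toeplitzA hq0 hq1 c) (toeplitzD hq0 hq1) n x.rev α : Toeplitz (Box n)) := by
  have := gridPath_map (Toeplitz (Box n)).subtype (q : ℂ) (toeplitzA hq0 hq1 c)
    (toeplitzD hq0 hq1) n x.rev α
  refine (fockOp_eq_gridPath (fun r d hr hd => ?_) (fun r d hr hd => ?_) hq0 x α).trans this.symm
  · simp only [toeplitzA, dif_pos (show r < n ∧ d < n from ⟨hr, hd⟩)]; rfl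
  · simp only [toeplitzD, dif_pos (show r < n ∧ d < n from ⟨hr, hd⟩)]; rfl

theorem fockOp_mem_toeplitz (hq0 : 0 < q) (hq1 : q < 1) (x α : Fin n) :
    fockOp q x α ∈ Toeplitz (Box n) :=
  fockOp_eq_coe hq0 hq1 0 x α ▸ Subtype.property _

/-- An irreducible representation has no closed invariant subspaces, so that every non-zero vector
is cyclic. -/
theorem IsIrreducibleRep.dense_range {H : Type*} [NormedAddCommGroup H] [InnerProductSpace ℂ H]
    [CompleteSpace H] {ρ : Pol n q →⋆ₐ[ℂ] (H →L[ℂ] H)} (h : IsIrreducibleRep ρ) {v : H}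
    (hv : v ≠ 0) : Dense (Set.range fun x => ρ x v) := by
  let f : Pol n q →ₗ[ℂ] H :=
    { toFun := fun x => ρ x v
      map_add' := fun x y => by rw [map_add]; rfl
      map_smul' := fun c x => by rw [map_smul]; rfl }
  have hK := h.2 (LinearMap.range f).topologicalClosure
    (Submodule.isClosed_topologicalClosure _) fun a => by
      have : Set.MapsTo (ρ a) (LinearMap.range f) (LinearMap.range f) := by
        rintro _ ⟨x, rfl⟩
        exact ⟨a * x, by simp only [f, LinearMap.coe_mk, AddHom.coe_mk, map_mul, clm_mul_apply]⟩
      exact this.closure (ρ a).continuous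
  have h1 : v ∈ (LinearMap.range f).topologicalClosure :=
    Submodule.le_topologicalClosure _ ⟨1, by simp [f]⟩
  rcases hK with hK | hK
  · rw [hK] at h1
    exact absurd h1 hv
  · intro w
    have : w ∈ (LinearMap.range f).topologicalClosure := by rw [hK]; trivial
    exact this

end Fock

/-! ### The representations of the admissible sequences -/

section Grid

variable {n : ℕ} {q : ℝ} (κ : AdmissibleSeq n)

theorem AdmissibleSeq.exists_isCharacterMap : ∃ θ, κ.IsCharacterMap θ := by
  classical
  exact exists_character_map (p := κ.IsWhite)
    (u := fun b => Complex.exp (Complex.I * (κ.angle b : ℂ))) fun b => norm_phase _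

theorem AdmissibleSeq.IsCharacterMap.unique {κ : AdmissibleSeq n}
    {θ θ' : Toeplitz (Box n) →⋆ₐ[ℂ] (Ell2 κ.White →L[ℂ] Ell2 κ.White)} (h : κ.IsCharacterMap θ)
    (h' : κ.IsCharacterMap θ') : θ = θ' := by
  refine toeplitz_hom_ext fun b => ?_
  by_cases hb : κ.IsWhite b
  · exact (h.1 ⟨b, hb⟩).trans (h'.1 ⟨b, hb⟩).symm
  · exact (h.2 b hb).trans (h'.2 b hb).symm

/-- The position of a white box. -/
def AdmissibleSeq.whitePos (b : κ.White) : ℕ × ℕ := boxPos b.1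

theorem AdmissibleSeq.whitePos_injective : Function.Injective κ.whitePos :=
  boxPos_injective.comp Subtype.val_injective

theorem AdmissibleSeq.isWhite_iff (b : Box n) :
    κ.IsWhite b ↔ (b.2.rev : ℕ) < extend κ.k b.1 := by
  rw [AdmissibleSeq.IsWhite, extend_of_lt _ b.1.2, Fin.val_rev]
  have := b.2.2
  simp only [Fin.eta]
  omega

/-- The family of operators of the representation that belongs to an admissible sequence. -/
def AdmissibleSeq.fam (q : ℝ) : ℕ → ℕ → Ell2 κ.White →L[ℂ] Ell2 κ.White :=
  gridFam q κ.whitePos (grayPhase (extend κ.k) (extend κ.φ)) n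

/-- The rows of the grid of an admissible sequence are added to each other. -/
theorem AdmissibleSeq.fam_iter (hq0 : 0 < q) (hq1 : q < 1) :
    Iter q (extend κ.k) (fun j => phase (extend κ.φ j)) n n (Ell2 κ.White) (κ.fam q) := by
  classical
  refine gridFam_iter hq0 hq1 n κ.White κ.whitePos κ.whitePos_injective (fun i hi d hd => ?_)
    (fun b => ⟨b.1.1.2, (κ.isWhite_iff b.1).1 b.2⟩) n κ.adm
  have hdn : d < n := hd.trans_le (κ.adm.le i hi)
  have hp := boxPos_boxAt hi hdn
  refine ⟨⟨boxAt hi hdn, (κ.isWhite_iff _).2 ?_⟩, hp⟩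
  obtain ⟨h1, h2⟩ := Prod.ext_iff.1 hp
  change (boxAt hi hdn).2.rev.val = d at h2
  rw [h2]
  exact hd

/-- The phases of the gray boxes, in terms of their positions. -/
theorem AdmissibleSeq.phase_angle (b : Box n) (hb : ¬ κ.IsWhite b) :
    Complex.exp (Complex.I * (κ.angle b : ℂ)) =
      grayPhase (extend κ.k) (extend κ.φ) b.1 b.2.rev := by
  have := b.2.2
  rw [grayPhase, extend_of_lt _ b.1.2, extend_of_lt _ b.1.2, AdmissibleSeq.angle, Fin.val_rev]
  simp only [Fin.eta]
  by_cases h : (b.2 : ℕ) + κ.k b.1 + 1 = n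
  · rw [if_pos h, if_pos (by omega), phase]
  · rw [if_neg h, if_neg (by omega)]; simp

/-- The character map takes the Fock representation to the operators of the grid of `κ`. -/
theorem AdmissibleSeq.IsCharacterMap.apply_fockOp (hq0 : 0 < q) (hq1 : q < 1)
    {κ : AdmissibleSeq n}
    {θ : Toeplitz (Box n) →⋆ₐ[ℂ] (Ell2 κ.White →L[ℂ] Ell2 κ.White)} (h : κ.IsCharacterMap θ)
    (x α : Fin n) :
    θ ⟨fockOp q x α, fockOp_mem_toeplitz hq0 hq1 x α⟩ = κ.fam q x.rev α := by
  have e : (⟨fockOp q x α, fockOp_mem_toeplitz hq0 hq1 x α⟩ : Toeplitz (Box n)) = gridPath (q : ℂ)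
      (toeplitzA hq0 hq1 (grayPhase (extend κ.k) (extend κ.φ))) (toeplitzD hq0 hq1) n x.rev α :=
    Subtype.ext (fockOp_eq_coe hq0 hq1 _ x α)
  have cases : ∀ r d, (∃ b : κ.White, κ.whitePos b = (r, d) ∧ ∃ h : r < n ∧ d < n,
        b.1 = boxAt h.1 h.2) ∨ (∀ b : κ.White, κ.whitePos b ≠ (r, d)) ∧
        ∀ h : r < n ∧ d < n, ¬ κ.IsWhite (boxAt h.1 h.2) := by
    intro r d
    by_cases hrd : ∃ b : κ.White, κ.whitePos b = (r, d)
    · obtain ⟨b, hb⟩ := hrd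
      refine Or.inl ⟨b, hb, ?_⟩
      obtain ⟨h1, h2⟩ := Prod.ext_iff.1 hb
      have hr : r < n := lt_of_eq_of_lt h1.symm b.1.1.2
      have hd : d < n := lt_of_eq_of_lt h2.symm b.1.2.rev.2
      exact ⟨⟨hr, hd⟩, boxPos_injective (hb.trans (boxPos_boxAt hr hd).symm)⟩
    · push Not at hrd
      exact Or.inr ⟨hrd, fun h hw => hrd ⟨_, hw⟩ (boxPos_boxAt h.1 h.2)⟩
  have hgray : ∀ r d, ∀ h' : r < n ∧ d < n, ¬ κ.IsWhite (boxAt h'.1 h'.2) →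
      θ (toeplitzGen (boxAt h'.1 h'.2)) =
        grayPhase (extend κ.k) (extend κ.φ) r d • 1 := by
    intro r d h' hb
    obtain ⟨h1, h2⟩ := Prod.ext_iff.1 (boxPos_boxAt h'.1 h'.2)
    change (boxAt h'.1 h'.2).2.rev.val = d at h2
    rw [h.2 _ hb, κ.phase_angle _ hb, h2]
    rfl
  have huni : ∀ r d, (grayPhase (extend κ.k) (extend κ.φ) r d • (1 : Ell2 κ.White →L[ℂ] Ell2 κ.White)) *
      star (grayPhase (extend κ.k) (extend κ.φ) r d • 1) = 1 := by
    intro r d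
    rw [star_smul, smul_mul_smul_comm, Complex.star_def, Complex.mul_conj,
      Complex.normSq_eq_norm_sq, norm_grayPhase]
    simp
  rw [e, gridPath_map]
  have hA : (fun r d => θ (toeplitzA hq0 hq1 (grayPhase (extend κ.k) (extend κ.φ)) r d)) =
      boxA q κ.whitePos (grayPhase (extend κ.k) (extend κ.φ)) := by
    funext r d
    rcases cases r d with ⟨b, hb, h', hb'⟩ | ⟨hb, hb'⟩
    · rw [boxA_of_eq κ.whitePos_injective hb]
      simp only [toeplitzA, dif_pos h']
      exact toeplitz_hom_T22_of_shift hq0 hq1 (by rw [← hb']; exact h.1 b)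
    · rw [boxA_of_not hb]
      by_cases h' : r < n ∧ d < n
      · simp only [toeplitzA, dif_pos h']
        rw [toeplitz_hom_T22_of_unitary hq0 hq1, hgray r d h' (hb' h')]
        rw [hgray r d h' (hb' h')]
        exact huni r d
      · simp only [toeplitzA, dif_neg h']
        rw [map_smul, map_one]
  have hDD : (fun r d => θ (toeplitzD hq0 hq1 r d)) = boxD q κ.whitePos := by
    funext r d
    rcases cases r d with ⟨b, hb, h', hb'⟩ | ⟨hb, hb'⟩
    · rw [boxD_of_eq κ.whitePos_injective hb]
      simp only [toeplitzD, dif_pos h']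
      exact toeplitz_hom_opD_of_shift hq0 hq1 (by rw [← hb']; exact h.1 b)
    · rw [boxD_of_not hb]
      by_cases h' : r < n ∧ d < n
      · simp only [toeplitzD, dif_pos h']
        refine toeplitz_hom_opD_of_unitary hq0 hq1 ?_
        rw [hgray r d h' (hb' h')]
        exact huni r d
      · simp only [toeplitzD, dif_neg h']
        rw [map_zero]
  rw [hA, hDD]
  rfl

end Grid

section GridRepresentations

variable {n : ℕ} {q : ℝ}

/-- The grid representation of an admissible sequence is the composition of the Fock representation
with the character map. -/
theorem AdmissibleSeq.exists_gridRep (hq0 : 0 < q) (hq1 : q < 1)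
    {F : Pol n q →⋆ₐ[ℂ] (Ell2 (Box n) →L[ℂ] Ell2 (Box n))} (hF : IsFock F) (κ : AdmissibleSeq n) :
    ∃ π : Pol n q →⋆ₐ[ℂ] (Ell2 κ.White →L[ℂ] Ell2 κ.White),
      (∀ ρ, κ.IsGridRep F ρ ↔ ρ = π) ∧ HasFam π (κ.fam q) := by
  obtain ⟨θ, hθ⟩ := κ.exists_isCharacterMap
  have hmem : ∀ x, F x ∈ Toeplitz (Box n) := rep_mem _ F fun a α => by
    rw [hF]; exact fockOp_mem_toeplitz hq0 hq1 a α
  refine ⟨θ.comp (F.codRestrict (Toeplitz (Box n)) hmem), fun ρ => ⟨?_, ?_⟩, fun a α => ?_⟩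
  · rintro ⟨θ', hθ', h⟩
    obtain rfl := hθ.unique hθ'
    ext1 x
    exact (h x).2
  · rintro rfl
    exact ⟨θ, hθ, fun x => ⟨hmem x, rfl⟩⟩
  · rw [← hθ.apply_fockOp hq0 hq1 a α]
    exact congrArg θ (Subtype.ext (hF a α))

end GridRepresentations
end QMat
end

theorem theorem3p1 (n : ℕ) (q : ℝ) (hq0 : 0 < q) (hq1 : q < 1) :
    -- the Fock representation: it exists, and `e_0 ⊗ ⋯ ⊗ e_0` is a cyclic vacuum vector
    ∃ F : Pol n q →⋆ₐ[ℂ] (Ell2 (Box n) →L[ℂ] Ell2 (Box n)),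
      IsFock F ∧
      (∀ a α : Fin n, F (star (z q a α)) (basisVec 0) = 0) ∧
      Dense (Set.range fun x : Pol n q => F x (basisVec 0)) ∧
      -- the representations attached to admissible sequences: they exist and are unique
      ∃ π : (κ : AdmissibleSeq n) → (Pol n q →⋆ₐ[ℂ] (Ell2 κ.White →L[ℂ] Ell2 κ.White)),
        (∀ (κ : AdmissibleSeq n) (ρ : Pol n q →⋆ₐ[ℂ] (Ell2 κ.White →L[ℂ] Ell2 κ.White)),
          κ.IsGridRep F ρ ↔ ρ = π κ) ∧
        -- they are irreducible, so that `κ ↦ [π κ]` is a map to classes of irreducibles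
        (∀ κ : AdmissibleSeq n, IsIrreducibleRep (π κ)) ∧
        -- this map is injective
        (∀ κ κ' : AdmissibleSeq n, UnitarilyEquivalent (π κ) (π κ') → κ = κ') ∧
        -- this map is surjective
        (∀ (H : Type*) [NormedAddCommGroup H] [InnerProductSpace ℂ H] [CompleteSpace H]
          (ρ : Pol n q →⋆ₐ[ℂ] (H →L[ℂ] H)), IsIrreducibleRep ρ →
          ∃ κ : AdmissibleSeq n, UnitarilyEquivalent (π κ) ρ) := by
  have hq : q ≠ 0 := hq0.ne'
  have hQ : (q : ℂ) ≠ 0 := by exact_mod_cast hq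
  obtain ⟨F, hF⟩ := (fockFam_isQMat (n := n) hq0 hq1).exists_rep hq
  have hFock : IsFock F := fun a α => (hF a α).trans (fockOp_eq_fockFam hq0 a α).symm
  choose π hπ hfam using AdmissibleSeq.exists_gridRep hq0 hq1 hFock
  refine ⟨F, hFock, fun a α => ?_, ?_, π, hπ, fun κ => ?_, fun κ κ' hE => ?_, ?_⟩
  · rw [hF.star]
    exact star_fockFam_basisVec hq0 hq1 a.rev.2 α
  · exact (hF.isIrreducibleRep (fockFam_irrFam hq0 hq1)).dense_range (basisVec_ne_zero 0)
  · exact (hfam κ).isIrreducibleRep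
      (Iter.irr hQ (fun j => phase_ne_zero _) n n _ _ (κ.fam_iter hq0 hq1))
  · have h := Iter.invariants hQ n n _ _ _ _ (κ.fam_iter hq0 hq1) (κ'.fam_iter hq0 hq1) κ.adm κ'.adm
      ((hfam κ).famEquiv (hfam κ') hE)
    refine AdmissibleSeq.ext (funext fun j => ?_) (funext fun j => ?_)
    · have := (h j j.2).1
      rwa [extend_of_lt _ j.2, extend_of_lt _ j.2] at this
    · have := (h j j.2).2
      rwa [extend_of_lt _ j.2, extend_of_lt _ j.2] at this
  · intro H _ _ _ ρ hρ
    obtain ⟨Z, hZ⟩ := exists_hasFam ρ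
    obtain ⟨k, φ, hA, hI⟩ := (hZ.irrFam hρ).exists_iter hq0 hq1 n n H Z (hZ.isQMat hq)
    obtain ⟨κ, hκ⟩ := hA.exists_admissibleSeq
    refine ⟨κ, (hfam κ).unitarilyEquivalent hZ
      (Iter.famEquiv n n _ _ _ _ (κ.fam_iter hq0 hq1) (hI.congr n n H Z fun j hj => ?_))⟩
    rw [extend_of_lt _ hj, extend_of_lt _ hj, (hκ j hj).1, (hκ j hj).2]
    exact ⟨rfl, rfl⟩
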